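/- A \emph{loose graph} $\Gamma=(V,E)$ is a finite simple graph in which edges with only one or no end vertex (loose edges) are also allowed, the latter possibly in parallel. Its completion $\overline\Gamma$ is obtained by giving every edge the end vertices it lacks, as new vertices. Let $k$ be a field and let $\mathbb{P}_k$ be the projective space over $k$ with one homogeneous coordinate for every vertex of $\overline\Gamma$. For $v\in V$ let $\mathbb{A}_v\subseteq\mathbb{P}_k$ be the affine space of dimension $\deg(v)$ on which the $v$-coordinate is nonzero and all coordinates other than that of $v$ and of its neighbours in $\overline\Gamma$ vanish; for an edge $e$ without end vertices in $\Gamma$ let $\mathbb{G}_e\cong\mathbb{G}_m$ be the locus in $\mathbb{P}_k$ on which precisely the coordinates of the two new ends of $e$ are nonzero. Then $\mathcal{X}_k=\mathcal{F}(\Gamma)\otimes_{\mathbb{F}_1}k$ is the union in $\mathbb{P}_k$ of all $\mathbb{A}_v$ and all $\mathbb{G}_e$, with the topology (on all scheme points) induced by the Zariski topology of $\mathbb{P}_k$. The \emph{combinatorial automorphism group} $\mathrm{Aut}^{\mathrm{comb}}(\mathcal{X}_k)$ is the automorphism group of the following incidence geometry: the points are the $k$-rational points of $\mathcal{X}_k$;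 the lines are the lines over $k$ of $\mathbb{P}_k$ that are contained in $\mathcal{X}_k$ or meet $\mathcal{X}_k$ in the whole line minus exactly one point; an automorphism is a pair consisting of a permutation of the points and a permutation of the lines that preserves incidence in both directions. The \emph{topological automorphism group} $\mathrm{Aut}^{\mathrm{top}}(\mathcal{X}_k)$ is the group of homeomorphisms of the underlying topological space of $\mathcal{X}_k$. \textbf{Proposition.} Assume that $k\neq\mathbb{F}_2$, or that every vertex of $\Gamma$ of degree at least $3$ is on at most one loose edge. Then there is an injective group homomorphism $$\varphi:\mathrm{Aut}^{\mathrm{comb}}(\mathcal{X}_k)\hookrightarrow\mathrm{Aut}^{\mathrm{top}}(\mathcal{X}_k).$$ If moreover $\Gamma$ has no edge without end vertices, or has exactly one such edge and no isolated vertex, then $\varphi$ can be chosen such that for every $g\in\mathrm{Aut}^{\mathrm{comb}}(\mathcal{X}_k)$ the homeomorphism $\varphi(g)$ extends the action of $g$ on the $k$-rational points. -/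

import Mathlib

open MvPolynomial

attribute [local instance] MvPolynomial.gradedAlgebra

/-- A loose graph with vertex type `V` and edge type `E`: a simple graph in which an edge may have
two, one or zero end vertices.  Edges with fewer than two end vertices (loose edges) may be
parallel; two edges with the same two end vertices coincide. -/
structure LooseGraph (V E : Type*) where
  /-- the set of end vertices of an edge -/
  ends : E → Finset V
  card_ends_le : ∀ e, (ends e).card ≤ 2
  eq_of_ends_eq : ∀ e e', (ends e).card = 2 → ends e = ends e' → e = e'

namespace LooseGraph

variable {V E : Type*} (Γ : LooseGraph V E)

/-- The vertices of the completion of `Γ`: every edge receives as many new end vertices as it lacks,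
so that it has exactly two of them.  They are the homogeneous coordinates of the ambient projective
space. -/
abbrev Completion : Type _ := V ⊕ (Σ e : E, Fin (2 - (Γ.ends e).card))

/-- The two end vertices of the edge `e` in the completion. -/
def completedEnds (e : E) : Set Γ.Completion :=
  {i | (∃ v ∈ Γ.ends e, i = Sum.inl v) ∨ ∃ j, i = Sum.inr ⟨e, j⟩}

/-- The loose star of `v` in the completion: `v` itself, and all ends of the edges on `v`.
It has `deg v + 1` elements. -/
def looseStar (v : V) : Set Γ.Completion :=
  {i | i = Sum.inl v ∨ ∃ e, v ∈ Γ.ends e ∧ i ∈ Γ.completedEnds e}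

/-- The points of the scheme over `𝔽₁` of `Γ`, as a subset of the points of the projective
`𝔽₁`-space on the vertices of the completion.  A point of the latter is a nonempty set `S` of
coordinates, namely of those that do not vanish at the point.
A vertex `v` contributes the affine space `Spec 𝔽₁[Xᵢ]`, with one coordinate direction for every
edge on `v` and with origin `v`; an edge without end vertices contributes a multiplicative group. -/
def monoidalPoints : Set (Set Γ.Completion) :=
  {S | (∃ v : V, Sum.inl v ∈ S ∧ S ⊆ Γ.looseStar v) ∨
    ∃ e : E, Γ.ends e = ∅ ∧ S = Γ.completedEnds e}

variable (k : Type*) [Field k]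

/-- The ambient projective space over `k` of `Γ`: the space of relevant homogeneous prime ideals of
the polynomial ring on the vertices of the completion, with the Zariski topology. -/
abbrev Ambient : Type _ :=
  ProjectiveSpectrum (homogeneousSubmodule Γ.Completion k)

variable {Γ k} in
/-- The set of homogeneous coordinates that do not vanish at a point of the ambient space, that is,
the image of the point under the projection from the projective space over `k` to the one
over `𝔽₁`. -/
def support (p : Γ.Ambient k) : Set Γ.Completion :=
  {i | (X i : MvPolynomial Γ.Completion k) ∉ p.asHomogeneousIdeal}

/-- (The underlying space of) the scheme over `k` of `Γ`, the base change of the scheme over `𝔽₁`: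
the union in the ambient projective space of the affine spaces of the vertices and of the
multiplicative groups of the edges without end vertices.  The coercion to a type carries the
topology induced by the Zariski topology of the ambient space. -/
def schemeOver : Set (Γ.Ambient k) := {p | support p ∈ Γ.monoidalPoints}

variable [Fintype V] [Fintype E]

variable {Γ k} in
/-- The linear subscheme of the ambient projective space of a subspace `W` of the space of
coordinate vectors: the common zeros of the linear forms that vanish on `W`. -/
def linearLocus (W : Submodule k (Γ.Completion → k)) : Set (Γ.Ambient k) :=
  ProjectiveSpectrum.zeroLocus _
    {f | ∃ a : Γ.Completion → k, (∀ w ∈ W, ∑ i, a i * w i = 0) ∧ f = ∑ i, C (a i) * X i}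

/-- The `k`-rational points of the scheme. -/
def RationalPoint : Type _ :=
  {p : Γ.schemeOver k //
    ∃ W : Submodule k (Γ.Completion → k), Module.finrank k W = 1 ∧ p.1 ∈ linearLocus W}

/-- The lines of the scheme: the lines over `k` of the ambient projective space that are contained
in the scheme (projective lines), or that meet it in the whole line minus one point (complete affine
lines, represented by their projective completions). -/
def Line : Type _ :=
  {W : Submodule k (Γ.Completion → k) // Module.finrank k W = 2 ∧
    (linearLocus W ⊆ Γ.schemeOver k ∨
      ∃ q ∈ linearLocus W, linearLocus W ∩ Γ.schemeOver k = linearLocus W \ {q})}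

variable {Γ k} in
/-- Incidence of a rational point and a line. -/
def Incident (p : Γ.RationalPoint k) (L : Γ.Line k) : Prop :=
  p.1.1 ∈ linearLocus L.1

/-- The combinatorial automorphism group: the automorphisms of the incidence geometry of rational
points and lines, that is, pairs of a permutation of the points and a permutation of the lines that
respect incidence (in both directions). -/
def combAut : Subgroup (Equiv.Perm (Γ.RationalPoint k) × Equiv.Perm (Γ.Line k)) where
  carrier := {g | ∀ p L, Incident (g.1 p) (g.2 L) ↔ Incident p L}
  one_mem' := fun _ _ => Iff.rfl
  mul_mem' := fun {g h} hg hh p L => (hg (h.1 p) (h.2 L)).trans (hh p L)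
  inv_mem' := fun {g} hg p L => by
    have := hg (g.1⁻¹ p) (g.2⁻¹ L)
    simpa using this.symm

end LooseGraph

/-!
Homogeneous coordinates turn the incidence geometry into linear algebra.  A rational point on some
line is a vector whose support is *dominated*: it contains a vertex `v` and is contained in the
loose star of `v`, where `v` has at least one edge.  A line is a plane of vectors for which the union
of the supports is dominated (`LooseGraph.isLn_of_line`, `LooseGraph.IsLn.line`).  That the lines of
the geometry are no others holds over every field, because all scheme points count: a line over a
finite field also has infinitely many points on no unnecessary coordinate hyperplane
(`ProjectiveSpectrum.infinite_setOf_moduleSupport_eq`).  The rational points on no line are isolated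
vertices and points of multiplicative groups, and a combinatorial automorphism permutes them
arbitrarily.

*Components of dimension at least two.*  On the affine space of a vertex with at least two edges, a
combinatorial automorphism is semilinear.  The images of all lines in one coordinate direction meet
in one point, which is the image of the vertex in this direction or, for a loose edge, is found by a
trapezoid argument that needs three scalars (`Collineation.exists_isDirection`); then the
argument of the fundamental theorem of projective geometry applies
(`IsLineation.exists_semilinear`).  Over the field with two elements, linearity follows directly if at
most one direction is loose, and every permutation of an affine plane is affine; this is where the
hypothesis is used (`Collineation.exists_realizes`).  The semilinear map takes maximal coordinate
subspaces to maximal ones, and dominated subspaces to dominated ones, so that it acts on the scheme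
points of the component (`Realizes.exists_map_eq`, `Realizes.isDominated_map`).

*Components of dimension one.*  The rational points of the projective or affine line of a vertex
whose star has two elements may be permuted arbitrarily.  The other points of this line are mapped
by a standard identification of its coordinates with those of the image line.  The result is a
homeomorphism since the proper closed subsets of a projective line are finite
(`LooseGraph.continuousOn_of_generic`).

*Gluing.*  Where two components meet, the semilinear maps agree on rational points up to scalars, and
hence, on the linear span of a point which is not rational, up to one scalar and with the same field
automorphism; so they act in the same way on this point (`IsCompatible.act_eq_act`).  For the same
reason the action is multiplicative.  It is continuous since it is so on finitely many closed sets
that cover the scheme (`LooseGraph.continuous_schemeMap`).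

*Isolated rational points.*  If there are several multiplicative groups, or one and an isolated
vertex, then a permutation of the rational points on no line need not extend to a homeomorphism.
These points are instead re-embedded among the non-generic points of one multiplicative group, all of
whose permutations are continuous (`LooseGraph.exists_isPlacement`); otherwise they are left in place
(`LooseGraph.isPlacement_inclusion`).  Injectivity holds as a combinatorial automorphism is determined
by its action on the rational points (`LooseGraph.eq_one_of_forall_eq`).
-/

/-! ### Coordinate subspaces and semilinear automorphisms -/

section Linear

variable {k : Type*} [Field k] {C : Type*}

/-- The subspace of the vectors whose support is contained in `S`. -/
def coordSubspace (k : Type*) [Field k] {C : Type*} (S : Set C) : Submodule k (C → k) where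
  carrier := {x | ∀ i, x i ≠ 0 → i ∈ S}
  add_mem' := by
    intro x y hx hy i hi
    by_cases h : x i = 0
    · exact hy i (by simpa [h] using hi)
    · exact hx i h
  zero_mem' := by simp
  smul_mem' := by
    intro c x hx i hi
    exact hx i (fun h => hi (by simp [h]))

theorem mem_coordSubspace {S : Set C} {x : C → k} :
    x ∈ coordSubspace k S ↔ Function.support x ⊆ S := Iff.rfl

theorem coordSubspace_mono {S T : Set C} (h : S ⊆ T) : coordSubspace k S ≤ coordSubspace k T :=
  fun _ hx i hi => h (hx i hi)

theorem indicator_one_mem_coordSubspace {S T : Set C} :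
    Set.indicator S (1 : C → k) ∈ coordSubspace k T ↔ S ⊆ T := by
  rw [mem_coordSubspace]
  simp [Function.support_one]

theorem support_indicator_one (S : Set C) : Function.support (Set.indicator S (1 : C → k)) = S := by
  simp [Function.support_one]

theorem coordSubspace_le_iff {S T : Set C} : coordSubspace k S ≤ coordSubspace k T ↔ S ⊆ T := by
  refine ⟨fun h => ?_, coordSubspace_mono⟩
  have := h (indicator_one_mem_coordSubspace (S := S) (T := S).2 subset_rfl)
  exact indicator_one_mem_coordSubspace.1 this

theorem coordSubspace_injective {S T : Set C} (h : coordSubspace k S = coordSubspace k T) :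
    S = T :=
  (coordSubspace_le_iff.1 h.le).antisymm (coordSubspace_le_iff.1 h.ge)

/-- A coordinate subspace is the span of its coordinate vectors. -/
theorem coordSubspace_le_of_indicator_mem [Finite C] {S : Set C} {P : Submodule k (C → k)}
    (h : ∀ i ∈ S, Set.indicator {i} (1 : C → k) ∈ P) : coordSubspace k S ≤ P := by
  classical
  have := Fintype.ofFinite C
  intro x hx
  have : x = ∑ i, x i • Set.indicator {i} (1 : C → k) := by
    ext j
    simp [Finset.sum_apply, Pi.single_apply]
  rw [this]
  refine P.sum_mem fun i _ => ?_
  by_cases hi : x i = 0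
  · simp [hi]
  · exact P.smul_mem _ (h i (hx i hi))

theorem coordSubspace_pair [Finite C] (i j : C) :
    coordSubspace k {i, j} =
      Submodule.span k {Set.indicator {i} (1 : C → k), Set.indicator {j} 1} := by
  apply le_antisymm
  · apply coordSubspace_le_of_indicator_mem
    rintro l (rfl | rfl) <;> exact Submodule.subset_span (by simp)
  · rw [Submodule.span_le]
    rintro z (rfl | rfl) <;> exact indicator_one_mem_coordSubspace.2 (by simp)

theorem finrank_coordSubspace [Finite C] (S : Set C) :
    Module.finrank k (coordSubspace k S) = S.ncard := by
  classical
  have := Fintype.ofFinite C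
  let e : coordSubspace k S ≃ₗ[k] (S → k) :=
    { toFun := fun x i => x.1 i
      map_add' := fun _ _ => rfl
      map_smul' := fun _ _ => rfl
      invFun := fun y => ⟨fun i => if h : i ∈ S then y ⟨i, h⟩ else 0, by
        intro i hi
        by_contra h
        exact hi (dif_neg h)⟩
      left_inv := by
        intro x
        ext i
        by_cases h : i ∈ S
        · simp [h]
        · have : x.1 i = 0 := by
            by_contra h0
            exact h (x.2 i h0)
          simp [h, this]
      right_inv := by
        intro y
        ext i
        simp }
  rw [e.finrank_eq, Module.finrank_fintype_fun_eq_card, ← Nat.card_eq_fintype_card,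
    Nat.card_coe_set_eq]

/-- The union of the supports of the vectors of a subspace. -/
def moduleSupport (W : Submodule k (C → k)) : Set C := {i | ∃ x ∈ W, x i ≠ 0}

theorem moduleSupport_subset_iff {W : Submodule k (C → k)} {S : Set C} :
    moduleSupport W ⊆ S ↔ W ≤ coordSubspace k S :=
  ⟨fun h x hx _ hi => h ⟨x, hx, hi⟩, fun h _ ⟨_, hx, hi⟩ => h hx _ hi⟩

theorem support_subset_moduleSupport {W : Submodule k (C → k)} {x : C → k} (hx : x ∈ W) :
    Function.support x ⊆ moduleSupport W := fun _ hi => ⟨x, hx, hi⟩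

theorem moduleSupport_coordSubspace (S : Set C) : moduleSupport (coordSubspace k S) = S := by
  refine (moduleSupport_subset_iff.2 le_rfl).antisymm fun i hi => ?_
  exact ⟨Set.indicator {i} 1, indicator_one_mem_coordSubspace.2 (by simpa using hi), by simp⟩

theorem moduleSupport_span_pair (x y : C → k) :
    moduleSupport (Submodule.span k {x, y}) = Function.support x ∪ Function.support y := by
  refine (moduleSupport_subset_iff.2 ?_).antisymm (Set.union_subset ?_ ?_)
  · rw [Submodule.span_le]
    rintro z (rfl | rfl)
    · exact Set.subset_union_left
    · exact Set.subset_union_right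
  · exact support_subset_moduleSupport (Submodule.subset_span (by simp))
  · exact support_subset_moduleSupport (Submodule.subset_span (by simp))

/-- A semilinear automorphism of the space of coordinate vectors, with respect to the automorphism
`scalar` of the field of scalars. -/
structure SemilinearAut (k : Type*) [Field k] (C : Type*) extends (C → k) ≃+ (C → k) where
  scalar : k ≃+* k
  map_smul' : ∀ (c : k) (x : C → k), toFun (c • x) = scalar c • toFun x

namespace SemilinearAut

instance : CoeFun (SemilinearAut k C) fun _ => (C → k) → (C → k) := ⟨fun F => F.toAddEquiv⟩

variable (F : SemilinearAut k C)

theorem map_smul (c : k) (x : C → k) : F (c • x) = F.scalar c • F x := F.map_smul' c x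

theorem map_add (x y : C → k) : F (x + y) = F x + F y := F.toAddEquiv.map_add x y

theorem map_sub (x y : C → k) : F (x - y) = F x - F y := _root_.map_sub F.toAddEquiv x y

theorem map_zero : F 0 = 0 := F.toAddEquiv.map_zero

theorem injective : Function.Injective F := F.toAddEquiv.injective

theorem map_eq_zero {x : C → k} : F x = 0 ↔ x = 0 := F.toAddEquiv.map_eq_zero_iff

/-- The inverse of a semilinear automorphism. -/
def symm : SemilinearAut k C where
  toAddEquiv := F.toAddEquiv.symm
  scalar := F.scalar.symm
  map_smul' c x := by
    apply F.toAddEquiv.injective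
    change F (F.toAddEquiv.symm (c • x)) = F (F.scalar.symm c • F.toAddEquiv.symm x)
    rw [F.map_smul]
    simp

@[simp] theorem apply_symm_apply (x : C → k) : F (F.symm x) = x := F.toAddEquiv.apply_symm_apply x

@[simp] theorem symm_apply_apply (x : C → k) : F.symm (F x) = x := F.toAddEquiv.symm_apply_apply x

/-- The composition `G ∘ F`. -/
def trans (G : SemilinearAut k C) : SemilinearAut k C where
  toAddEquiv := F.toAddEquiv.trans G.toAddEquiv
  scalar := F.scalar.trans G.scalar
  map_smul' c x := by
    change G (F (c • x)) = G.scalar (F.scalar c) • G (F x)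
    rw [F.map_smul, G.map_smul]

@[simp] theorem trans_apply (G : SemilinearAut k C) (x : C → k) : F.trans G x = G (F x) := rfl

/-- The image of a subspace. -/
def map (W : Submodule k (C → k)) : Submodule k (C → k) where
  carrier := {y | F.symm y ∈ W}
  add_mem' := by
    intro x y hx hy
    change F.symm (x + y) ∈ W
    rw [SemilinearAut.map_add]
    exact W.add_mem hx hy
  zero_mem' := by
    change F.symm 0 ∈ W
    rw [SemilinearAut.map_zero]
    exact W.zero_mem
  smul_mem' := by
    intro c x hx
    change F.symm (c • x) ∈ W
    rw [SemilinearAut.map_smul]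
    exact W.smul_mem _ hx

theorem mem_map {W : Submodule k (C → k)} {y : C → k} : y ∈ F.map W ↔ F.symm y ∈ W := Iff.rfl

@[simp] theorem apply_mem_map {W : Submodule k (C → k)} {x : C → k} : F x ∈ F.map W ↔ x ∈ W := by
  rw [mem_map, symm_apply_apply]

theorem map_mono {W W' : Submodule k (C → k)} (h : W ≤ W') : F.map W ≤ F.map W' :=
  fun _ hy => h hy

theorem symm_map_map (W : Submodule k (C → k)) : F.symm.map (F.map W) = W := by
  ext x
  change F.symm (F x) ∈ W ↔ _
  simp

theorem map_span_pair (x y : C → k) :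
    F.map (Submodule.span k {x, y}) = Submodule.span k {F x, F y} := by
  ext z
  rw [mem_map, Submodule.mem_span_pair, Submodule.mem_span_pair]
  constructor
  · rintro ⟨a, b, h⟩
    refine ⟨F.scalar a, F.scalar b, ?_⟩
    rw [← F.map_smul, ← F.map_smul, ← F.map_add, h, apply_symm_apply]
  · rintro ⟨a, b, h⟩
    refine ⟨F.scalar.symm a, F.scalar.symm b, ?_⟩
    apply F.injective
    rw [apply_symm_apply, F.map_add, F.map_smul, F.map_smul, ← h]
    simp

end SemilinearAut

end Linear

/-! ### Dominated sets of coordinates -/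

namespace LooseGraph

variable {V E : Type*} (Γ : LooseGraph V E)

theorem inl_mem_completedEnds {v : V} {e : E} :
    (Sum.inl v : Γ.Completion) ∈ Γ.completedEnds e ↔ v ∈ Γ.ends e := by
  simp [completedEnds]

theorem inr_mem_completedEnds {e e' : E} {j : Fin (2 - (Γ.ends e').card)} :
    (Sum.inr ⟨e', j⟩ : Γ.Completion) ∈ Γ.completedEnds e ↔ e' = e := by
  constructor
  · rintro (⟨v, -, h⟩ | ⟨j', h⟩)
    · cases h
    · have := Sum.inr_injective h
      exact congrArg Sigma.fst this
  · rintro rfl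
    exact Or.inr ⟨j, rfl⟩

theorem inl_mem_looseStar_self (v : V) : (Sum.inl v : Γ.Completion) ∈ Γ.looseStar v := Or.inl rfl

theorem inl_mem_looseStar_symm {v w : V} (h : (Sum.inl w : Γ.Completion) ∈ Γ.looseStar v) :
    (Sum.inl v : Γ.Completion) ∈ Γ.looseStar w := by
  rcases h with h | ⟨e, hv, hw⟩
  · exact Or.inl h.symm
  · exact Or.inr ⟨e, Γ.inl_mem_completedEnds.1 hw, Γ.inl_mem_completedEnds.2 hv⟩

/-- A set of coordinates is dominated if it is one of the sets that the affine space of a vertex of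
positive degree contributes to the scheme over `𝔽₁`.  In these terms, a vector represents a rational
point on a line of the geometry if its support is dominated, and a plane represents a line if the
union of the supports of its vectors is dominated. -/
def IsDominated (S : Set Γ.Completion) : Prop :=
  ∃ v : V, Sum.inl v ∈ S ∧ S ⊆ Γ.looseStar v ∧ (Γ.looseStar v).Nontrivial

variable {Γ}

theorem IsDominated.nonempty {S : Set Γ.Completion} (h : Γ.IsDominated S) : S.Nonempty := by
  obtain ⟨v, hv, -⟩ := h
  exact ⟨_, hv⟩

variable {k : Type*} [Field k]

/-- If the vectors supported in `T` that are dominated together with the vector `p` make up a linear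
subspace, then this is a coordinate subspace. -/
theorem eq_coordSubspace_of_isDominated_union [Finite V] [Finite E] {p : Γ.Completion → k}
    {T : Set Γ.Completion} {P : Submodule k (Γ.Completion → k)}
    (hpT : Function.support p ⊆ T)
    (hP : ∀ y, y ∈ P ↔
      Function.support y ⊆ T ∧ Γ.IsDominated (Function.support p ∪ Function.support y)) :
    P = coordSubspace k {i | ∃ u : V, Sum.inl u ∈ T ∧ Function.support p ⊆ Γ.looseStar u ∧
      (Γ.looseStar u).Nontrivial ∧ i ∈ Γ.looseStar u ∧ i ∈ T} := by
  apply le_antisymm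
  · intro y hy i hi
    obtain ⟨hyT, u, hu, hus, hn⟩ := (hP y).1 hy
    refine ⟨u, ?_, Set.subset_union_left.trans hus, hn, hus (Or.inr hi), hyT hi⟩
    exact hu.elim (fun h => hpT h) (fun h => hyT h)
  · apply coordSubspace_le_of_indicator_mem
    rintro i ⟨u, huT, hpu, hn, hiu, hiT⟩
    have key : ∀ y : Γ.Completion → k, Function.support y ⊆ T → Function.support y ⊆ Γ.looseStar u →
        (Sum.inl u ∈ Function.support p ∨ Sum.inl u ∈ Function.support y) → y ∈ P := by
      intro y h1 h2 h3
      exact (hP y).2 ⟨h1, u, h3, Set.union_subset hpu h2, hn⟩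
    by_cases hup : Sum.inl u ∈ Function.support p
    · apply key _ _ _ (Or.inl hup) <;> rw [support_indicator_one] <;> simpa
    · have hu : Set.indicator {Sum.inl u} (1 : Γ.Completion → k) ∈ P := by
        apply key <;> rw [support_indicator_one]
        · simpa
        · simpa using Γ.inl_mem_looseStar_self u
        · simp
      by_cases hiu' : i = Sum.inl u
      · rw [hiu']
        exact hu
      -- the coordinate vector of `i` is a difference of vectors with a nonzero `u`-coordinate
      have h2 : Set.indicator {Sum.inl u, i} (1 : Γ.Completion → k) ∈ P := by
        apply key <;> rw [support_indicator_one]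
        · exact Set.insert_subset huT (by simpa)
        · exact Set.insert_subset (Γ.inl_mem_looseStar_self u) (by simpa)
        · simp
      have h3 : Set.indicator {i} (1 : Γ.Completion → k) =
          Set.indicator {Sum.inl u, i} (1 : Γ.Completion → k) -
            Set.indicator {Sum.inl u} (1 : Γ.Completion → k) := by
        have hd : Disjoint ({i} : Set Γ.Completion) {Sum.inl u} := by simpa using hiu'
        rw [eq_sub_iff_add_eq, Set.pair_comm, ← Set.singleton_union]
        exact (Set.indicator_union_of_disjoint hd (1 : Γ.Completion → k)).symm
      rw [h3]
      exact P.sub_mem h2 hu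

/-- The vectors of a coordinate space that involve a vertex dominating the whole space are those
which are dominated together with every other vector. -/
theorem exists_dominating_iff {T : Set Γ.Completion} {x : Γ.Completion → k}
    (hx : Function.support x ⊆ T) :
    (∃ v : V, Sum.inl v ∈ T ∧ T ⊆ Γ.looseStar v ∧ (Γ.looseStar v).Nontrivial ∧ x (Sum.inl v) ≠ 0) ↔
      ∀ y : Γ.Completion → k, Function.support y ⊆ T →
        Γ.IsDominated (Function.support x ∪ Function.support y) := by
  constructor
  · rintro ⟨v, hv, hT, hn, hxv⟩ y hy
    exact ⟨v, Or.inl hxv, (Set.union_subset hx hy).trans hT, hn⟩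
  · intro h
    by_contra! hcon
    set T₀ : Set Γ.Completion := {i ∈ T | ∀ v : V, i = Sum.inl v → T ⊆ Γ.looseStar v →
      (Γ.looseStar v).Nontrivial → False} with hT₀
    have hx₀ : Function.support x ⊆ T₀ := by
      intro i hi
      refine ⟨hx hi, ?_⟩
      rintro v rfl h1 h2
      exact hi (hcon v (hx hi) h1 h2)
    obtain ⟨u, hu, hus, hn⟩ := h (Set.indicator T₀ 1)
      (by rw [support_indicator_one]; exact fun i hi => hi.1)
    rw [support_indicator_one, Set.union_eq_self_of_subset_left hx₀] at hu hus
    refine hu.2 u rfl ?_ hn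
    intro i hi
    by_cases hi₀ : i ∈ T₀
    · exact hus hi₀
    · have : ∃ v : V, i = Sum.inl v ∧ T ⊆ Γ.looseStar v := by
        by_contra! hc
        exact hi₀ ⟨hi, fun v h1 h2 _ => hc v h1 h2⟩
      obtain ⟨v, rfl, hv⟩ := this
      exact Γ.inl_mem_looseStar_symm (hv hu.1)

/-- A semilinear automorphism that maps one coordinate subspace to another one and preserves
domination for the rational points and lines in it, preserves domination for all linear subspaces.
Over small finite fields a linear subspace does not always contain a vector of full support, so
this cannot be checked on the subspace alone; instead, the dominating vertices are recovered from
the ambient coordinate subspace. -/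
theorem isDominated_moduleSupport_map [Finite V] [Finite E] (F : SemilinearAut k Γ.Completion) :
    ∀ (n : ℕ) (T T' : Set Γ.Completion), T.ncard = n →
      F.map (coordSubspace k T) = coordSubspace k T' →
      (∀ x y, Function.support x ⊆ T → Function.support y ⊆ T →
        (Γ.IsDominated (Function.support x ∪ Function.support y) ↔
          Γ.IsDominated (Function.support (F x) ∪ Function.support (F y)))) →
      ∀ U ≤ coordSubspace k T, Γ.IsDominated (moduleSupport U) →
        Γ.IsDominated (moduleSupport (F.map U)) := by
  intro n
  induction n using Nat.strong_induction_on with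
  | _ n ih =>
  intro T T' hn hF hdom U hU hUd
  have hFT : ∀ x, Function.support (F x) ⊆ T' ↔ Function.support x ⊆ T := by
    intro x
    rw [← mem_coordSubspace (k := k), ← mem_coordSubspace (k := k), ← hF, F.apply_mem_map]
  by_cases hB : ∃ v : V, Sum.inl v ∈ T ∧ T ⊆ Γ.looseStar v ∧ (Γ.looseStar v).Nontrivial
  · have hM : ∀ x, Function.support x ⊆ T →
        ((∃ v : V, Sum.inl v ∈ T ∧ T ⊆ Γ.looseStar v ∧ (Γ.looseStar v).Nontrivial ∧
            x (Sum.inl v) ≠ 0) ↔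
          ∃ v : V, Sum.inl v ∈ T' ∧ T' ⊆ Γ.looseStar v ∧ (Γ.looseStar v).Nontrivial ∧
            F x (Sum.inl v) ≠ 0) := by
      intro x hx
      rw [exists_dominating_iff hx, exists_dominating_iff ((hFT x).2 hx)]
      constructor
      · intro h y hy
        have hy' : Function.support (F.symm y) ⊆ T := by
          rw [← hFT, F.apply_symm_apply]
          exact hy
        have := (hdom x _ hx hy').1 (h _ hy')
        rwa [F.apply_symm_apply] at this
      · intro h y hy
        exact (hdom x y hx hy).2 (h _ ((hFT y).2 hy))
    by_cases hUB : ∃ x ∈ U, ∃ v : V, Sum.inl v ∈ T ∧ T ⊆ Γ.looseStar v ∧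
        (Γ.looseStar v).Nontrivial ∧ x (Sum.inl v) ≠ 0
    · obtain ⟨x, hxU, hx⟩ := hUB
      obtain ⟨v, -, hvT, hvn, hv⟩ := (hM x (hU hxU)).1 hx
      refine ⟨v, ⟨F x, by simpa using hxU, hv⟩, ?_, hvn⟩
      refine Set.Subset.trans ?_ hvT
      rw [moduleSupport_subset_iff, ← hF]
      exact F.map_mono hU
    · -- the subspace involves no dominating vertex, and these can be discarded on both sides
      push Not at hUB
      set D : Set Γ.Completion → Set Γ.Completion := fun T => {i ∈ T | ∀ v : V, i = Sum.inl v →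
        T ⊆ Γ.looseStar v → (Γ.looseStar v).Nontrivial → False} with hD
      have hD' : ∀ (T : Set Γ.Completion) (x : Γ.Completion → k), Function.support x ⊆ D T ↔
          Function.support x ⊆ T ∧ ¬ ∃ v : V, Sum.inl v ∈ T ∧ T ⊆ Γ.looseStar v ∧
            (Γ.looseStar v).Nontrivial ∧ x (Sum.inl v) ≠ 0 := by
        intro T x
        constructor
        · intro h
          refine ⟨fun i hi => (h hi).1, ?_⟩
          rintro ⟨v, -, h2, h3, h4⟩
          exact (h h4).2 v rfl h2 h3
        · rintro ⟨h1, h2⟩ i hi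
          refine ⟨h1 hi, ?_⟩
          rintro v rfl h3 h4
          exact h2 ⟨v, h1 hi, h3, h4, hi⟩
      have hFD : ∀ x, Function.support (F x) ⊆ D T' ↔ Function.support x ⊆ D T := by
        intro x
        rw [hD', hD', hFT]
        constructor
        · rintro ⟨h1, h2⟩
          exact ⟨h1, by rwa [hM x h1]⟩
        · rintro ⟨h1, h2⟩
          exact ⟨h1, by rwa [← hM x h1]⟩
      have hDT : D T ⊆ T := fun i hi => hi.1
      refine ih (D T).ncard ?_ (D T) (D T') rfl ?_ ?_ U ?_ hUd
      · rw [← hn]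
        apply Set.ncard_lt_ncard _ (Set.toFinite _)
        refine ⟨hDT, fun h => ?_⟩
        obtain ⟨v, h1, h2, h3⟩ := hB
        exact (h h1).2 v rfl h2 h3
      · ext y
        rw [F.mem_map, mem_coordSubspace, mem_coordSubspace, ← hFD, F.apply_symm_apply]
      · intro x y hx hy
        exact hdom x y (hx.trans hDT) (hy.trans hDT)
      · intro x hx
        rw [mem_coordSubspace, hD']
        refine ⟨hU hx, ?_⟩
        rintro ⟨v, h1, h2, h3, h4⟩
        exact h4 (hUB x hx v h1 h2 h3)
  · -- no vertex dominates everything: descend to a maximal trace of a star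
    obtain ⟨u, hu, hus, hun⟩ := hUd
    have huT : Sum.inl u ∈ T := moduleSupport_subset_iff.2 hU hu
    obtain ⟨v, ⟨hvT, hvn, huv⟩, hvmax⟩ : ∃ v : V, (Sum.inl v ∈ T ∧ (Γ.looseStar v).Nontrivial ∧
        Γ.looseStar u ∩ T ⊆ Γ.looseStar v ∩ T) ∧ ∀ w : V, (Sum.inl w ∈ T ∧
          (Γ.looseStar w).Nontrivial ∧ Γ.looseStar u ∩ T ⊆ Γ.looseStar w ∩ T) →
          (Γ.looseStar w ∩ T).ncard ≤ (Γ.looseStar v ∩ T).ncard := by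
      obtain ⟨v, hv, hmax⟩ := Set.exists_max_image {w : V | Sum.inl w ∈ T ∧
          (Γ.looseStar w).Nontrivial ∧ Γ.looseStar u ∩ T ⊆ Γ.looseStar w ∩ T}
          (fun w => (Γ.looseStar w ∩ T).ncard) (Set.toFinite _) ⟨u, huT, hun, subset_rfl⟩
      exact ⟨v, hv, hmax⟩
    set S := Γ.looseStar v ∩ T with hS
    have hST : S ⊆ T := Set.inter_subset_right
    have hp : Function.support (Set.indicator S (1 : Γ.Completion → k)) = S :=
      support_indicator_one S
    have hvS : Sum.inl v ∈ S := ⟨Γ.inl_mem_looseStar_self v, hvT⟩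
    have hN : ∀ y : Γ.Completion → k, Function.support y ⊆ T →
        (Function.support y ⊆ S ↔
          Γ.IsDominated (Function.support (Set.indicator S (1 : Γ.Completion → k)) ∪
            Function.support y)) := by
      intro y hy
      rw [hp]
      constructor
      · intro h
        exact ⟨v, Or.inl hvS, (Set.union_subset subset_rfl h).trans Set.inter_subset_left, hvn⟩
      · rintro ⟨w, hw, hws, hwn⟩
        have hwT : Sum.inl w ∈ T := hw.elim (fun h => hST h) (fun h => hy h)
        have hSw : S ⊆ Γ.looseStar w ∩ T :=
          Set.subset_inter (Set.subset_union_left.trans hws) hST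
        have := Set.eq_of_subset_of_ncard_le hSw (hvmax w ⟨hwT, hwn, huv.trans hSw⟩)
          (Set.toFinite _)
        rw [this]
        exact Set.subset_inter (Set.subset_union_right.trans hws) hy
    have hpT : Function.support (Set.indicator S (1 : Γ.Completion → k)) ⊆ T := by rwa [hp]
    have hFS := eq_coordSubspace_of_isDominated_union (P := F.map (coordSubspace k S)) (T := T')
      ((hFT _).2 hpT) (by
        intro y
        rw [F.mem_map, mem_coordSubspace]
        have h1 := hFT (F.symm y)
        rw [F.apply_symm_apply] at h1
        rw [h1]
        constructor
        · intro h
          refine ⟨h.trans hST, ?_⟩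
          have := (hdom _ _ hpT (h.trans hST)).1 ((hN _ (h.trans hST)).1 h)
          rwa [F.apply_symm_apply] at this
        · rintro ⟨h2, h3⟩
          rw [hN _ h2, hdom _ _ hpT h2, F.apply_symm_apply]
          exact h3)
    refine ih S.ncard ?_ S _ rfl hFS ?_ U ?_ ⟨u, hu, hus, hun⟩
    · rw [← hn]
      apply Set.ncard_lt_ncard _ (Set.toFinite _)
      refine ⟨hST, fun h => hB ⟨v, hvT, fun i hi => (h hi).1, hvn⟩⟩
    · intro x y hx hy
      exact hdom x y (hx.trans hST) (hy.trans hST)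
    · rw [← moduleSupport_subset_iff]
      exact fun i hi => huv ⟨hus hi, moduleSupport_subset_iff.2 hU hi⟩

end LooseGraph

/-! ### The fundamental theorem for maps from an affine to a projective space -/

section Fundamental

variable {k M ι : Type*} [Field k] [AddCommGroup M] [Module k M] [DecidableEq ι]

/-- A map from the affine space `ι → k` to the projective space of `M`, given by representing
vectors, which preserves collinearity and non-collinearity and maps all lines in the direction of
the `i`-th coordinate to lines through the point of `w i`. -/
structure IsLineation (h : (ι → k) → M) (w : ι → M) : Prop where
  notMem_span : ∀ t t', t ≠ t' → h t ∉ Submodule.span k {h t'}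
  mem_span : ∀ (t t' : ι → k) (s : k), h (t + s • (t' - t)) ∈ Submodule.span k {h t, h t'}
  exists_of_mem_span : ∀ t t' z, t ≠ t' → h z ∈ Submodule.span k {h t, h t'} →
    ∃ s : k, z = t + s • (t' - t)
  dir_notMem_span : ∀ t i, w i ∉ Submodule.span k {h t}
  dir_mem_span : ∀ t i s, s ≠ 0 → w i ∈ Submodule.span k {h t, h (t + Pi.single i s)}

namespace IsLineation

variable {h : (ι → k) → M} {w : ι → M}

theorem ne_zero [Nonempty ι] (H : IsLineation h w) (t : ι → k) : h t ≠ 0 := by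
  intro h0
  have i := Classical.arbitrary ι
  refine H.notMem_span t (t + Pi.single i 1) ?_ (by rw [h0]; exact Submodule.zero_mem _)
  intro h1
  have := congrFun h1 i
  simp at this

theorem exists_eq_smul_add [Nonempty ι] (H : IsLineation h w) (t : ι → k) (i : ι) (s : k) :
    ∃ c r : k, r ≠ 0 ∧ h (t + Pi.single i s) = r • (h t + c • w i) := by
  by_cases hs : s = 0
  · exact ⟨0, 1, one_ne_zero, by simp [hs]⟩
  obtain ⟨a, b, hab⟩ := Submodule.mem_span_pair.1 (H.dir_mem_span t i s hs)
  have hb : b ≠ 0 := by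
    rintro rfl
    exact H.dir_notMem_span t i (Submodule.mem_span_singleton.2 ⟨a, by simpa using hab⟩)
  have ha : a ≠ 0 := by
    rintro rfl
    exact H.dir_notMem_span (t + Pi.single i s) i
      (Submodule.mem_span_singleton.2 ⟨b, by simpa using hab⟩)
  refine ⟨-a⁻¹, -(a / b), by simp [ha, hb], ?_⟩
  rw [← hab]
  simp only [smul_add, smul_smul]
  have h1 : -(a / b) + -(a / b) * (-a⁻¹ * a) = 0 := by field_simp; ring
  have h2 : -(a / b) * (-a⁻¹ * b) = 1 := by field_simp
  rw [← add_assoc, ← add_smul, h1, h2]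
  simp

theorem smul_add_smul_eq_zero [Nonempty ι] (H : IsLineation h w) {t : ι → k} {i : ι} {a b : k}
    (hab : a • h t + b • w i = 0) : a = 0 ∧ b = 0 := by
  have hb : b = 0 := by
    by_contra hb
    refine H.dir_notMem_span t i (Submodule.mem_span_singleton.2 ⟨-(b⁻¹ * a), ?_⟩)
    have : w i = b⁻¹ • (a • h t + b • w i) - (b⁻¹ * a) • h t := by
      rw [smul_add, smul_smul, smul_smul, inv_mul_cancel₀ hb]
      simp
    rw [this, hab]
    simp
  subst hb
  refine ⟨?_, rfl⟩
  by_contra ha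
  simp [ha, H.ne_zero] at hab

theorem dir_notMem_span_pair [Nonempty ι] (H : IsLineation h w) (t : ι → k) {i j : ι}
    (hij : i ≠ j) : w j ∉ Submodule.span k {h t, w i} := by
  intro hj
  have hle : Submodule.span k {h t, w i} ≤ Submodule.span k {h t, h (t + Pi.single i 1)} := by
    rw [Submodule.span_le]
    rintro x (rfl | rfl)
    · exact Submodule.subset_span (by simp)
    · exact H.dir_mem_span t i 1 one_ne_zero
  obtain ⟨c, r, hr, hc⟩ := H.exists_eq_smul_add t j 1
  have hmem : h (t + Pi.single j 1) ∈ Submodule.span k {h t, h (t + Pi.single i 1)} := by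
    rw [hc]
    exact Submodule.smul_mem _ _ (Submodule.add_mem _ (Submodule.subset_span (by simp))
      (Submodule.smul_mem _ _ (hle hj)))
  obtain ⟨s, hs⟩ := H.exists_of_mem_span _ _ _ (by
    intro h1
    have := congrFun h1 i
    simp at this) hmem
  have := congrFun hs j
  simp [hij.symm] at this

theorem smul_add_smul_add_smul_eq_zero [Nonempty ι] (H : IsLineation h w) {t : ι → k} {i j : ι}
    (hij : i ≠ j) {a b c : k} (habc : a • h t + b • w i + c • w j = 0) :
    a = 0 ∧ b = 0 ∧ c = 0 := by
  have hc : c = 0 := by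
    by_contra hc
    refine H.dir_notMem_span_pair t hij (Submodule.mem_span_pair.2 ⟨-(c⁻¹ * a), -(c⁻¹ * b), ?_⟩)
    have : w j = c⁻¹ • (a • h t + b • w i + c • w j) - (c⁻¹ * a) • h t - (c⁻¹ * b) • w i := by
      simp only [smul_add, smul_smul, inv_mul_cancel₀ hc, one_smul]
      abel
    rw [this, habc]
    simp [sub_eq_add_neg]
  subst hc
  have := H.smul_add_smul_eq_zero (t := t) (i := i) (a := a) (b := b) (by simpa using habc)
  exact ⟨this.1, this.2, rfl⟩

/-- Rescaling the directions. -/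
theorem smul_dir (H : IsLineation h w) {b : ι → k} (hb : ∀ i, b i ≠ 0) :
    IsLineation h (fun i => b i • w i) where
  notMem_span := H.notMem_span
  mem_span := H.mem_span
  exists_of_mem_span := H.exists_of_mem_span
  dir_notMem_span t i hi := by
    have := Submodule.smul_mem _ (b i)⁻¹ hi
    rw [smul_smul, inv_mul_cancel₀ (hb i), one_smul] at this
    exact H.dir_notMem_span t i this
  dir_mem_span t i s hs := Submodule.smul_mem _ _ (H.dir_mem_span t i s hs)

/-- Up to rescaling of the directions, a lineation is given in coordinates by one map of `k` for
every coordinate. -/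
theorem exists_coordinates [Fintype ι] [Nonempty ι] (H : IsLineation h w) :
    ∃ (b : ι → k) (σ : ι → k → k), (∀ i, b i ≠ 0) ∧ (∀ i, σ i 0 = 0) ∧ (∀ i, σ i 1 = 1) ∧
      (∀ i, Function.Injective (σ i)) ∧
      ∀ t, ∃ r : k, r ≠ 0 ∧ h t = r • (h 0 + ∑ i, σ i (t i) • b i • w i) := by
  classical
  choose c₀ r₀ hr₀ hc₀ using fun i => H.exists_eq_smul_add 0 i 1
  have hne : ∀ i, c₀ i ≠ 0 := by
    intro i h0
    refine H.notMem_span (Pi.single i 1) 0 ?_ (Submodule.mem_span_singleton.2 ⟨r₀ i, ?_⟩)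
    · intro h1
      have := congrFun h1 i
      simp at this
    · have := hc₀ i
      rw [zero_add, h0, zero_smul, add_zero] at this
      exact this.symm
  set w' : ι → M := fun i => c₀ i • w i with hw'
  have H' : IsLineation h w' := H.smul_dir hne
  choose σ r hr hσ using fun (i : ι) (s : k) => H'.exists_eq_smul_add 0 i s
  simp only [zero_add] at hσ hc₀
  have huniq : ∀ i {a b r₁ r₂ : k}, r₁ ≠ 0 → r₁ • (h 0 + a • w' i) = r₂ • (h 0 + b • w' i) →
      a = b := by
    intro i a b r₁ r₂ h1 h2
    have : (r₁ - r₂) • h 0 + (r₁ * a - r₂ * b) • w' i = 0 := by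
      rw [← sub_eq_zero] at h2
      rw [← h2]
      module
    obtain ⟨h3, h4⟩ := H'.smul_add_smul_eq_zero this
    rw [← sub_eq_zero.1 h3, ← mul_sub] at h4
    exact sub_eq_zero.1 ((mul_eq_zero.1 h4).resolve_left h1)
  have hσ0 : ∀ i, σ i 0 = 0 := by
    intro i
    apply huniq i (hr i 0) (r₂ := 1)
    rw [← hσ]
    simp
  have hσ1 : ∀ i, σ i 1 = 1 := by
    intro i
    apply huniq i (hr i 1) (r₂ := r₀ i)
    rw [← hσ, hc₀, one_smul]
  have hinj : ∀ i, Function.Injective (σ i) := by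
    intro i s s' hs
    by_contra hne'
    refine H.notMem_span (Pi.single i s) (Pi.single i s') ?_
      (Submodule.mem_span_singleton.2 ⟨r i s * (r i s')⁻¹, ?_⟩)
    · intro h1
      exact hne' (by simpa using congrFun h1 i)
    · rw [hσ, hσ, hs, smul_smul, mul_assoc, inv_mul_cancel₀ (hr i s'), mul_one]
  refine ⟨c₀, σ, hne, hσ0, hσ1, hinj, ?_⟩
  change ∀ t, ∃ r : k, r ≠ 0 ∧ h t = r • (h 0 + ∑ i, σ i (t i) • w' i)
  set Φ : (ι → k) → M := fun t => h 0 + ∑ i, σ i (t i) • w' i with hΦ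
  have hΦadd : ∀ (u : ι → k) (i : ι) (s : k), u i = 0 →
      Φ (u + Pi.single i s) = Φ u + σ i s • w' i := by
    intro u i s hu
    simp only [hΦ]
    rw [add_assoc, ← Finset.add_sum_erase _ _ (Finset.mem_univ i),
      ← Finset.add_sum_erase (a := i) (f := fun i => σ i (u i) • w' i) _ (Finset.mem_univ i)]
    simp only [Pi.add_apply, Pi.single_eq_same, hu, hσ0, zero_add, zero_smul]
    rw [add_comm (σ i s • w' i)]
    congr 2
    apply Finset.sum_congr rfl
    intro j hj
    simp [Finset.ne_of_mem_erase hj]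
  -- the coordinates are added one at a time
  suffices hmain : ∀ (n : ℕ) (t : ι → k), (Finset.univ.filter fun i => t i ≠ 0).card = n →
      ∃ r : k, r ≠ 0 ∧ h t = r • Φ t from fun t => hmain _ t rfl
  intro n
  induction n using Nat.strong_induction_on with
  | _ n ih =>
  intro t ht
  by_cases h0 : ∃ i, t i ≠ 0
  swap
  · push Not at h0
    have : t = 0 := funext h0
    subst this
    exact ⟨1, one_ne_zero, by simp [hΦ, hσ0]⟩
  obtain ⟨i, hi⟩ := h0
  by_cases h1 : ∃ j, j ≠ i ∧ t j ≠ 0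
  swap
  · push Not at h1
    have : t = 0 + Pi.single i (t i) := by
      ext j
      by_cases hj : j = i
      · subst hj; simp
      · simp [hj, h1 j hj]
    refine ⟨r i (t i), hr i _, ?_⟩
    rw [this, hΦadd _ _ _ rfl]
    simp [hΦ, hσ0, ← hσ]
  obtain ⟨j, hji, hj⟩ := h1
  -- both coordinates `i` and `j` are nonzero; compare with the points where one or both vanish
  set u : ι → k := Function.update (Function.update t i 0) j 0 with hu
  have hui : u i = 0 := by simp [hu, hji.symm]
  have huj : u j = 0 := by simp [hu]
  have hul : ∀ l, l ≠ i → l ≠ j → u l = t l := by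
    intro l h1 h2
    simp [hu, h1, h2]
  set a := t i
  set b := t j
  have hcard : ∀ t' : ι → k, (∀ l, t' l ≠ 0 → t l ≠ 0) → (∃ l, t l ≠ 0 ∧ t' l = 0) →
      (Finset.univ.filter fun i => t' i ≠ 0).card < n := by
    rintro t' h1 ⟨l, h2, h3⟩
    rw [← ht]
    apply Finset.card_lt_card
    rw [Finset.ssubset_iff_of_subset]
    · exact ⟨l, by simpa using h2, by simpa using h3⟩
    · intro m
      simpa using h1 m
  obtain ⟨r₁, hr₁, e₁⟩ := ih _ (hcard (u + Pi.single i a) (by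
      intro l hl
      by_cases hli : l = i
      · subst hli; exact hi
      · by_cases hlj : l = j
        · subst hlj; exact hj
        · simpa [hli, hul l hli hlj] using hl) ⟨j, hj, by simp [huj, hji]⟩) _ rfl
  obtain ⟨r₂, hr₂, e₂⟩ := ih _ (hcard (u + Pi.single j b) (by
      intro l hl
      by_cases hli : l = i
      · subst hli; exact hi
      · by_cases hlj : l = j
        · subst hlj; exact hj
        · simpa [hlj, hul l hli hlj] using hl) ⟨i, hi, by simp [hui, hji.symm]⟩) _ rfl
  obtain ⟨r₀, hr₀, e₀⟩ := ih _ (hcard u (by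
      intro l hl
      by_cases hli : l = i
      · subst hli; exact hi
      · by_cases hlj : l = j
        · subst hlj; exact hj
        · simpa [hul l hli hlj] using hl) ⟨i, hi, hui⟩) _ rfl
  have ht1 : t = (u + Pi.single i a) + Pi.single j b := by
    ext l
    by_cases hli : l = i
    · subst hli; simp [hui, hji.symm, a]
    · by_cases hlj : l = j
      · subst hlj; simp [huj, hli, b]
      · simp [hul l hli hlj, hli, hlj]
  have ht2 : t = (u + Pi.single j b) + Pi.single i a := by
    rw [ht1]; abel
  obtain ⟨c, r₃, hr₃, e₃⟩ := H'.exists_eq_smul_add (u + Pi.single i a) j b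
  obtain ⟨d, r₄, hr₄, e₄⟩ := H'.exists_eq_smul_add (u + Pi.single j b) i a
  rw [← ht1] at e₃
  rw [← ht2] at e₄
  have hΦt : Φ t = Φ u + σ i a • w' i + σ j b • w' j := by
    rw [ht1, hΦadd _ _ _ (by simp [huj, hji]), hΦadd _ _ _ hui]
  rw [e₁, hΦadd _ _ _ hui] at e₃
  rw [e₂, hΦadd _ _ _ huj] at e₄
  have hrel : ((r₃ * r₁ - r₄ * r₂) * r₀⁻¹) • h u + (r₃ * r₁ * σ i a - r₄ * d) • w' i +
      (r₃ * c - r₄ * r₂ * σ j b) • w' j = 0 := by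
    have h2 := e₃.symm.trans e₄
    rw [← sub_eq_zero] at h2
    rw [← h2, e₀, smul_smul, inv_mul_cancel_right₀ hr₀]
    module
  obtain ⟨h3, -, h5⟩ := H'.smul_add_smul_add_smul_eq_zero hji.symm hrel
  have h6 : r₃ * r₁ = r₄ * r₂ := by
    rcases mul_eq_zero.1 h3 with h | h
    · exact sub_eq_zero.1 h
    · exact absurd h (inv_ne_zero hr₀)
  have h7 : c = r₁ * σ j b := by
    rw [← h6, mul_assoc, ← mul_sub] at h5
    exact sub_eq_zero.1 ((mul_eq_zero.1 h5).resolve_left hr₃)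
  refine ⟨r₃ * r₁, mul_ne_zero hr₃ hr₁, ?_⟩
  rw [e₃, hΦt, h7]
  module

/-- The fundamental theorem: a lineation of an affine space of dimension at least two is semilinear
in coordinates.  The last hypothesis expresses that a coordinate line is mapped onto a line with at
most two points missing, which makes the field homomorphism surjective. -/
theorem exists_semilinear [Fintype ι] [Nontrivial ι] (H : IsLineation h w)
    (hsurj : ∃ (i : ι) (c : M), ∀ y ∈ Submodule.span k {h 0, w i},
      (∃ s, y ∈ Submodule.span k {h (Pi.single i s)}) ∨ y ∈ Submodule.span k {w i} ∨
        y ∈ Submodule.span k {c}) :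
    ∃ (σ : k ≃+* k) (w' : ι → M), ∀ t, ∃ r : k, r ≠ 0 ∧
      h t = r • (h 0 + ∑ i, σ (t i) • w' i) := by
  obtain ⟨b, σ, hb, hσ0, hσ1, hinj, hσ⟩ := H.exists_coordinates
  set w' : ι → M := fun i => b i • w i with hw'
  have H' : IsLineation h w' := H.smul_dir hb
  have hΦ : ∀ i j, i ≠ j → ∀ x y, h 0 + ∑ l, σ l ((Pi.single i x + Pi.single j y : ι → k) l) • w' l
      = h 0 + (σ i x • w' i + σ j y • w' j) := by
    intro i j hij x y
    congr 1
    rw [Finset.sum_eq_add i j hij]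
    · simp [hij, hij.symm]
    · intro l _ hl
      simp [hl.1, hl.2, hσ0]
    · simp
    · simp
  -- collinear points of a coordinate plane
  have hcol : ∀ i j, i ≠ j → ∀ x y x' y' s, ∃ α : k,
      σ i (x + s * (x' - x)) = σ i x + α * (σ i x' - σ i x) ∧
      σ j (y + s * (y' - y)) = σ j y + α * (σ j y' - σ j y) := by
    intro i j hij x y x' y' s
    have h1 := H'.mem_span (Pi.single i x + Pi.single j y) (Pi.single i x' + Pi.single j y') s
    have h2 : (Pi.single i x + Pi.single j y : ι → k) +
        s • ((Pi.single i x' + Pi.single j y') - (Pi.single i x + Pi.single j y)) =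
        Pi.single i (x + s * (x' - x)) + Pi.single j (y + s * (y' - y)) := by
      ext l
      by_cases hli : l = i
      · subst hli; simp [hij]
      · by_cases hlj : l = j
        · subst hlj; simp [hij.symm]
        · simp [hli, hlj]
    rw [h2] at h1
    obtain ⟨r₁, hr₁, e₁⟩ := hσ (Pi.single i x + Pi.single j y)
    obtain ⟨r₂, hr₂, e₂⟩ := hσ (Pi.single i x' + Pi.single j y')
    obtain ⟨r₃, hr₃, e₃⟩ := hσ (Pi.single i (x + s * (x' - x)) + Pi.single j (y + s * (y' - y)))
    rw [hΦ i j hij] at e₁ e₂ e₃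
    rw [e₁, e₂, e₃, Submodule.mem_span_pair] at h1
    obtain ⟨a₁, a₂, h3⟩ := h1
    have h4 : (a₁ * r₁ + a₂ * r₂ - r₃) • h 0 +
        (a₁ * r₁ * σ i x + a₂ * r₂ * σ i x' - r₃ * σ i (x + s * (x' - x))) • w' i +
        (a₁ * r₁ * σ j y + a₂ * r₂ * σ j y' - r₃ * σ j (y + s * (y' - y))) • w' j = 0 := by
      rw [← sub_eq_zero] at h3
      rw [← h3]
      module
    obtain ⟨h5, h6, h7⟩ := H'.smul_add_smul_add_smul_eq_zero hij h4
    have h8 : a₁ * r₁ = r₃ - a₂ * r₂ := by linear_combination h5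
    rw [h8] at h6 h7
    refine ⟨a₂ * r₂ / r₃, ?_, ?_⟩
    · field_simp
      linear_combination -h6
    · field_simp
      linear_combination -h7
  obtain ⟨i₀, j₀, hij₀⟩ := exists_pair_ne ι
  -- the points of the diagonal of a coordinate plane show that all coordinates have the same map
  have heq : ∀ i j, σ i = σ j := by
    intro i j
    by_cases hij : i = j
    · rw [hij]
    ext s
    obtain ⟨α, h1, h2⟩ := hcol i j hij 0 0 1 1 s
    simp only [hσ0, hσ1, sub_zero, mul_one, zero_add] at h1 h2
    rw [h1, h2]
  set τ : k → k := σ i₀ with hτ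
  have hτi : ∀ i, σ i = τ := fun i => heq i i₀
  have hmul : ∀ s a, τ (s * a) = τ s * τ a := by
    intro s a
    obtain ⟨α, h1, h2⟩ := hcol i₀ j₀ hij₀ 0 0 1 a s
    simp only [hσ0, hσ1, sub_zero, mul_one, zero_add, hτi] at h1 h2
    rw [h2, h1]
  have hτ0 : τ 0 = 0 := hσ0 i₀
  have hτ1 : τ 1 = 1 := hσ1 i₀
  have hτinj : Function.Injective τ := hinj i₀
  have hneg : τ (-1) = -1 := by
    have h1 : (τ (-1) - 1) * (τ (-1) + 1) = 0 := by
      have := hmul (-1) (-1)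
      rw [neg_one_mul, neg_neg, hτ1] at this
      linear_combination -this
    rcases mul_eq_zero.1 h1 with h2 | h2
    · have h3 : (-1 : k) = 1 := hτinj (by rw [hτ1]; exact sub_eq_zero.1 h2)
      rw [h3, hτ1]
    · exact eq_neg_of_add_eq_zero_left h2
  have hadd : ∀ s b, τ (s + b) = τ s + τ b := by
    intro s b
    by_cases hb0 : b = 0
    · simp [hb0, hτ0]
    have key : ∀ s, τ (s + b) = τ b + τ s * (τ (1 + b) - τ b) := by
      intro s
      obtain ⟨α, h1, h2⟩ := hcol i₀ j₀ hij₀ 0 b 1 (1 + b) s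
      simp only [hσ0, hσ1, sub_zero, mul_one, zero_add, hτi] at h1 h2
      rw [← h1] at h2
      rw [← h2]
      congr 1
      ring
    have h3 := key (-b)
    rw [neg_add_cancel, hτ0, neg_eq_neg_one_mul, hmul, hneg] at h3
    have hb1 : τ b ≠ 0 := fun h => hb0 (hτinj (h.trans hτ0.symm))
    have h4 : τ (1 + b) - τ b = 1 := by
      apply mul_left_cancel₀ hb1
      linear_combination h3
    rw [key, h4]
    ring
  let τ' : k →+* k := ⟨⟨⟨τ, hτ1⟩, hmul⟩, hτ0, hadd⟩
  have hτsurj : Function.Surjective τ' := by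
    obtain ⟨i, c, hi⟩ := hsurj
    intro a
    by_contra ha
    have ha1 : ¬ ∃ s, τ' s = a + 1 := by
      rintro ⟨s, hs⟩
      exact ha ⟨s - 1, by rw [map_sub, hs, map_one]; ring⟩
    have key : ∀ a, (¬ ∃ s, τ' s = a) → h 0 + a • w' i ∈ Submodule.span k {c} := by
      intro a ha
      rcases hi (h 0 + a • w' i) (Submodule.mem_span_pair.2 ⟨1, a * b i, by simp [hw', mul_smul]⟩)
        with ⟨s, hs⟩ | h1 | h1
      · obtain ⟨r, hr⟩ := Submodule.mem_span_singleton.1 hs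
        obtain ⟨r₁, hr₁, e₁⟩ := hσ (Pi.single i s)
        have e₂ : ∑ l, σ l ((Pi.single i s : ι → k) l) • w' l = σ i s • w' i := by
          rw [Finset.sum_eq_single i]
          · simp
          · intro l _ hl
            simp [hl, hσ0]
          · simp
        have e₃ : ∑ l, σ l ((Pi.single i s : ι → k) l) • b l • w l = σ i s • w' i := e₂
        rw [e₁, e₃] at hr
        have h2 : (r * r₁ - 1) • h 0 + (r * r₁ * σ i s - a) • w' i = 0 := by
          rw [← sub_eq_zero] at hr
          rw [← hr]
          module
        obtain ⟨h3, h4⟩ := H'.smul_add_smul_eq_zero h2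
        rw [sub_eq_zero.1 h3, one_mul] at h4
        exact absurd ⟨s, by rw [← sub_eq_zero.1 h4, hτi]; rfl⟩ ha
      · obtain ⟨r, hr⟩ := Submodule.mem_span_singleton.1 h1
        have h2 : (1 : k) • h 0 + (a * b i - r) • w i = 0 := by
          rw [← sub_eq_zero] at hr
          simp only [hw'] at hr
          rw [← neg_eq_zero, ← hr]
          module
        exact absurd (H.smul_add_smul_eq_zero h2).1 one_ne_zero
      · exact h1
    obtain ⟨r, hr⟩ := Submodule.mem_span_singleton.1 (key a ha)
    obtain ⟨r', hr'⟩ := Submodule.mem_span_singleton.1 (key _ ha1)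
    have h2 : (r' - r) • h 0 + (r' * a - r * (a + 1)) • w' i = 0 := by
      have h3 : r' • r • c = r • r' • c := by rw [smul_smul, smul_smul, mul_comm]
      rw [hr, hr', ← sub_eq_zero] at h3
      rw [← h3]
      module
    obtain ⟨h3, h4⟩ := H'.smul_add_smul_eq_zero h2
    have h5 : r = 0 := by
      rw [sub_eq_zero.1 h3] at h4
      linear_combination -h4
    rw [h5, zero_smul] at hr
    have := H'.smul_add_smul_eq_zero (t := 0) (i := i) (a := 1) (b := a) (by rw [hr, one_smul])
    exact one_ne_zero this.1
  refine ⟨RingEquiv.ofBijective τ' ⟨hτinj, hτsurj⟩, w', fun t => ?_⟩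
  obtain ⟨r, hr, e⟩ := hσ t
  refine ⟨r, hr, ?_⟩
  rw [e]
  simp only [hτi]
  rfl

end IsLineation

end Fundamental

/-! ### Collineations in terms of coordinate vectors -/

namespace LooseGraph

section Geometry

variable {V E : Type*} {Γ : LooseGraph V E} {k : Type*} [Field k]

/-- A vector represents a rational point that lies on some line of the geometry. -/
def IsPt (Γ : LooseGraph V E) (x : Γ.Completion → k) : Prop := Γ.IsDominated (Function.support x)

/-- A subspace represents a line of the geometry: it is a plane, and its generic point lies in the
affine space of a vertex. -/
def IsLn (Γ : LooseGraph V E) (W : Submodule k (Γ.Completion → k)) : Prop :=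
  Module.finrank k W = 2 ∧ Γ.IsDominated (moduleSupport W)

theorem support_smul_of_ne_zero {C : Type*} {x : C → k} {c : k} (hc : c ≠ 0) :
    Function.support (c • x) = Function.support x := by
  ext i
  simp [hc]

theorem IsPt.smul {x : Γ.Completion → k} (hx : Γ.IsPt x) {c : k} (hc : c ≠ 0) : Γ.IsPt (c • x) := by
  rwa [IsPt, support_smul_of_ne_zero hc]

theorem IsPt.ne_zero {x : Γ.Completion → k} (hx : Γ.IsPt x) : x ≠ 0 := by
  rintro rfl
  simpa using hx.nonempty

theorem isPt_of_apply_ne_zero {x : Γ.Completion → k} {v : V} (hn : (Γ.looseStar v).Nontrivial)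
    (hx : x ∈ coordSubspace k (Γ.looseStar v)) (hv : x (Sum.inl v) ≠ 0) : Γ.IsPt x :=
  ⟨v, hv, hx, hn⟩

theorem looseStar_nontrivial_of_mem {v w : V} (hn : (Γ.looseStar v).Nontrivial)
    (hw : Sum.inl w ∈ Γ.looseStar v) : (Γ.looseStar w).Nontrivial := by
  by_cases h : w = v
  · rwa [h]
  · exact ⟨_, Γ.inl_mem_looseStar_self w, _, Γ.inl_mem_looseStar_symm hw,
      fun h' => h (Sum.inl_injective h')⟩

theorem isPt_indicator {v w : V} (hn : (Γ.looseStar v).Nontrivial)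
    (hw : Sum.inl w ∈ Γ.looseStar v) :
    Γ.IsPt (Set.indicator {Sum.inl w} (1 : Γ.Completion → k)) := by
  rw [IsPt, support_indicator_one]
  exact ⟨w, rfl, by simpa using Γ.inl_mem_looseStar_self w, looseStar_nontrivial_of_mem hn hw⟩

theorem finrank_span_pair_eq_two {M : Type*} [AddCommGroup M] [Module k M] {x y : M} (hx : x ≠ 0)
    (hy : y ∉ Submodule.span k {x}) : Module.finrank k (Submodule.span k {x, y}) = 2 := by
  have h : LinearIndependent k ![x, y] := by
    rw [LinearIndependent.pair_iff' hx]
    intro a ha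
    exact hy (Submodule.mem_span_singleton.2 ⟨a, ha⟩)
  have := finrank_span_eq_card h
  rwa [Matrix.range_cons, Matrix.range_cons, Matrix.range_empty, Set.union_empty,
    Set.singleton_union, Fintype.card_fin] at this

theorem isLn_span {x y : Γ.Completion → k} (hx : x ≠ 0) (hy : y ∉ Submodule.span k {x})
    (hd : Γ.IsDominated (Function.support x ∪ Function.support y)) :
    Γ.IsLn (Submodule.span k {x, y}) :=
  ⟨finrank_span_pair_eq_two hx hy, by rwa [moduleSupport_span_pair]⟩

theorem notMem_span_symm {M : Type*} [AddCommGroup M] [Module k M] {x y : M} (hx : x ≠ 0)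
    (h : y ∉ Submodule.span k {x}) : x ∉ Submodule.span k {y} := by
  intro h'
  obtain ⟨a, rfl⟩ := Submodule.mem_span_singleton.1 h'
  have ha : a ≠ 0 := by
    rintro rfl
    simp at hx
  exact h (Submodule.mem_span_singleton.2 ⟨a⁻¹, by rw [smul_smul, inv_mul_cancel₀ ha, one_smul]⟩)

theorem IsLn.eq_span [Finite V] [Finite E] {W : Submodule k (Γ.Completion → k)} (hW : Γ.IsLn W)
    {x y : Γ.Completion → k} (hx : x ∈ W) (hy : y ∈ W) (hx0 : x ≠ 0)
    (hxy : y ∉ Submodule.span k {x}) : W = Submodule.span k {x, y} := by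
  symm
  apply Submodule.eq_of_le_of_finrank_eq
  · rw [Submodule.span_le]
    rintro z (rfl | rfl) <;> assumption
  · rw [hW.1, finrank_span_pair_eq_two hx0 hxy]

/-- Every line is spanned by two points of the scheme: two points off the coordinate hyperplane of a
vertex that dominates the line. -/
theorem IsLn.exists_pair [Finite V] [Finite E] {W : Submodule k (Γ.Completion → k)}
    (hW : Γ.IsLn W) : ∃ x y, Γ.IsPt x ∧ Γ.IsPt y ∧ y ∉ Submodule.span k {x} ∧
      W = Submodule.span k {x, y} := by
  obtain ⟨u, ⟨x, hx, hxu⟩, hus, hn⟩ := hW.2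
  rw [moduleSupport_subset_iff] at hus
  have hx0 : x ≠ 0 := by
    rintro rfl
    simp at hxu
  have hex : ∃ y ∈ W, y ∉ Submodule.span k {x} := by
    by_contra! hc
    have := Submodule.finrank_mono (show W ≤ Submodule.span k {x} from hc)
    rw [hW.1, finrank_span_singleton hx0] at this
    omega
  obtain ⟨y, hy, hyx⟩ := hex
  by_cases hyu : y (Sum.inl u) = 0
  · have hyx' : x + y ∉ Submodule.span k {x} := by
      intro h
      exact hyx ((Submodule.add_mem_iff_right _ (Submodule.mem_span_singleton_self x)).1 h)
    refine ⟨x, x + y, isPt_of_apply_ne_zero hn (hus hx) hxu,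
      isPt_of_apply_ne_zero hn (hus (W.add_mem hx hy)) (by simpa [hyu] using hxu), hyx',
      hW.eq_span hx (W.add_mem hx hy) hx0 hyx'⟩
  · exact ⟨x, y, isPt_of_apply_ne_zero hn (hus hx) hxu, isPt_of_apply_ne_zero hn (hus hy) hyu, hyx,
      hW.eq_span hx hy hx0 hyx⟩

/-- At most one rational point of a line does not belong to the scheme. -/
theorem IsLn.mem_span_of_not_isPt [Finite V] [Finite E] {W : Submodule k (Γ.Completion → k)}
    (hW : Γ.IsLn W) {x y : Γ.Completion → k} (hx : x ∈ W) (hy : y ∈ W) (hx0 : x ≠ 0)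
    (hxp : ¬ Γ.IsPt x) (hyp : ¬ Γ.IsPt y) : y ∈ Submodule.span k {x} := by
  by_contra hyx
  obtain ⟨u, ⟨z, hz, hzu⟩, hus, hn⟩ := hW.2
  rw [moduleSupport_subset_iff] at hus
  have hxu : x (Sum.inl u) = 0 := by
    by_contra h
    exact hxp (isPt_of_apply_ne_zero hn (hus hx) h)
  have hyu : y (Sum.inl u) = 0 := by
    by_contra h
    exact hyp (isPt_of_apply_ne_zero hn (hus hy) h)
  rw [hW.eq_span hx hy hx0 hyx] at hz
  obtain ⟨a, b, rfl⟩ := Submodule.mem_span_pair.1 hz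
  simp [hxu, hyu] at hzu

/-- An automorphism of the incidence geometry of the points that lie on lines, and of the lines,
expressed by representing vectors and subspaces.  Nothing is required at vectors and subspaces that
represent neither.  Proportional vectors have the same image vector, so that the two maps on vectors
are inverse to each other up to scalars only. -/
structure Collineation (Γ : LooseGraph V E) (k : Type*) [Field k] where
  toFun : (Γ.Completion → k) → Γ.Completion → k
  invFun : (Γ.Completion → k) → Γ.Completion → k
  mapLn : Submodule k (Γ.Completion → k) → Submodule k (Γ.Completion → k)
  comapLn : Submodule k (Γ.Completion → k) → Submodule k (Γ.Completion → k)
  isPt_toFun : ∀ x, Γ.IsPt x → Γ.IsPt (toFun x)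
  isLn_mapLn : ∀ W, Γ.IsLn W → Γ.IsLn (mapLn W)
  mem_mapLn : ∀ x W, Γ.IsPt x → Γ.IsLn W → (toFun x ∈ mapLn W ↔ x ∈ W)
  toFun_smul : ∀ x (c : k), Γ.IsPt x → c ≠ 0 → toFun (c • x) = toFun x
  inv_toFun : ∀ x, Γ.IsPt x → ∃ c : k, c ≠ 0 ∧ invFun (toFun x) = c • x
  comapLn_mapLn : ∀ W, Γ.IsLn W → comapLn (mapLn W) = W
  isPt_invFun : ∀ x, Γ.IsPt x → Γ.IsPt (invFun x)
  isLn_comapLn : ∀ W, Γ.IsLn W → Γ.IsLn (comapLn W)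
  mem_comapLn : ∀ x W, Γ.IsPt x → Γ.IsLn W → (invFun x ∈ comapLn W ↔ x ∈ W)
  invFun_smul : ∀ x (c : k), Γ.IsPt x → c ≠ 0 → invFun (c • x) = invFun x
  toFun_inv : ∀ x, Γ.IsPt x → ∃ c : k, c ≠ 0 ∧ toFun (invFun x) = c • x
  mapLn_comapLn : ∀ W, Γ.IsLn W → mapLn (comapLn W) = W

namespace Collineation

/-- The inverse collineation. -/
def symm (f : Γ.Collineation k) : Γ.Collineation k where
  toFun := f.invFun
  invFun := f.toFun
  mapLn := f.comapLn
  comapLn := f.mapLn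
  isPt_toFun := f.isPt_invFun
  isLn_mapLn := f.isLn_comapLn
  mem_mapLn := f.mem_comapLn
  toFun_smul := f.invFun_smul
  inv_toFun := f.toFun_inv
  comapLn_mapLn := f.mapLn_comapLn
  isPt_invFun := f.isPt_toFun
  isLn_comapLn := f.isLn_mapLn
  mem_comapLn := f.mem_mapLn
  invFun_smul := f.toFun_smul
  toFun_inv := f.inv_toFun
  mapLn_comapLn := f.comapLn_mapLn

variable (f : Γ.Collineation k)

theorem toFun_notMem_span {x y : Γ.Completion → k} (hx : Γ.IsPt x) (hy : Γ.IsPt y)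
    (hxy : y ∉ Submodule.span k {x}) : f.toFun y ∉ Submodule.span k {f.toFun x} := by
  intro h
  obtain ⟨c, hc⟩ := Submodule.mem_span_singleton.1 h
  have hc0 : c ≠ 0 := by
    rintro rfl
    exact (f.isPt_toFun y hy).ne_zero (by simpa using hc.symm)
  obtain ⟨a, ha, h1⟩ := f.inv_toFun x hx
  obtain ⟨b, hb, h2⟩ := f.inv_toFun y hy
  have h3 := f.invFun_smul _ c (f.isPt_toFun x hx) hc0
  rw [hc, h2, h1] at h3
  refine hxy (Submodule.mem_span_singleton.2 ⟨b⁻¹ * a, ?_⟩)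
  rw [mul_smul, ← h3, smul_smul, inv_mul_cancel₀ hb, one_smul]

theorem toFun_mem_mapLn {x : Γ.Completion → k} {W : Submodule k (Γ.Completion → k)}
    (hx : Γ.IsPt x) (hW : Γ.IsLn W) (h : x ∈ W) : f.toFun x ∈ f.mapLn W :=
  (f.mem_mapLn x W hx hW).2 h

theorem invFun_mem_iff {y : Γ.Completion → k} {W : Submodule k (Γ.Completion → k)}
    (hy : Γ.IsPt y) (hW : Γ.IsLn W) : f.invFun y ∈ W ↔ y ∈ f.mapLn W := by
  rw [← f.mem_comapLn y _ hy (f.isLn_mapLn W hW), f.comapLn_mapLn W hW]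

theorem mapLn_span [Finite V] [Finite E] {x y : Γ.Completion → k} (hx : Γ.IsPt x) (hy : Γ.IsPt y)
    (hxy : y ∉ Submodule.span k {x}) (hW : Γ.IsLn (Submodule.span k {x, y})) :
    f.mapLn (Submodule.span k {x, y}) = Submodule.span k {f.toFun x, f.toFun y} :=
  (f.isLn_mapLn _ hW).eq_span
    (f.toFun_mem_mapLn hx hW (Submodule.subset_span (by simp)))
    (f.toFun_mem_mapLn hy hW (Submodule.subset_span (by simp)))
    (f.isPt_toFun x hx).ne_zero (f.toFun_notMem_span hx hy hxy)

end Collineation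

/-! ### The affine space of a vertex -/

/-- The directions of the affine space of the vertex `v`. -/
abbrev Neighbor (Γ : LooseGraph V E) (v : V) : Type _ :=
  {i : Γ.Completion // i ∈ Γ.looseStar v ∧ i ≠ Sum.inl v}

/-- The vector of homogeneous coordinates of a rational point of the affine space of `v`, normalized
by the value one at `v`. -/
noncomputable def starVec {v : V} (t : Γ.Neighbor v → k) : Γ.Completion → k :=
  Set.indicator {Sum.inl v} 1 + Function.extend Subtype.val t 0

variable {v : V}

theorem ext_of_mem_coordSubspace {x y : Γ.Completion → k}
    (hx : x ∈ coordSubspace k (Γ.looseStar v)) (hy : y ∈ coordSubspace k (Γ.looseStar v))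
    (hv : x (Sum.inl v) = y (Sum.inl v)) (h : ∀ i : Γ.Neighbor v, x i = y i) : x = y := by
  ext i
  by_cases hi : i ∈ Γ.looseStar v
  · by_cases hiv : i = Sum.inl v
    · rw [hiv, hv]
    · exact h ⟨i, hi, hiv⟩
  · have h1 : x i = 0 := by
      by_contra h
      exact hi (hx i h)
    have h2 : y i = 0 := by
      by_contra h
      exact hi (hy i h)
    rw [h1, h2]

@[simp] theorem starVec_apply_self (t : Γ.Neighbor v → k) : starVec t (Sum.inl v) = 1 := by
  rw [starVec, Pi.add_apply, Function.extend_apply']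
  · simp
  · rintro ⟨i, hi⟩
    exact i.2.2 hi

@[simp] theorem starVec_apply (t : Γ.Neighbor v → k) (i : Γ.Neighbor v) :
    starVec t (i : Γ.Completion) = t i := by
  rw [starVec, Pi.add_apply, Subtype.val_injective.extend_apply]
  simp [i.2.2]

theorem starVec_mem (t : Γ.Neighbor v → k) : starVec t ∈ coordSubspace k (Γ.looseStar v) := by
  intro i hi
  by_contra h
  apply hi
  rw [starVec, Pi.add_apply, Function.extend_apply']
  · have : i ≠ Sum.inl v := by
      rintro rfl
      exact h (Γ.inl_mem_looseStar_self v)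
    simp [this]
  · rintro ⟨j, rfl⟩
    exact h j.2.1

theorem indicator_neighbor_mem (i : Γ.Neighbor v) :
    Set.indicator {(i : Γ.Completion)} (1 : Γ.Completion → k) ∈
      coordSubspace k (Γ.looseStar v) :=
  indicator_one_mem_coordSubspace.2 (by simpa using i.2.1)

theorem starVec_add_single [DecidableEq (Γ.Neighbor v)] (t : Γ.Neighbor v → k) (i : Γ.Neighbor v)
    (s : k) : starVec (t + Pi.single i s) =
      starVec t + s • Set.indicator {(i : Γ.Completion)} (1 : Γ.Completion → k) := by
  refine ext_of_mem_coordSubspace (v := v) (starVec_mem _)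
    (Submodule.add_mem _ (starVec_mem _) (Submodule.smul_mem _ _ (indicator_neighbor_mem i))) ?_ ?_
  · have : (Sum.inl v : Γ.Completion) ≠ i := i.2.2.symm
    simp [this]
  · intro j
    by_cases hj : j = i
    · subst hj
      simp
    · have : (j : Γ.Completion) ≠ i := fun h => hj (Subtype.ext h)
      simp [hj, this]

theorem starVec_add_smul_sub (t t' : Γ.Neighbor v → k) (s : k) :
    starVec (t + s • (t' - t)) = (1 - s) • starVec t + s • starVec t' := by
  refine ext_of_mem_coordSubspace (v := v) (starVec_mem _)
    (Submodule.add_mem _ (Submodule.smul_mem _ _ (starVec_mem _))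
      (Submodule.smul_mem _ _ (starVec_mem _))) ?_ ?_
  · simp
  · intro j
    simp
    ring

theorem eq_smul_starVec {x : Γ.Completion → k} (hx : x ∈ coordSubspace k (Γ.looseStar v))
    (hv : x (Sum.inl v) ≠ 0) :
    x = x (Sum.inl v) • starVec fun i : Γ.Neighbor v => (x (Sum.inl v))⁻¹ * x i := by
  refine ext_of_mem_coordSubspace (v := v) hx (Submodule.smul_mem _ _ (starVec_mem _)) ?_ ?_
  · simp
  · intro j
    simp [hv]

theorem starVec_injective : Function.Injective (starVec : (Γ.Neighbor v → k) → _) := by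
  intro t t' h
  ext i
  rw [← starVec_apply t i, h, starVec_apply]

theorem starVec_notMem_span {t t' : Γ.Neighbor v → k} (h : t ≠ t') :
    starVec t ∉ Submodule.span k {starVec t'} := by
  intro h1
  obtain ⟨c, hc⟩ := Submodule.mem_span_singleton.1 h1
  have h2 := congrFun hc (Sum.inl v)
  simp only [Pi.smul_apply, starVec_apply_self, smul_eq_mul, mul_one] at h2
  rw [h2, one_smul] at hc
  exact h (starVec_injective hc.symm)

theorem isPt_starVec (hn : (Γ.looseStar v).Nontrivial) (t : Γ.Neighbor v → k) :
    Γ.IsPt (starVec t) :=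
  isPt_of_apply_ne_zero hn (starVec_mem t) (by simp)

/-- A line through a point of the affine space of `v` and another point of its projective
completion. -/
theorem isLn_span_of_apply_ne_zero (hn : (Γ.looseStar v).Nontrivial) {x y : Γ.Completion → k}
    (hx : x ∈ coordSubspace k (Γ.looseStar v)) (hv : x (Sum.inl v) ≠ 0)
    (hy : y ∈ coordSubspace k (Γ.looseStar v)) (hxy : y ∉ Submodule.span k {x}) :
    Γ.IsLn (Submodule.span k {x, y}) :=
  isLn_span (isPt_of_apply_ne_zero hn hx hv).ne_zero hxy ⟨v, Or.inl hv, Set.union_subset hx hy, hn⟩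

theorem indicator_notMem_span_starVec (t : Γ.Neighbor v → k) (i : Γ.Neighbor v) :
    Set.indicator {(i : Γ.Completion)} (1 : Γ.Completion → k) ∉ Submodule.span k {starVec t} := by
  intro h
  obtain ⟨c, hc⟩ := Submodule.mem_span_singleton.1 h
  have h1 : (Sum.inl v : Γ.Completion) ≠ i := i.2.2.symm
  have h2 := congrFun hc (Sum.inl v)
  simp [h1] at h2
  rw [h2, zero_smul] at hc
  have h3 := congrFun hc i
  simp at h3

theorem isLn_span_starVec_indicator (hn : (Γ.looseStar v).Nontrivial) (t : Γ.Neighbor v → k)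
    (i : Γ.Neighbor v) :
    Γ.IsLn (Submodule.span k {starVec t, Set.indicator {(i : Γ.Completion)} 1}) :=
  isLn_span_of_apply_ne_zero hn (starVec_mem t) (by simp) (indicator_neighbor_mem i)
    (indicator_notMem_span_starVec t i)

end Geometry
end LooseGraph

/-! ### Collineations over fields with more than two elements -/

namespace LooseGraph

section Lineation

variable {V E : Type*} {Γ : LooseGraph V E} {k : Type*} [Field k] {v : V}

namespace Collineation

variable (f : Γ.Collineation k)

theorem isLn_span_starVec (hn : (Γ.looseStar v).Nontrivial) {t t' : Γ.Neighbor v → k}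
    (h : t ≠ t') : Γ.IsLn (Submodule.span k {starVec t, starVec t'}) :=
  isLn_span_of_apply_ne_zero hn (starVec_mem t) (by simp) (starVec_mem t')
    (starVec_notMem_span h.symm)

theorem toFun_starVec_notMem_span (hn : (Γ.looseStar v).Nontrivial) (t t' : Γ.Neighbor v → k)
    (h : t ≠ t') : f.toFun (starVec t) ∉ Submodule.span k {f.toFun (starVec t')} :=
  f.toFun_notMem_span (isPt_starVec hn t') (isPt_starVec hn t) (starVec_notMem_span h)

theorem span_starVec_indicator [DecidableEq (Γ.Neighbor v)] (t : Γ.Neighbor v → k)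
    (i : Γ.Neighbor v) {s : k} (hs : s ≠ 0) :
    Submodule.span k {starVec t, Set.indicator {(i : Γ.Completion)} 1} =
      Submodule.span k {starVec t, starVec (t + Pi.single i s)} := by
  apply le_antisymm <;> rw [Submodule.span_le] <;> rintro z (rfl | rfl)
  · exact Submodule.subset_span (by simp)
  · refine Submodule.mem_span_pair.2 ⟨-s⁻¹, s⁻¹, ?_⟩
    rw [starVec_add_single, smul_add, smul_smul, inv_mul_cancel₀ hs, one_smul, ← add_assoc,
      ← add_smul]
    simp
  · exact Submodule.subset_span (by simp)
  · exact Submodule.mem_span_pair.2 ⟨1, s, by rw [one_smul, starVec_add_single]⟩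

/-- The vector `w` represents the common point of the images of all lines of the affine space of
`v` in the direction `i`.  If this direction leads to a vertex, it is the image of that vertex. -/
structure IsDirection [DecidableEq (Γ.Neighbor v)] (i : Γ.Neighbor v) (w : Γ.Completion → k) :
    Prop where
  notMem_span : ∀ t : Γ.Neighbor v → k, w ∉ Submodule.span k {f.toFun (starVec t)}
  mem_mapLn : ∀ t : Γ.Neighbor v → k,
    w ∈ f.mapLn (Submodule.span k {starVec t, Set.indicator {(i : Γ.Completion)} 1})
  eq_toFun : Γ.IsPt (Set.indicator {(i : Γ.Completion)} (1 : Γ.Completion → k)) →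
    w = f.toFun (Set.indicator {(i : Γ.Completion)} 1)

/-- In the direction of a neighbouring vertex, all lines meet in that vertex. -/
theorem isDirection_of_isPt [DecidableEq (Γ.Neighbor v)] (hn : (Γ.looseStar v).Nontrivial)
    (i : Γ.Neighbor v) (hi : Γ.IsPt (Set.indicator {(i : Γ.Completion)} (1 : Γ.Completion → k))) :
    f.IsDirection i (f.toFun (Set.indicator {(i : Γ.Completion)} 1)) where
  notMem_span t := f.toFun_notMem_span (isPt_starVec hn t) hi (indicator_notMem_span_starVec t i)
  mem_mapLn t := f.toFun_mem_mapLn hi (isLn_span_starVec_indicator hn t i)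
    (Submodule.subset_span (by simp))
  eq_toFun _ := rfl

variable [Finite V] [Finite E]

theorem mapLn_span_starVec (hn : (Γ.looseStar v).Nontrivial) {t t' : Γ.Neighbor v → k}
    (h : t ≠ t') : f.mapLn (Submodule.span k {starVec t, starVec t'}) =
      Submodule.span k {f.toFun (starVec t), f.toFun (starVec t')} :=
  f.mapLn_span (isPt_starVec hn t) (isPt_starVec hn t') (starVec_notMem_span h.symm)
    (isLn_span_starVec hn h)

theorem toFun_starVec_mem_span (hn : (Γ.looseStar v).Nontrivial) (t t' : Γ.Neighbor v → k)
    (s : k) : f.toFun (starVec (t + s • (t' - t))) ∈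
      Submodule.span k {f.toFun (starVec t), f.toFun (starVec t')} := by
  by_cases h : t = t'
  · subst h
    rw [sub_self, smul_zero, add_zero]
    exact Submodule.subset_span (by simp)
  rw [← f.mapLn_span_starVec hn h]
  apply f.toFun_mem_mapLn (isPt_starVec hn _) (isLn_span_starVec hn h)
  rw [starVec_add_smul_sub]
  exact Submodule.mem_span_pair.2 ⟨_, _, rfl⟩

theorem exists_of_toFun_starVec_mem_span (hn : (Γ.looseStar v).Nontrivial)
    (t t' z : Γ.Neighbor v → k) (h : t ≠ t') (hz : f.toFun (starVec z) ∈
      Submodule.span k {f.toFun (starVec t), f.toFun (starVec t')}) :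
    ∃ s : k, z = t + s • (t' - t) := by
  rw [← f.mapLn_span_starVec hn h, f.mem_mapLn _ _ (isPt_starVec hn _) (isLn_span_starVec hn h),
    Submodule.mem_span_pair] at hz
  obtain ⟨a, b, hab⟩ := hz
  have h1 := congrFun hab (Sum.inl v)
  simp only [Pi.add_apply, Pi.smul_apply, starVec_apply_self, smul_eq_mul, mul_one] at h1
  refine ⟨b, starVec_injective ?_⟩
  rw [starVec_add_smul_sub, ← hab, ← h1, add_sub_cancel_right]

theorem mapLn_span_starVec_indicator [DecidableEq (Γ.Neighbor v)]
    (hn : (Γ.looseStar v).Nontrivial) (t : Γ.Neighbor v → k)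
    (i : Γ.Neighbor v) {s : k} (hs : s ≠ 0) :
    f.mapLn (Submodule.span k {starVec t, Set.indicator {(i : Γ.Completion)} 1}) =
      Submodule.span k {f.toFun (starVec t), f.toFun (starVec (t + Pi.single i s))} := by
  rw [span_starVec_indicator t i hs, f.mapLn_span_starVec hn]
  intro h
  apply hs
  simpa using congrFun h i

/-- The images of two parallel lines meet: the diagonals of a trapezoid with two sides on the lines
meet in a point, so that the images lie in a plane. -/
theorem exists_mem_mapLn_inf [DecidableEq (Γ.Neighbor v)] (hn : (Γ.looseStar v).Nontrivial)
    {τ : k} (hτ : τ ≠ 0) (hτ' : τ ≠ -1) (i : Γ.Neighbor v) (t : Γ.Neighbor v → k)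
    (ht : ∀ s, t ≠ Pi.single i s) : ∃ c ≠ 0,
      c ∈ f.mapLn (Submodule.span k {starVec (0 : Γ.Neighbor v → k), Set.indicator {(i : Γ.Completion)} 1}) ∧
      c ∈ f.mapLn (Submodule.span k {starVec t, Set.indicator {(i : Γ.Completion)} 1}) := by
  rw [f.mapLn_span_starVec_indicator hn 0 i one_ne_zero,
    f.mapLn_span_starVec_indicator hn t i hτ]
  have h1 : 1 + τ ≠ 0 := fun h => hτ' (by linear_combination h)
  -- `z` is the intersection of the diagonals
  set l : k := (1 + τ)⁻¹ with hl
  have hl1 : l * (1 + τ) = 1 := inv_mul_cancel₀ h1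
  set z : Γ.Neighbor v → k := l • (t + Pi.single i τ) with hz
  have hz1 := f.toFun_starVec_mem_span hn 0 (t + Pi.single i τ) l
  have hz2 := f.toFun_starVec_mem_span hn (0 + Pi.single i 1) t l
  rw [sub_zero, zero_add, ← hz] at hz1
  have e : (0 + Pi.single i 1 : Γ.Neighbor v → k) + l • (t - (0 + Pi.single i 1)) = z := by
    ext j
    by_cases hj : j = i
    · subst hj
      simp [hz]
      linear_combination -hl1
    · simp [hz, hj]
  rw [e] at hz2
  obtain ⟨a, b, hab⟩ := Submodule.mem_span_pair.1 hz1
  obtain ⟨c, d, hcd⟩ := Submodule.mem_span_pair.1 hz2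
  refine ⟨a • f.toFun (starVec (0 : Γ.Neighbor v → k)) - c • f.toFun (starVec (0 + Pi.single i 1)), ?_, ?_, ?_⟩
  · intro h0
    have hc : c = 0 := by
      by_contra hc
      refine f.toFun_starVec_notMem_span hn (0 + Pi.single i 1) 0 ?_
        (Submodule.mem_span_singleton.2 ⟨c⁻¹ * a, ?_⟩)
      · intro h
        simpa using congrFun h i
      · rw [mul_smul, sub_eq_zero.1 h0, smul_smul, inv_mul_cancel₀ hc, one_smul]
    rw [hc, zero_smul, sub_zero] at h0
    rw [h0, zero_add] at hab
    refine f.toFun_starVec_notMem_span hn z (t + Pi.single i τ) ?_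
      (Submodule.mem_span_singleton.2 ⟨b, hab⟩)
    intro h
    have h2 : (l - 1) • (t + Pi.single i τ) = 0 := by
      rw [sub_smul, one_smul, ← hz, h, sub_self]
    rcases smul_eq_zero.1 h2 with h3 | h3
    · apply hτ
      rw [sub_eq_zero.1 h3] at hl1
      linear_combination hl1
    · apply ht (-τ)
      rw [eq_neg_of_add_eq_zero_left h3, ← Pi.single_neg]
  · exact Submodule.mem_span_pair.2 ⟨a, -c, by rw [neg_smul, sub_eq_add_neg]⟩
  · refine Submodule.mem_span_pair.2 ⟨d, -b, ?_⟩
    have : a • f.toFun (starVec (0 : Γ.Neighbor v → k)) = f.toFun (starVec z) - b • f.toFun (starVec (t + Pi.single i τ))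
      := by rw [← hab]; abel
    rw [this, ← hcd]
    module

/-- In the direction of a loose edge, exactly one point of each image line lies outside the scheme,
and any two image lines meet in such a point. -/
theorem exists_isDirection [DecidableEq (Γ.Neighbor v)] (hn : (Γ.looseStar v).Nontrivial)
    [Nontrivial (Γ.Neighbor v)] {τ : k} (hτ : τ ≠ 0) (hτ' : τ ≠ -1) (i : Γ.Neighbor v) :
    ∃ w, f.IsDirection i w := by
  by_cases hi : Γ.IsPt (Set.indicator {(i : Γ.Completion)} (1 : Γ.Completion → k))
  · exact ⟨_, f.isDirection_of_isPt hn i hi⟩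
  have hnot : ∀ t : Γ.Neighbor v → k, (∀ s, t ≠ Pi.single i s) → ∀ c,
      c ∈ f.mapLn (Submodule.span k {starVec (0 : Γ.Neighbor v → k), Set.indicator {(i : Γ.Completion)} 1}) →
      c ∈ f.mapLn (Submodule.span k {starVec t, Set.indicator {(i : Γ.Completion)} 1}) →
      ¬ Γ.IsPt c := by
    intro t ht c h1 h2 hc
    rw [← f.invFun_mem_iff hc (isLn_span_starVec_indicator hn _ i), Submodule.mem_span_pair]
      at h1 h2
    obtain ⟨a, b, hab⟩ := h1
    obtain ⟨a', b', hab'⟩ := h2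
    have hv : (Sum.inl v : Γ.Completion) ≠ i := i.2.2.symm
    have haa : a = a' := by
      have := congrFun (hab.trans hab'.symm) (Sum.inl v)
      simpa [hv] using this
    subst haa
    by_cases ha : a = 0
    · rw [ha, zero_smul, zero_add] at hab
      have hp := f.isPt_invFun c hc
      have hb : b ≠ 0 := by
        rintro rfl
        exact hp.ne_zero (by rw [← hab, zero_smul])
      rw [← hab] at hp
      have := hp.smul (inv_ne_zero hb)
      rw [smul_smul, inv_mul_cancel₀ hb, one_smul] at this
      exact hi this
    · apply ht (a⁻¹ * (b - b'))
      ext j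
      have := congrFun (hab.trans hab'.symm) j
      by_cases hj : j = i
      · subst hj
        simp at this
        simp
        field_simp
        linear_combination -this
      · have hj' : (j : Γ.Completion) ≠ i := fun h => hj (Subtype.ext h)
        simpa [hj', hj, ha] using this.symm
  obtain ⟨j, hj⟩ := exists_ne i
  have hone : ∀ s : k, (Pi.single j 1 : Γ.Neighbor v → k) ≠ Pi.single i s := by
    intro s h
    have := congrFun h j
    simp [hj] at this
  obtain ⟨w, hw0, hw1, hw2⟩ := f.exists_mem_mapLn_inf hn hτ hτ' i (Pi.single j 1) hone
  have hw := hnot _ hone w hw1 hw2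
  refine ⟨w, ⟨?_, ?_, fun h => absurd h hi⟩⟩
  · intro t ht
    obtain ⟨c, rfl⟩ := Submodule.mem_span_singleton.1 ht
    have hc : c ≠ 0 := by
      rintro rfl
      exact hw0 (zero_smul _ _)
    exact hw ((f.isPt_toFun _ (isPt_starVec hn t)).smul hc)
  · intro t
    by_cases ht : ∀ s, t ≠ Pi.single i s
    · obtain ⟨c, hc0, hc1, hc2⟩ := f.exists_mem_mapLn_inf hn hτ hτ' i t ht
      have hc := hnot t ht c hc1 hc2
      have := (f.isLn_mapLn _ (isLn_span_starVec_indicator hn 0 i)).mem_span_of_not_isPt hc1 hw1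
        hc0 hc hw
      exact (Submodule.span_singleton_le_iff_mem _ _).2 hc2 this
    · push Not at ht
      obtain ⟨s, rfl⟩ := ht
      -- this is the line through the origin
      have e : Submodule.span k {starVec (Pi.single i s),
            Set.indicator {(i : Γ.Completion)} (1 : Γ.Completion → k)} =
          Submodule.span k {starVec (0 : Γ.Neighbor v → k), Set.indicator {(i : Γ.Completion)} 1} := by
        have h0 := starVec_add_single (0 : Γ.Neighbor v → k) i s
        rw [zero_add] at h0
        rw [h0]
        apply le_antisymm <;> rw [Submodule.span_le] <;> rintro z (rfl | rfl)
        · exact Submodule.mem_span_pair.2 ⟨1, s, by rw [one_smul]⟩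
        · exact Submodule.subset_span (by simp)
        · exact Submodule.mem_span_pair.2 ⟨1, -s, by module⟩
        · exact Submodule.subset_span (by simp)
      rw [e]
      exact hw1

/-- The semilinear form of a collineation on the affine space of `v`, over a field with more than
two elements. -/
theorem exists_semilinear_of_ne [Fintype (Γ.Neighbor v)] (hn : (Γ.looseStar v).Nontrivial)
    [Nontrivial (Γ.Neighbor v)] {τ : k} (hτ : τ ≠ 0) (hτ' : τ ≠ -1) :
    ∃ (σ : k ≃+* k) (w : Γ.Neighbor v → Γ.Completion → k), ∀ t : Γ.Neighbor v → k,
      ∃ r : k, r ≠ 0 ∧ f.toFun (starVec t) = r • (f.toFun (starVec (0 : Γ.Neighbor v → k)) + ∑ i, σ (t i) • w i) := by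
  classical
  choose w hw using f.exists_isDirection hn hτ hτ'
  have H : IsLineation (fun t : Γ.Neighbor v → k => f.toFun (starVec t)) w :=
    { notMem_span := f.toFun_starVec_notMem_span hn
      mem_span := f.toFun_starVec_mem_span hn
      exists_of_mem_span := f.exists_of_toFun_starVec_mem_span hn
      dir_notMem_span := fun t i => (hw i).notMem_span t
      dir_mem_span := fun t i s hs => by
        rw [← f.mapLn_span_starVec_indicator hn t i hs]
        exact (hw i).mem_mapLn t }
  apply H.exists_semilinear
  set i : Γ.Neighbor v := Classical.arbitrary _
  have hL := isLn_span_starVec_indicator (k := k) hn 0 i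
  have hL' := f.isLn_mapLn _ hL
  have e : Submodule.span k {f.toFun (starVec (0 : Γ.Neighbor v → k)), w i} =
      f.mapLn (Submodule.span k {starVec (0 : Γ.Neighbor v → k), Set.indicator {(i : Γ.Completion)} 1}) := by
    symm
    apply hL'.eq_span
    · exact f.toFun_mem_mapLn (isPt_starVec hn 0) hL (Submodule.subset_span (by simp))
    · exact (hw i).mem_mapLn 0
    · exact (f.isPt_toFun _ (isPt_starVec hn 0)).ne_zero
    · exact (hw i).notMem_span 0
  -- a point of the image line either belongs to the scheme, and hence to the image of the
  -- coordinate line, or is the only rational point `c` of the image line outside the scheme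
  obtain ⟨c, hc⟩ : ∃ c : Γ.Completion → k, ∀ y ∈ Submodule.span k {f.toFun (starVec (0 : Γ.Neighbor v → k)), w i},
      ¬ Γ.IsPt y → y ∈ Submodule.span k {c} := by
    by_cases hex : ∃ c ∈ Submodule.span k {f.toFun (starVec (0 : Γ.Neighbor v → k)), w i}, c ≠ 0 ∧ ¬ Γ.IsPt c
    · obtain ⟨c, hc1, hc2, hc3⟩ := hex
      rw [e] at hc1 ⊢
      exact ⟨c, fun y hy hyp => hL'.mem_span_of_not_isPt hc1 hy hc2 hc3 hyp⟩
    · push Not at hex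
      refine ⟨0, fun y hy hyp => ?_⟩
      by_contra h0
      exact hyp (hex y hy fun h => h0 (by simp [h]))
  refine ⟨i, c, fun y hy => ?_⟩
  by_cases hyp : Γ.IsPt y
  swap
  · exact Or.inr (Or.inr (hc y hy hyp))
  rw [e, ← f.invFun_mem_iff hyp hL, Submodule.mem_span_pair] at hy
  obtain ⟨a, b, hab⟩ := hy
  obtain ⟨r, hr, hry⟩ := f.toFun_inv y hyp
  have hyr : y = r⁻¹ • f.toFun (f.invFun y) := by
    rw [hry, smul_smul, inv_mul_cancel₀ hr, one_smul]
  have hp := f.isPt_invFun y hyp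
  by_cases ha : a = 0
  · rw [ha, zero_smul, zero_add] at hab
    have hb : b ≠ 0 := by
      rintro rfl
      exact hp.ne_zero (by rw [← hab, zero_smul])
    have hi : Γ.IsPt (Set.indicator {(i : Γ.Completion)} (1 : Γ.Completion → k)) := by
      have := hp.smul (inv_ne_zero hb)
      rwa [← hab, smul_smul, inv_mul_cancel₀ hb, one_smul] at this
    refine Or.inr (Or.inl (Submodule.mem_span_singleton.2 ⟨r⁻¹, ?_⟩))
    rw [(hw i).eq_toFun hi, ← f.toFun_smul _ b hi hb, hab, ← hyr]
  · refine Or.inl ⟨a⁻¹ * b, Submodule.mem_span_singleton.2 ⟨r⁻¹, ?_⟩⟩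
    have h2 : f.invFun y = a • starVec (Pi.single i (a⁻¹ * b)) := by
      have := starVec_add_single (0 : Γ.Neighbor v → k) i (a⁻¹ * b)
      rw [zero_add] at this
      rw [this, ← hab, smul_add, smul_smul, mul_inv_cancel_left₀ ha]
    rw [← f.toFun_smul _ a (isPt_starVec hn _) ha, ← h2, ← hyr]

end Collineation
end Lineation
end LooseGraph

/-! ### Collineations over the field with two elements -/

namespace LooseGraph

section Two

variable {V E : Type*} {Γ : LooseGraph V E} {k : Type*} [Field k] {v : V}

/-- If `v` has no neighbouring vertex, a dominated set containing `v` is dominated by `v`. -/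
theorem IsDominated.subset_looseStar (hv : ∀ w, Sum.inl w ∈ Γ.looseStar v → w = v)
    {S : Set Γ.Completion} (hS : Γ.IsDominated S) (h : Sum.inl v ∈ S) : S ⊆ Γ.looseStar v := by
  obtain ⟨u, -, hus, -⟩ := hS
  rwa [hv u (Γ.inl_mem_looseStar_symm (hus h))] at hus

theorem IsPt.apply_ne_zero (hv : ∀ w, Sum.inl w ∈ Γ.looseStar v → w = v) {x : Γ.Completion → k}
    (hx : Γ.IsPt x) (h : x ∈ coordSubspace k (Γ.looseStar v)) : x (Sum.inl v) ≠ 0 := by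
  obtain ⟨u, hu, -⟩ := hx
  have := hv u (mem_coordSubspace.1 h hu)
  rwa [this] at hu

namespace Collineation

variable [Finite V] [Finite E] (f : Γ.Collineation k)

theorem toFun_starVec_add_single [DecidableEq (Γ.Neighbor v)] (hk : ∀ c : k, c = 0 ∨ c = 1)
    (hn : (Γ.looseStar v).Nontrivial) (i : Γ.Neighbor v)
    (hi : Γ.IsPt (Set.indicator {(i : Γ.Completion)} (1 : Γ.Completion → k)))
    (t : Γ.Neighbor v → k) : f.toFun (starVec (t + Pi.single i 1)) =
      f.toFun (starVec t) + f.toFun (Set.indicator {(i : Γ.Completion)} 1) := by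
  have hd := f.isDirection_of_isPt hn i hi
  have h1 := hd.mem_mapLn t
  rw [f.mapLn_span_starVec_indicator hn t i one_ne_zero, Submodule.mem_span_pair] at h1
  obtain ⟨a, b, hab⟩ := h1
  have ha : a = 1 := by
    refine (hk a).resolve_left ?_
    rintro rfl
    exact hd.notMem_span (t + Pi.single i 1) (Submodule.mem_span_singleton.2 ⟨b, by simpa using hab⟩)
  have hb : b = 1 := by
    refine (hk b).resolve_left ?_
    rintro rfl
    exact hd.notMem_span t (Submodule.mem_span_singleton.2 ⟨a, by simpa using hab⟩)
  have h2 : (1 : k) + 1 = 0 := by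
    rcases hk (1 + 1) with h | h
    · exact h
    · exact absurd (add_eq_left.1 h) one_ne_zero
  rw [← hab, ha, hb]
  calc f.toFun (starVec (t + Pi.single i 1)) = ((1 : k) + 1) • f.toFun (starVec t) +
        f.toFun (starVec (t + Pi.single i 1)) := by rw [h2, zero_smul, zero_add]
    _ = _ := by module

/-- If at most one direction is loose, the points at infinity of the other directions determine
the images of all parallels, so that the collineation is linear. -/
theorem exists_semilinear_of_subsingleton [Fintype (Γ.Neighbor v)] (hk : ∀ c : k, c = 0 ∨ c = 1)
    (hn : (Γ.looseStar v).Nontrivial)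
    (hl : ∀ i j : Γ.Neighbor v,
      ¬ Γ.IsPt (Set.indicator {(i : Γ.Completion)} (1 : Γ.Completion → k)) →
      ¬ Γ.IsPt (Set.indicator {(j : Γ.Completion)} (1 : Γ.Completion → k)) → i = j) :
    ∃ (σ : k ≃+* k) (w : Γ.Neighbor v → Γ.Completion → k), ∀ t : Γ.Neighbor v → k,
      ∃ r : k, r ≠ 0 ∧ f.toFun (starVec t) =
        r • (f.toFun (starVec (0 : Γ.Neighbor v → k)) + ∑ i, σ (t i) • w i) := by
  classical
  set w : Γ.Neighbor v → Γ.Completion → k := fun i =>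
    if Γ.IsPt (Set.indicator {(i : Γ.Completion)} (1 : Γ.Completion → k)) then
      f.toFun (Set.indicator {(i : Γ.Completion)} 1)
    else f.toFun (starVec (Pi.single i 1)) - f.toFun (starVec (0 : Γ.Neighbor v → k)) with hw
  refine ⟨RingEquiv.refl k, w, ?_⟩
  suffices h : ∀ (n : ℕ) (t : Γ.Neighbor v → k), (Finset.univ.filter fun i : Γ.Neighbor v =>
      t i ≠ 0 ∧ Γ.IsPt (Set.indicator {(i : Γ.Completion)} (1 : Γ.Completion → k))).card = n →
      f.toFun (starVec t) = f.toFun (starVec (0 : Γ.Neighbor v → k)) + ∑ i, t i • w i by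
    intro t
    exact ⟨1, one_ne_zero, by rw [one_smul, h _ t rfl]; rfl⟩
  intro n
  induction n with
  | zero =>
    intro t ht
    rw [Finset.card_eq_zero, Finset.filter_eq_empty_iff] at ht
    have ht' : ∀ i, t i ≠ 0 →
        ¬ Γ.IsPt (Set.indicator {(i : Γ.Completion)} (1 : Γ.Completion → k)) := by
      intro i hi hp
      exact ht (Finset.mem_univ i) ⟨hi, hp⟩
    by_cases h0 : ∃ i, t i ≠ 0
    · obtain ⟨i, hi⟩ := h0
      have hti : t = Pi.single i 1 := by
        ext j
        by_cases hj : j = i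
        · subst hj
          rw [(hk (t j)).resolve_left hi, Pi.single_eq_same]
        · rw [Pi.single_eq_of_ne hj]
          by_contra h
          exact hj (hl j i (ht' j h) (ht' i hi))
      have hwi : w i = f.toFun (starVec (Pi.single i 1)) -
          f.toFun (starVec (0 : Γ.Neighbor v → k)) := if_neg (ht' i hi)
      rw [Finset.sum_eq_single i]
      · rw [hti, Pi.single_eq_same, one_smul, hwi, add_sub_cancel]
      · intro j _ hj
        rw [hti, Pi.single_eq_of_ne hj, zero_smul]
      · simp
    · push Not at h0
      have : t = 0 := funext h0
      subst this
      simp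
  | succ n ih =>
    intro t ht
    have hex : ∃ i, t i ≠ 0 ∧
        Γ.IsPt (Set.indicator {(i : Γ.Completion)} (1 : Γ.Completion → k)) := by
      have : 0 < (Finset.univ.filter fun i : Γ.Neighbor v =>
        t i ≠ 0 ∧ Γ.IsPt (Set.indicator {(i : Γ.Completion)} (1 : Γ.Completion → k))).card := by
        rw [ht]
        exact n.succ_pos
      obtain ⟨i, hi⟩ := Finset.card_pos.1 this
      exact ⟨i, (Finset.mem_filter.1 hi).2⟩
    obtain ⟨i, hi, hp⟩ := hex
    set u := Function.update t i 0 with hu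
    have htu : t = u + Pi.single i 1 := by
      ext j
      by_cases hj : j = i
      · subst hj
        simp [hu, (hk (t j)).resolve_left hi]
      · simp [hu, hj]
    have hwi : w i = f.toFun (Set.indicator {(i : Γ.Completion)} 1) := if_pos hp
    rw [htu, f.toFun_starVec_add_single hk hn i hp, ih u, add_assoc, ← hwi]
    · congr 1
      simp only [Pi.add_apply, add_smul, Finset.sum_add_distrib]
      congr 1
      rw [Finset.sum_eq_single i]
      · simp
      · intro j _ hj
        simp [hj]
      · simp
    · have : (Finset.univ.filter fun j : Γ.Neighbor v =>
          u j ≠ 0 ∧ Γ.IsPt (Set.indicator {(j : Γ.Completion)} (1 : Γ.Completion → k))) =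
          (Finset.univ.filter fun j : Γ.Neighbor v => t j ≠ 0 ∧
            Γ.IsPt (Set.indicator {(j : Γ.Completion)} (1 : Γ.Completion → k))).erase i := by
        ext j
        by_cases hj : j = i
        · subst hj
          simp [hu]
        · simp [hu, hj]
      rw [this, Finset.card_erase_of_mem (Finset.mem_filter.2 ⟨Finset.mem_univ i, hi, hp⟩), ht, Nat.add_sub_cancel]

/-- For a vertex without neighbouring vertices, the image of its affine space is the affine space of
another vertex. -/
theorem exists_affine_image (hk : ∀ c : k, c = 0 ∨ c = 1) (hn : (Γ.looseStar v).Nontrivial)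
    (hv : ∀ w, Sum.inl w ∈ Γ.looseStar v → w = v) :
    ∃ u : V, ∀ y : Γ.Completion → k,
      (y ∈ coordSubspace k (Γ.looseStar u) ∧ y (Sum.inl u) ≠ 0) ↔
        ∃ t : Γ.Neighbor v → k, y = f.toFun (starVec t) := by
  have hone : ∀ c : k, c ≠ 0 → c = 1 := fun c hc => (hk c).resolve_left hc
  have hspan : ∀ x y : Γ.Completion → k, y ≠ 0 → y ≠ x → y ∉ Submodule.span k {x} := by
    intro x y hy hyx h
    obtain ⟨c, rfl⟩ := Submodule.mem_span_singleton.1 h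
    by_cases hc : c = 0
    · exact hy (by rw [hc, zero_smul])
    · exact hyx (by rw [hone c hc, one_smul])
  have hinv : f.invFun (f.toFun (starVec (0 : Γ.Neighbor v → k))) =
      starVec (0 : Γ.Neighbor v → k) := by
    obtain ⟨c, hc, h⟩ := f.inv_toFun _ (isPt_starVec hn (0 : Γ.Neighbor v → k))
    rw [h, hone c hc, one_smul]
  have hp0 := f.isPt_toFun _ (isPt_starVec hn (0 : Γ.Neighbor v → k))
  -- lines through the image of the origin come from the affine space of `v`
  have hback : ∀ W, Γ.IsLn W → f.toFun (starVec (0 : Γ.Neighbor v → k)) ∈ W → ∀ y ∈ W, Γ.IsPt y →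
      f.invFun y ∈ coordSubspace k (Γ.looseStar v) ∧ f.invFun y (Sum.inl v) = 1 := by
    intro W hW h0 y hy hyp
    have h1 : starVec (0 : Γ.Neighbor v → k) ∈ f.comapLn W := by
      rw [← hinv]
      exact (f.mem_comapLn _ _ hp0 hW).2 h0
    have h2 := (f.isLn_comapLn W hW).2.subset_looseStar hv ⟨_, h1, by simp⟩
    rw [moduleSupport_subset_iff] at h2
    have h3 := h2 ((f.mem_comapLn _ _ hyp hW).2 hy)
    exact ⟨h3, hone _ ((f.isPt_invFun y hyp).apply_ne_zero hv h3)⟩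
  obtain ⟨u, hu, hus, hun⟩ := f.isPt_toFun _ (isPt_starVec hn (0 : Γ.Neighbor v → k))
  -- `u` has no neighbouring vertex either, as no line through the origin has a third point
  have huu : ∀ w, Sum.inl w ∈ Γ.looseStar u → w = u := by
    intro w hw
    by_contra hwu
    have hwp : Γ.IsPt (Set.indicator {Sum.inl w} (1 : Γ.Completion → k)) := isPt_indicator hun hw
    have hwm : Set.indicator {Sum.inl w} (1 : Γ.Completion → k) ∈
        coordSubspace k (Γ.looseStar u) := indicator_one_mem_coordSubspace.2 (by simpa using hw)
    have huw : (Sum.inl u : Γ.Completion) ≠ Sum.inl w := fun h => hwu (Sum.inl_injective h).symm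
    have hwu0 : (Set.indicator {Sum.inl w} (1 : Γ.Completion → k)) (Sum.inl u) = 0 := by
      simpa using fun h : u = w => hwu h.symm
    have hne : Set.indicator {Sum.inl w} (1 : Γ.Completion → k) ≠
        f.toFun (starVec (0 : Γ.Neighbor v → k)) := by
      intro h
      exact hu (by rw [← h, hwu0])
    have hW := isLn_span_of_apply_ne_zero hun hus hu hwm (hspan _ _ hwp.ne_zero hne)
    have hsp : Γ.IsPt (f.toFun (starVec (0 : Γ.Neighbor v → k)) + Set.indicator {Sum.inl w} 1) :=
      isPt_of_apply_ne_zero hun (Submodule.add_mem _ hus hwm)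
        (by rw [Pi.add_apply, hwu0, add_zero]; exact hu)
    have m0 : f.toFun (starVec (0 : Γ.Neighbor v → k)) ∈ Submodule.span k
        {f.toFun (starVec (0 : Γ.Neighbor v → k)), Set.indicator {Sum.inl w} 1} :=
      Submodule.subset_span (by simp)
    have m1 : Set.indicator {Sum.inl w} (1 : Γ.Completion → k) ∈ Submodule.span k
        {f.toFun (starVec (0 : Γ.Neighbor v → k)), Set.indicator {Sum.inl w} 1} :=
      Submodule.subset_span (by simp)
    have m2 := Submodule.add_mem _ m0 m1
    obtain ⟨-, b0⟩ := hback _ hW m0 _ m0 hp0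
    obtain ⟨-, b1⟩ := hback _ hW m0 _ m1 hwp
    obtain ⟨-, b2⟩ := hback _ hW m0 _ m2 hsp
    have n01 := f.symm.toFun_notMem_span hp0 hwp (hspan _ _ hwp.ne_zero hne)
    have n02 := f.symm.toFun_notMem_span hp0 hsp
      (hspan _ _ hsp.ne_zero (fun h => hwp.ne_zero (add_eq_left.1 h)))
    have n12 := f.symm.toFun_notMem_span hwp hsp
      (hspan _ _ hsp.ne_zero (fun h => hp0.ne_zero (add_eq_right.1 h)))
    have h3 := (f.isLn_comapLn _ hW).eq_span ((f.mem_comapLn _ _ hp0 hW).2 m0)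
      ((f.mem_comapLn _ _ hwp hW).2 m1) (f.isPt_invFun _ hp0).ne_zero n01
    have h4 := (f.mem_comapLn _ _ hsp hW).2 m2
    rw [h3, Submodule.mem_span_pair] at h4
    obtain ⟨a, b, hab⟩ := h4
    have h5 := congrFun hab (Sum.inl v)
    rw [b2, Pi.add_apply, Pi.smul_apply, Pi.smul_apply, b0, b1] at h5
    rcases hk a with rfl | rfl
    · exact n12 (Submodule.mem_span_singleton.2 ⟨b, by rwa [zero_smul, zero_add] at hab⟩)
    · have hb : b = 0 := by simpa using h5
      rw [hb] at hab
      exact n02 (Submodule.mem_span_singleton.2 ⟨1, by rwa [zero_smul, add_zero] at hab⟩)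
  refine ⟨u, fun y => ⟨?_, ?_⟩⟩
  · rintro ⟨hy, hyu⟩
    by_cases hy0 : y = f.toFun (starVec (0 : Γ.Neighbor v → k))
    · exact ⟨0, hy0⟩
    have hyp : Γ.IsPt y := isPt_of_apply_ne_zero hun hy hyu
    have hW := isLn_span_of_apply_ne_zero hun hus hu hy (hspan _ _ hyp.ne_zero hy0)
    obtain ⟨h1, h2⟩ := hback _ hW (Submodule.subset_span (by simp)) y
      (Submodule.subset_span (by simp)) hyp
    have h3 := eq_smul_starVec h1 (by rw [h2]; exact one_ne_zero)
    rw [h2, one_smul] at h3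
    obtain ⟨c, hc, h4⟩ := f.toFun_inv y hyp
    exact ⟨_, by rw [← h3, h4, hone c hc, one_smul]⟩
  · rintro ⟨t, rfl⟩
    by_cases ht : t = 0
    · rw [ht]
      exact ⟨hus, hu⟩
    have hL := f.isLn_mapLn _ (isLn_span_starVec (k := k) hn (Ne.symm ht))
    have h1 := hL.2.subset_looseStar huu ⟨_, f.toFun_mem_mapLn (isPt_starVec hn _)
      (isLn_span_starVec (k := k) hn (Ne.symm ht)) (Submodule.subset_span (by simp)), hu⟩
    have h2 := moduleSupport_subset_iff.1 h1 (f.toFun_mem_mapLn (isPt_starVec hn t)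
      (isLn_span_starVec (k := k) hn (Ne.symm ht)) (Submodule.subset_span (by simp)))
    exact ⟨h2, (f.isPt_toFun _ (isPt_starVec hn t)).apply_ne_zero huu h2⟩

/-- Every permutation of the affine plane over the field with two elements is affine. -/
theorem exists_semilinear_of_two_loose [Fintype (Γ.Neighbor v)] (hk : ∀ c : k, c = 0 ∨ c = 1)
    (hn : (Γ.looseStar v).Nontrivial) (hv : ∀ w, Sum.inl w ∈ Γ.looseStar v → w = v)
    {i j : Γ.Neighbor v} (hij : i ≠ j) (hall : ∀ l, l = i ∨ l = j) :
    ∃ (σ : k ≃+* k) (w : Γ.Neighbor v → Γ.Completion → k), ∀ t : Γ.Neighbor v → k,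
      ∃ r : k, r ≠ 0 ∧ f.toFun (starVec t) =
        r • (f.toFun (starVec (0 : Γ.Neighbor v → k)) + ∑ i, σ (t i) • w i) := by
  classical
  have hone : ∀ c : k, c ≠ 0 → c = 1 := fun c hc => (hk c).resolve_left hc
  obtain ⟨u, hu⟩ := f.exists_affine_image hk hn hv
  set h : (Γ.Neighbor v → k) → Γ.Completion → k := fun t => f.toFun (starVec t) with hh
  have hinj : ∀ t t', t ≠ t' → h t ≠ h t' := by
    intro t t' htt heq
    apply f.toFun_starVec_notMem_span hn t t' htt
    change h t ∈ _
    rw [heq]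
    exact Submodule.mem_span_singleton_self _
  have hcases : ∀ t : Γ.Neighbor v → k, t = 0 ∨ t = Pi.single i 1 ∨ t = Pi.single j 1 ∨
      t = Pi.single i 1 + Pi.single j 1 := by
    intro t
    have ht : t = Pi.single i (t i) + Pi.single j (t j) := by
      ext l
      rcases hall l with rfl | rfl
      · simp [hij]
      · simp [hij.symm]
    rcases hk (t i) with h1 | h1 <;> rcases hk (t j) with h2 | h2 <;> rw [h1, h2] at ht
    · exact Or.inl (by simpa using ht)
    · exact Or.inr (Or.inr (Or.inl (by simpa using ht)))
    · exact Or.inr (Or.inl (by simpa using ht))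
    · exact Or.inr (Or.inr (Or.inr ht))
  have hi0 : (Pi.single i 1 : Γ.Neighbor v → k) ≠ 0 := by simp
  have hj0 : (Pi.single j 1 : Γ.Neighbor v → k) ≠ 0 := by simp
  have hij1 : (Pi.single i 1 : Γ.Neighbor v → k) ≠ Pi.single j 1 := by
    intro h1
    have := congrFun h1 i
    simp [hij] at this
  have h2 : (1 : k) + 1 = 0 := by
    rcases hk (1 + 1) with h | h
    · exact h
    · exact absurd (add_eq_left.1 h) one_ne_zero
  have hdbl : ∀ x : Γ.Completion → k, x + x = 0 := by
    intro x
    calc x + x = ((1 : k) + 1) • x := by rw [add_smul, one_smul]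
      _ = 0 := by rw [h2, zero_smul]
  -- the sum of three points of an affine space over this field is again a point of it
  have hsum : h (Pi.single i 1) + h (Pi.single j 1) - h 0 = h (Pi.single i 1 + Pi.single j 1) := by
    have m : ∀ t, h t ∈ coordSubspace k (Γ.looseStar u) ∧ h t (Sum.inl u) = 1 := by
      intro t
      obtain ⟨h3, h4⟩ := (hu (h t)).2 ⟨t, rfl⟩
      exact ⟨h3, hone _ h4⟩
    obtain ⟨t, ht⟩ := (hu (h (Pi.single i 1) + h (Pi.single j 1) - h 0)).1
      ⟨Submodule.sub_mem _ (Submodule.add_mem _ (m _).1 (m _).1) (m _).1, by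
        simp [(m _).2]⟩
    change _ = h t at ht
    rcases hcases t with rfl | rfl | rfl | rfl
    · exfalso
      apply hinj _ _ hij1
      rw [sub_eq_iff_eq_add, hdbl] at ht
      rw [eq_neg_of_add_eq_zero_left ht, neg_eq_of_add_eq_zero_left (hdbl _)]
    · exfalso
      apply hinj _ _ hj0
      rw [add_sub_assoc, add_eq_left, sub_eq_zero] at ht
      exact ht
    · exfalso
      apply hinj _ _ hi0
      rw [add_sub_right_comm, add_eq_right, sub_eq_zero] at ht
      exact ht
    · exact ht
  refine ⟨RingEquiv.refl k, fun l => h (Pi.single l 1) - h 0, fun t => ⟨1, one_ne_zero, ?_⟩⟩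
  rw [one_smul, Finset.sum_eq_add i j hij (by
    intro l _ hl
    rcases hall l with h3 | h3
    · exact absurd h3 hl.1
    · exact absurd h3 hl.2) (by simp) (by simp)]
  change h t = h 0 + (t i • (h (Pi.single i 1) - h 0) + t j • (h (Pi.single j 1) - h 0))
  rcases hcases t with rfl | rfl | rfl | rfl
  · simp
  · simp [hij.symm]
  · simp [hij]
  · simp only [Pi.add_apply, Pi.single_eq_same, Pi.single_eq_of_ne hij, Pi.single_eq_of_ne hij.symm,
      add_zero, zero_add, one_smul]
    rw [← hsum]
    abel

end Collineation
end Two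
end LooseGraph

/-! ### Semilinear extension of collineations -/

namespace LooseGraph

section Extension

variable {V E : Type*} {Γ : LooseGraph V E} {k : Type*} [Field k] {v : V}

/-- The star of `v` is maximal, and `v` is not isolated.  The closures of the affine spaces of these
vertices are the irreducible components of positive dimension, apart from those of the edges without
end vertices. -/
def IsMaximalStar (Γ : LooseGraph V E) (v : V) : Prop :=
  (Γ.looseStar v).Nontrivial ∧ ∀ u, Γ.looseStar v ⊆ Γ.looseStar u → Γ.looseStar u ⊆ Γ.looseStar v

theorem exists_isMaximalStar_of_nontrivial [Finite V] (hn : (Γ.looseStar v).Nontrivial) :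
    ∃ u, Γ.IsMaximalStar u ∧ Γ.looseStar v ⊆ Γ.looseStar u := by
  obtain ⟨u, hu, hmax⟩ := Set.Finite.exists_maximalFor (fun u => Γ.looseStar u)
    {u : V | Γ.looseStar v ⊆ Γ.looseStar u} (Set.toFinite _)
    ⟨v, Set.Subset.refl (Γ.looseStar v)⟩
  exact ⟨u, ⟨hn.mono hu, fun w hw => hmax (Set.Subset.trans hu hw) hw⟩, hu⟩

theorem IsDominated.exists_isMaximalStar [Finite V] {S : Set Γ.Completion}
    (h : Γ.IsDominated S) : ∃ v, Γ.IsMaximalStar v ∧ S ⊆ Γ.looseStar v := by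
  obtain ⟨u, -, hu, hn⟩ := h
  obtain ⟨v, hv, huv⟩ := exists_isMaximalStar_of_nontrivial hn
  exact ⟨v, hv, hu.trans huv⟩

/-- Different directions of the affine space of `v` belong to different edges on `v`. -/
theorem ncard_looseStar_le [Finite V] [Finite E] (v : V) :
    (Γ.looseStar v).ncard ≤ {e : E | v ∈ Γ.ends e}.ncard + 1 := by
  classical
  have h1 : (Γ.looseStar v \ {Sum.inl v}).ncard + 1 = (Γ.looseStar v).ncard :=
    Set.ncard_sdiff_singleton_add_one (Γ.inl_mem_looseStar_self v) (Set.toFinite _)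
  rw [← h1]
  apply Nat.add_le_add_right
  have hex : ∀ i : Γ.Completion, i ∈ Γ.looseStar v \ {Sum.inl v} →
      ∃ e, v ∈ Γ.ends e ∧ i ∈ Γ.completedEnds e := by
    rintro i ⟨hi | hi, hiv⟩
    · exact absurd hi hiv
    · exact hi
  rcases isEmpty_or_nonempty E with hE | hE
  · rw [Set.eq_empty_of_forall_notMem fun i hi => hE.elim (hex i hi).choose, Set.ncard_empty]
    exact Nat.zero_le _
  choose! e he hie using hex
  refine Set.ncard_le_ncard_of_injOn e (fun i hi => he i hi) ?_ (Set.toFinite _)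
  intro i hi i' hi' hee
  have h2 := he i hi
  have h3 := hie i hi
  have h4 := hie i' hi'
  rw [← hee] at h4
  generalize e i = d at h2 h3 h4
  have hcard : ∀ w, w ≠ v → w ∈ Γ.ends d → Γ.ends d = {v, w} := by
    intro w hw hwe
    symm
    apply Finset.eq_of_subset_of_card_le
    · intro x hx
      rcases Finset.mem_insert.1 hx with rfl | hx
      · exact h2
      · rwa [Finset.mem_singleton.1 hx]
    · rw [Finset.card_pair hw.symm]
      exact Γ.card_ends_le _
  have hpos : 0 < (Γ.ends d).card := Finset.card_pos.2 ⟨v, h2⟩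
  rcases h3 with ⟨w, hw, rfl⟩ | ⟨j, rfl⟩ <;> rcases h4 with ⟨w', hw', rfl⟩ | ⟨j', rfl⟩
  · have hwv : w ≠ v := fun h => hi.2 (by rw [h]; rfl)
    have hwv' : w' ≠ v := fun h => hi'.2 (by rw [h]; rfl)
    rw [hcard w hwv hw] at hw'
    simp [hwv'] at hw'
    rw [hw']
  · have hwv : w ≠ v := fun h => hi.2 (by rw [h]; rfl)
    have h5 : (Γ.ends d).card = 2 := by rw [hcard w hwv hw, Finset.card_pair hwv.symm]
    have := j'.2
    omega
  · have hwv' : w' ≠ v := fun h => hi'.2 (by rw [h]; rfl)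
    have h5 : (Γ.ends d).card = 2 := by rw [hcard w' hwv' hw', Finset.card_pair hwv'.symm]
    have := j.2
    omega
  · have : j = j' := by
      apply Fin.ext
      have := j.2
      have := j'.2
      omega
    rw [this]

/-- The directions of the affine space of `v` whose points at infinity are not in the scheme are those
of the edges whose only end vertex is `v`. -/
theorem neighbor_eq_of_subsingleton (hv : {e : E | Γ.ends e = {v}}.Subsingleton)
    (hn : (Γ.looseStar v).Nontrivial) (i j : Γ.Neighbor v)
    (hi : ¬ Γ.IsPt (Set.indicator {(i : Γ.Completion)} (1 : Γ.Completion → k)))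
    (hj : ¬ Γ.IsPt (Set.indicator {(j : Γ.Completion)} (1 : Γ.Completion → k))) : i = j := by
  have key : ∀ i : Γ.Neighbor v,
      ¬ Γ.IsPt (Set.indicator {(i : Γ.Completion)} (1 : Γ.Completion → k)) →
      ∃ (e : E) (a : Fin (2 - (Γ.ends e).card)), (i : Γ.Completion) = Sum.inr ⟨e, a⟩ ∧
        Γ.ends e = {v} := by
    rintro ⟨i, hi, hiv⟩ hp
    rcases i with w | ⟨e, a⟩
    · exact absurd (isPt_indicator hn hi) hp
    · refine ⟨e, a, rfl, ?_⟩
      obtain h | ⟨e', he', h⟩ := hi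
      · exact absurd h (by simp)
      · rw [Γ.inr_mem_completedEnds] at h
        subst h
        symm
        apply Finset.eq_of_subset_of_card_le (by simpa using he')
        have := a.2
        rw [Finset.card_singleton]
        omega
  obtain ⟨e, a, h1, h2⟩ := key i hi
  obtain ⟨e', a', h1', h2'⟩ := key j hj
  have := hv h2 h2'
  subst this
  have : a = a' := by
    apply Fin.ext
    have h3 := a.2
    have h4 := a'.2
    have hc : (Γ.ends e).card = 1 := by rw [h2, Finset.card_singleton]
    omega
  subst this
  exact Subtype.ext (h1.trans h1'.symm)

/-- A subspace which consists of the points dominated together with a given point is the coordinate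
subspace of a maximal star. -/
theorem exists_isMaximalStar [Finite V] [Finite E] {p : Γ.Completion → k}
    {P : Submodule k (Γ.Completion → k)}
    (hp : Γ.IsPt p)
    (hP : ∀ y, y ∈ P ↔ Γ.IsDominated (Function.support p ∪ Function.support y)) :
    ∃ u, Γ.IsMaximalStar u ∧ P = coordSubspace k (Γ.looseStar u) := by
  have h1 := eq_coordSubspace_of_isDominated_union (T := Set.univ) (P := P) (p := p)
    (Set.subset_univ _) (by simpa using hP)
  set S : Set Γ.Completion := {i | ∃ u : V, Sum.inl u ∈ Set.univ ∧
    Function.support p ⊆ Γ.looseStar u ∧ (Γ.looseStar u).Nontrivial ∧ i ∈ Γ.looseStar u ∧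
      i ∈ Set.univ} with hS
  have hpS : Function.support p ⊆ S := by
    rw [← mem_coordSubspace, ← h1, hP, Set.union_self]
    exact hp
  have h2 : Set.indicator S (1 : Γ.Completion → k) ∈ P := by
    rw [h1, indicator_one_mem_coordSubspace]
  rw [hP, support_indicator_one, Set.union_eq_self_of_subset_left hpS] at h2
  obtain ⟨u, -, hus, hun⟩ := h2
  have hle : ∀ w, (Γ.looseStar w).Nontrivial → Function.support p ⊆ Γ.looseStar w →
      Γ.looseStar w ⊆ S :=
    fun w hw hpw i hi => ⟨w, Set.mem_univ _, hpw, hw, hi, Set.mem_univ _⟩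
  have hSu : S = Γ.looseStar u := hus.antisymm (hle u hun (hpS.trans hus))
  refine ⟨u, ⟨hun, fun w hw => ?_⟩, by rw [h1, hSu]⟩
  rw [← hSu]
  exact hle w (hun.mono hw) ((hpS.trans hus).trans hw)

/-- A linear automorphism preceded by a field automorphism in all coordinates. -/
def semilinearAutOfLinearEquiv {C : Type*} (L : (C → k) ≃ₗ[k] (C → k)) (σ : k ≃+* k) :
    SemilinearAut k C where
  toFun x := L fun i => σ (x i)
  invFun y := fun i => σ.symm (L.symm y i)
  left_inv x := by simp
  right_inv y := by simp
  map_add' x y := by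
    rw [← L.map_add]
    congr 1
    ext i
    simp
  scalar := σ
  map_smul' c x := by
    rw [← L.map_smul]
    congr 1
    ext i
    simp

namespace Collineation

/-- The collineation is given, up to scalars, by a semilinear automorphism on the affine space of
`v`. -/
def Realizes (f : Γ.Collineation k) (v : V) (F : SemilinearAut k Γ.Completion) : Prop :=
  ∀ x ∈ coordSubspace k (Γ.looseStar v), x (Sum.inl v) ≠ 0 → ∃ r : k, r ≠ 0 ∧ f.toFun x = r • F x

theorem Realizes.notMem_span_of_apply {x a : Γ.Completion → k} (hx : x ≠ 0) (hxv : x (Sum.inl v) = 0)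
    (hav : a (Sum.inl v) ≠ 0) : x ∉ Submodule.span k {a} := by
  intro h
  obtain ⟨c, rfl⟩ := Submodule.mem_span_singleton.1 h
  rcases mul_eq_zero.1 (show c * a (Sum.inl v) = 0 from hxv) with h | h
  · exact hx (by rw [h, zero_smul])
  · exact hav h

/-- The lines through the image of a point with maximal support come from the corresponding
coordinate subspace. -/
theorem comapLn_le (f : Γ.Collineation k) (hm : Γ.IsMaximalStar v)
    {W : Submodule k (Γ.Completion → k)} (hW : Γ.IsLn W)
    (h : f.toFun (Set.indicator (Γ.looseStar v) 1) ∈ W) :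
    f.comapLn W ≤ coordSubspace k (Γ.looseStar v) := by
  have hp : Γ.IsPt (Set.indicator (Γ.looseStar v) (1 : Γ.Completion → k)) := by
    rw [IsPt, support_indicator_one]
    exact ⟨v, Γ.inl_mem_looseStar_self v, subset_rfl, hm.1⟩
  have hL := f.isLn_comapLn W hW
  rw [← f.mapLn_comapLn W hW, f.mem_mapLn _ _ hp hL] at h
  obtain ⟨u, hu, hus, hun⟩ := hL.2
  rw [← moduleSupport_subset_iff]
  apply hus.trans
  apply hm.2
  have := (support_subset_moduleSupport h).trans hus
  rwa [support_indicator_one] at this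

variable [Finite V] [Finite E] (f : Γ.Collineation k)

theorem exists_realizes_of_semilinear [Fintype (Γ.Neighbor v)] (hn : (Γ.looseStar v).Nontrivial)
    (h : ∃ (σ : k ≃+* k) (w : Γ.Neighbor v → Γ.Completion → k), ∀ t : Γ.Neighbor v → k,
      ∃ r : k, r ≠ 0 ∧ f.toFun (starVec t) =
        r • (f.toFun (starVec (0 : Γ.Neighbor v → k)) + ∑ i, σ (t i) • w i)) :
    ∃ F, f.Realizes v F := by
  obtain ⟨σ, w, h⟩ := h
  set h0 := f.toFun (starVec (0 : Γ.Neighbor v → k)) with hh0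
  set L : (Γ.Completion → k) →ₗ[k] (Γ.Completion → k) :=
    (LinearMap.proj (Sum.inl v)).smulRight h0 +
      ∑ i : Γ.Neighbor v, (LinearMap.proj (i : Γ.Completion)).smulRight (w i) with hL
  have hLapp : ∀ x, L x = x (Sum.inl v) • h0 + ∑ i : Γ.Neighbor v, x i • w i := by
    intro x
    simp [hL]
  have hker : ∀ x ∈ coordSubspace k (Γ.looseStar v), L x = 0 → x = 0 := by
    intro x hx hx0
    rw [hLapp] at hx0
    have hv : x (Sum.inl v) = 0 := by
      by_contra hv
      obtain ⟨r, hr, hr'⟩ := h fun i => σ.symm ((x (Sum.inl v))⁻¹ * x i)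
      apply (f.isPt_toFun _ (isPt_starVec hn _)).ne_zero (hr'.trans _)
      have : h0 + ∑ i : Γ.Neighbor v, σ (σ.symm ((x (Sum.inl v))⁻¹ * x i)) • w i =
          (x (Sum.inl v))⁻¹ • (x (Sum.inl v) • h0 + ∑ i : Γ.Neighbor v, x i • w i) := by
        rw [smul_add, smul_smul, inv_mul_cancel₀ hv, one_smul, Finset.smul_sum]
        simp [smul_smul]
      rw [this, hx0, smul_zero, smul_zero]
    rw [hv, zero_smul, zero_add] at hx0
    have hz : (fun i : Γ.Neighbor v => σ.symm (x i)) = 0 := by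
      by_contra hne
      obtain ⟨r, hr, hr'⟩ := h fun i => σ.symm (x i)
      apply f.toFun_starVec_notMem_span hn _ _ hne
      rw [hr']
      simp only [RingEquiv.apply_symm_apply, hx0, add_zero]
      exact Submodule.smul_mem _ _ (Submodule.mem_span_singleton_self _)
    refine ext_of_mem_coordSubspace hx (Submodule.zero_mem _) hv fun i => ?_
    have := congrFun hz i
    simpa using this
  set S := coordSubspace k (Γ.looseStar v)
  have hinj : Function.Injective (L.domRestrict S) := by
    rw [← LinearMap.ker_eq_bot, LinearMap.ker_eq_bot']
    rintro ⟨x, hx⟩ hx0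
    exact Subtype.ext (hker x hx hx0)
  obtain ⟨g, hg⟩ := Submodule.exists_linearEquiv_restrict_eq
    (LinearEquiv.ofInjective (L.domRestrict S) hinj)
  refine ⟨semilinearAutOfLinearEquiv g σ, fun x hx hv => ?_⟩
  have hσx : (fun i => σ (x i)) ∈ S := by
    intro i hi
    exact hx i (by simpa using hi)
  have hFx : semilinearAutOfLinearEquiv g σ x = L fun i => σ (x i) := (hg ⟨_, hσx⟩).symm
  obtain ⟨r, hr, hr'⟩ := h fun i => (x (Sum.inl v))⁻¹ * x i
  have hσv : σ (x (Sum.inl v)) ≠ 0 := by simpa using hv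
  refine ⟨r * (σ (x (Sum.inl v)))⁻¹, mul_ne_zero hr (inv_ne_zero hσv), ?_⟩
  rw [hFx, hLapp, eq_smul_starVec hx hv, f.toFun_smul _ _ (isPt_starVec hn _) hv, hr', mul_smul]
  congr 1
  simp only [Pi.smul_apply, starVec_apply_self, starVec_apply, smul_eq_mul, mul_one, smul_add,
    smul_smul, inv_mul_cancel₀ hσv, one_smul, Finset.smul_sum, mul_inv_cancel_left₀ hv]
  simp

/-- The collineation is semilinear on every affine space of dimension at least two.  Over the field
with two elements this needs the bound on the number of loose edges, except in dimension two, where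
every permutation of the four points of an affine plane is affine. -/
theorem exists_realizes (hn : (Γ.looseStar v).Nontrivial) (h3 : 3 ≤ (Γ.looseStar v).ncard)
    (hk : Nat.card k ≠ 2 ∨ (3 < (Γ.looseStar v).ncard → {e : E | Γ.ends e = {v}}.Subsingleton)) :
    ∃ F, f.Realizes v F := by
  classical
  have := Fintype.ofFinite (Γ.Neighbor v)
  have hcard : Fintype.card (Γ.Neighbor v) + 1 = (Γ.looseStar v).ncard := by
    rw [← Nat.card_eq_fintype_card, ← Set.ncard_sdiff_singleton_add_one
      (Γ.inl_mem_looseStar_self v) (Set.toFinite _)]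
    rfl
  have : Nontrivial (Γ.Neighbor v) := Fintype.one_lt_card_iff_nontrivial.1 (by omega)
  apply f.exists_realizes_of_semilinear hn
  by_cases hτ : ∃ τ : k, τ ≠ 0 ∧ τ ≠ -1
  · obtain ⟨τ, h1, h2⟩ := hτ
    exact f.exists_semilinear_of_ne hn h1 h2
  push Not at hτ
  have hk2 : ∀ c : k, c = 0 ∨ c = 1 := by
    intro c
    by_cases hc : c = 0
    · exact Or.inl hc
    · exact Or.inr ((hτ c hc).trans (hτ 1 one_ne_zero).symm)
  by_cases hl : ∀ i j : Γ.Neighbor v,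
      ¬ Γ.IsPt (Set.indicator {(i : Γ.Completion)} (1 : Γ.Completion → k)) →
      ¬ Γ.IsPt (Set.indicator {(j : Γ.Completion)} (1 : Γ.Completion → k)) → i = j
  · exact f.exists_semilinear_of_subsingleton hk2 hn hl
  have hcard3 : (Γ.looseStar v).ncard = 3 := by
    by_contra hne
    rcases hk with hk | hk
    · apply hk
      rw [Nat.card_eq_two_iff]
      exact ⟨0, 1, zero_ne_one, Set.eq_univ_of_forall fun c => by simpa using hk2 c⟩
    · exact hl fun i j => neighbor_eq_of_subsingleton (hk (by omega)) hn i j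
  push Not at hl
  obtain ⟨i, j, hi, hj, hij⟩ := hl
  have hall : ∀ l, l = i ∨ l = j := by
    intro l
    have h2 : (Finset.univ : Finset (Γ.Neighbor v)) = {i, j} := by
      symm
      apply Finset.eq_univ_of_card
      rw [Finset.card_pair hij]
      omega
    have := Finset.mem_univ l
    rw [h2] at this
    simpa using this
  apply f.exists_semilinear_of_two_loose hk2 hn _ hij hall
  intro w hw
  by_contra hwv
  have hp : Γ.IsPt (Set.indicator {Sum.inl w} (1 : Γ.Completion → k)) := isPt_indicator hn hw
  rcases hall ⟨Sum.inl w, hw, fun h => hwv (Sum.inl_injective h)⟩ with h | h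
  · rw [← h] at hi
    exact hi hp
  · rw [← h] at hj
    exact hj hp

variable {f} {F : SemilinearAut k Γ.Completion}

namespace Realizes

/-- On a line of the projective closure of the affine space of `v` that meets the affine space, the
collineation is given by the semilinear automorphism. -/
theorem mapLn_span (hF : f.Realizes v F) (hn : (Γ.looseStar v).Nontrivial)
    {a y : Γ.Completion → k} (ha : a ∈ coordSubspace k (Γ.looseStar v)) (hav : a (Sum.inl v) ≠ 0)
    (hy : y ∈ coordSubspace k (Γ.looseStar v)) (hay : y ∉ Submodule.span k {a}) :
    f.mapLn (Submodule.span k {a, y}) = F.map (Submodule.span k {a, y}) := by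
  have hW := isLn_span_of_apply_ne_zero hn ha hav hy hay
  have key : ∀ z ∈ Submodule.span k {a, y}, z ∈ coordSubspace k (Γ.looseStar v) →
      z (Sum.inl v) ≠ 0 → F z ∈ f.mapLn (Submodule.span k {a, y}) := by
    intro z hz hzs hzv
    obtain ⟨r, hr, h1⟩ := hF z hzs hzv
    have h2 := f.toFun_mem_mapLn (isPt_of_apply_ne_zero hn hzs hzv) hW hz
    rw [h1] at h2
    exact (Submodule.smul_mem_iff _ hr).1 h2
  have hma : a ∈ Submodule.span k {a, y} := Submodule.subset_span (by simp)
  have hmy : y ∈ Submodule.span k {a, y} := Submodule.subset_span (by simp)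
  have hFa := key a hma ha hav
  have hFy : F y ∈ f.mapLn (Submodule.span k {a, y}) := by
    by_cases hyv : y (Sum.inl v) = 0
    · have := key (a + y) (Submodule.add_mem _ hma hmy) (Submodule.add_mem _ ha hy)
        (by simpa [hyv] using hav)
      rw [F.map_add] at this
      exact (Submodule.add_mem_iff_right _ hFa).1 this
    · exact key y hmy hy hyv
  rw [F.map_span_pair]
  apply (f.isLn_mapLn _ hW).eq_span hFa hFy
  · rw [Ne, F.map_eq_zero]
    rintro rfl
    simp at hav
  · intro h
    obtain ⟨c, hc⟩ := Submodule.mem_span_singleton.1 h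
    refine hay (Submodule.mem_span_singleton.2 ⟨F.scalar.symm c, F.injective ?_⟩)
    rw [F.map_smul, RingEquiv.apply_symm_apply, hc]

/-- A point at infinity of the affine space of `v` is the intersection of two lines. -/
theorem exists_span_inf (h3 : 3 ≤ (Γ.looseStar v).ncard) {x : Γ.Completion → k}
    (hxv : x (Sum.inl v) = 0) :
    ∃ a ∈ coordSubspace k (Γ.looseStar v), ∃ b ∈ coordSubspace k (Γ.looseStar v),
      a (Sum.inl v) ≠ 0 ∧ b (Sum.inl v) ≠ 0 ∧
      ∀ z ∈ Submodule.span k {a, x}, z ∈ Submodule.span k {b, x} → ∃ c : k, z = c • x := by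
  have hex : ∃ i : Γ.Neighbor v,
      Set.indicator {(i : Γ.Completion)} (1 : Γ.Completion → k) ∉ Submodule.span k {x} := by
    by_contra! hc
    obtain ⟨i, hi, j, hj, hij⟩ : (Γ.looseStar v \ {Sum.inl v}).Nontrivial := by
      rw [← Set.one_lt_ncard_iff_nontrivial]
      have := Set.ncard_sdiff_singleton_add_one (Γ.inl_mem_looseStar_self v) (Set.toFinite _)
      omega
    obtain ⟨a, ha⟩ := Submodule.mem_span_singleton.1 (hc ⟨i, hi.1, hi.2⟩)
    obtain ⟨b, hb⟩ := Submodule.mem_span_singleton.1 (hc ⟨j, hj.1, hj.2⟩)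
    have h1 := congrFun ha i
    have h2 := congrFun ha j
    have h4 := congrFun hb j
    simp at h1 h4
    simp [hij.symm] at h2
    rcases h2 with h2 | h2
    · simp [h2] at h1
    · simp [h2] at h4
  obtain ⟨i, hi⟩ := hex
  have hv : (Sum.inl v : Γ.Completion) ≠ i := i.2.2.symm
  refine ⟨starVec (0 : Γ.Neighbor v → k), starVec_mem _,
    starVec (0 : Γ.Neighbor v → k) + Set.indicator {(i : Γ.Completion)} 1,
    Submodule.add_mem _ (starVec_mem _) (indicator_neighbor_mem i), by simp, by simp [hv], ?_⟩
  intro z hz1 hz2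
  obtain ⟨a, b, hab⟩ := Submodule.mem_span_pair.1 hz1
  obtain ⟨c, d, hcd⟩ := Submodule.mem_span_pair.1 hz2
  have hac : a = c := by
    have := congrFun (hab.trans hcd.symm) (Sum.inl v)
    simpa [hxv, hv] using this
  subst hac
  by_cases ha : a = 0
  · exact ⟨b, by rw [← hab, ha, zero_smul, zero_add]⟩
  · exfalso
    refine hi (Submodule.mem_span_singleton.2 ⟨a⁻¹ * (b - d), ?_⟩)
    have h1 : (b - d) • x = a • Set.indicator {(i : Γ.Completion)} (1 : Γ.Completion → k) := by
      have := hab.trans hcd.symm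
      rw [smul_add, add_assoc] at this
      rw [sub_smul, add_left_cancel this, add_sub_cancel_right]
    rw [mul_smul, h1, smul_smul, inv_mul_cancel₀ ha, one_smul]

theorem toFun_eq (hF : f.Realizes v F) (hn : (Γ.looseStar v).Nontrivial)
    (h3 : 3 ≤ (Γ.looseStar v).ncard) {x : Γ.Completion → k}
    (hx : x ∈ coordSubspace k (Γ.looseStar v)) (hxp : Γ.IsPt x) :
    ∃ r : k, r ≠ 0 ∧ f.toFun x = r • F x := by
  by_cases hxv : x (Sum.inl v) = 0
  swap
  · exact hF x hx hxv
  obtain ⟨a, ha, b, hb, hav, hbv, hab⟩ := exists_span_inf h3 hxv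
  have key : ∀ a ∈ coordSubspace k (Γ.looseStar v), a (Sum.inl v) ≠ 0 →
      F.symm (f.toFun x) ∈ Submodule.span k {a, x} := by
    intro a ha hav
    have hax := notMem_span_of_apply hxp.ne_zero hxv hav
    rw [← F.mem_map, ← hF.mapLn_span hn ha hav hx hax]
    exact f.toFun_mem_mapLn hxp (isLn_span_of_apply_ne_zero hn ha hav hx hax)
      (Submodule.subset_span (by simp))
  obtain ⟨c, hc⟩ := hab _ (key a ha hav) (key b hb hbv)
  have h1 : f.toFun x = F.scalar c • F x := by
    rw [← F.map_smul, ← hc, F.apply_symm_apply]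
  refine ⟨_, ?_, h1⟩
  intro h0
  rw [h0, zero_smul] at h1
  exact (f.isPt_toFun x hxp).ne_zero h1

theorem invFun_eq (hF : f.Realizes v F) (hn : (Γ.looseStar v).Nontrivial)
    (h3 : 3 ≤ (Γ.looseStar v).ncard) {x : Γ.Completion → k}
    (hx : x ∈ coordSubspace k (Γ.looseStar v)) (hxp : Γ.IsPt (F x)) :
    ∃ r : k, r ≠ 0 ∧ f.invFun (F x) = r • x := by
  by_cases hxv : x (Sum.inl v) = 0
  swap
  · obtain ⟨r, hr, h1⟩ := hF x hx hxv
    obtain ⟨c, hc, h2⟩ := f.inv_toFun x (isPt_of_apply_ne_zero hn hx hxv)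
    rw [h1, f.invFun_smul _ _ hxp hr] at h2
    exact ⟨c, hc, h2⟩
  have hx0 : x ≠ 0 := fun h => hxp.ne_zero (by rw [h, F.map_zero])
  obtain ⟨a, ha, b, hb, hav, hbv, hab⟩ := exists_span_inf h3 hxv
  have key : ∀ a ∈ coordSubspace k (Γ.looseStar v), a (Sum.inl v) ≠ 0 →
      f.invFun (F x) ∈ Submodule.span k {a, x} := by
    intro a ha hav
    have hax := notMem_span_of_apply hx0 hxv hav
    rw [f.invFun_mem_iff hxp (isLn_span_of_apply_ne_zero hn ha hav hx hax),
      hF.mapLn_span hn ha hav hx hax, F.apply_mem_map]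
    exact Submodule.subset_span (by simp)
  obtain ⟨c, hc⟩ := hab _ (key a ha hav) (key b hb hbv)
  refine ⟨c, ?_, hc⟩
  rintro rfl
  exact (f.isPt_invFun _ hxp).ne_zero (by rw [hc, zero_smul])

theorem isPt_iff (hF : f.Realizes v F) (hn : (Γ.looseStar v).Nontrivial)
    (h3 : 3 ≤ (Γ.looseStar v).ncard) {x : Γ.Completion → k}
    (hx : x ∈ coordSubspace k (Γ.looseStar v)) : Γ.IsPt (F x) ↔ Γ.IsPt x := by
  constructor
  · intro h
    obtain ⟨r, hr, h1⟩ := hF.invFun_eq hn h3 hx h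
    have := (f.isPt_invFun _ h).smul (inv_ne_zero hr)
    rwa [h1, smul_smul, inv_mul_cancel₀ hr, one_smul] at this
  · intro h
    obtain ⟨r, hr, h1⟩ := hF.toFun_eq hn h3 hx h
    have := (f.isPt_toFun _ h).smul (inv_ne_zero hr)
    rwa [h1, smul_smul, inv_mul_cancel₀ hr, one_smul] at this

theorem span_smul_pair {M : Type*} [AddCommGroup M] [Module k M] {a b : k} (ha : a ≠ 0)
    (hb : b ≠ 0) (x y : M) :
    Submodule.span k {a • x, b • y} = Submodule.span k {x, y} := by
  rw [Submodule.span_insert, Submodule.span_insert, Submodule.span_singleton_smul_eq (IsUnit.mk0 a ha),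
    Submodule.span_singleton_smul_eq (IsUnit.mk0 b hb)]

theorem mapLn_eq (hF : f.Realizes v F) (hn : (Γ.looseStar v).Nontrivial)
    (h3 : 3 ≤ (Γ.looseStar v).ncard) {W : Submodule k (Γ.Completion → k)}
    (hW : W ≤ coordSubspace k (Γ.looseStar v)) (hL : Γ.IsLn W) : f.mapLn W = F.map W := by
  obtain ⟨x, y, hx, hy, hxy, rfl⟩ := hL.exists_pair
  obtain ⟨r, hr, h1⟩ := hF.toFun_eq hn h3 (hW (Submodule.subset_span (by simp))) hx
  obtain ⟨s, hs, h2⟩ := hF.toFun_eq hn h3 (hW (Submodule.subset_span (by simp))) hy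
  rw [f.mapLn_span hx hy hxy hL, F.map_span_pair, h1, h2, span_smul_pair hr hs]

theorem isLn_of_isLn_map (hF : f.Realizes v F) (hn : (Γ.looseStar v).Nontrivial)
    (h3 : 3 ≤ (Γ.looseStar v).ncard) {W : Submodule k (Γ.Completion → k)}
    (hW : W ≤ coordSubspace k (Γ.looseStar v)) (hL : Γ.IsLn (F.map W)) : Γ.IsLn W := by
  obtain ⟨x, y, hx, hy, hxy, he⟩ := hL.exists_pair
  have hxm : F.symm x ∈ W := by
    rw [← F.mem_map, he]
    exact Submodule.subset_span (by simp)
  have hym : F.symm y ∈ W := by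
    rw [← F.mem_map, he]
    exact Submodule.subset_span (by simp)
  obtain ⟨r, hr, h1⟩ := hF.invFun_eq hn h3 (hW hxm) (by rwa [F.apply_symm_apply])
  obtain ⟨s, hs, h2⟩ := hF.invFun_eq hn h3 (hW hym) (by rwa [F.apply_symm_apply])
  rw [F.apply_symm_apply] at h1 h2
  have hL' := hL
  rw [he] at hL'
  have h5 : f.comapLn (Submodule.span k {x, y}) = Submodule.span k {f.invFun x, f.invFun y} :=
    f.symm.mapLn_span hx hy hxy hL'
  have h6 := f.isLn_comapLn _ hL'
  rw [h5, h1, h2, span_smul_pair hr hs] at h6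
  have h7 : W = Submodule.span k {F.symm x, F.symm y} := by
    rw [← F.symm.map_span_pair, ← he, F.symm_map_map]
  rwa [h7]

theorem isDominated_union_iff (hF : f.Realizes v F) (hn : (Γ.looseStar v).Nontrivial)
    (h3 : 3 ≤ (Γ.looseStar v).ncard) {x y : Γ.Completion → k}
    (hx : x ∈ coordSubspace k (Γ.looseStar v)) (hy : y ∈ coordSubspace k (Γ.looseStar v)) :
    Γ.IsDominated (Function.support x ∪ Function.support y) ↔
      Γ.IsDominated (Function.support (F x) ∪ Function.support (F y)) := by
  by_cases hx0 : x = 0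
  · subst hx0
    rw [F.map_zero, Function.support_zero, Set.empty_union, Set.empty_union]
    exact (hF.isPt_iff hn h3 hy).symm
  have hsub : ∀ (c : k) (x : Γ.Completion → k),
      Function.support (c • x) ⊆ Function.support x := fun c x =>
    Function.support_const_smul_subset c x
  by_cases hxy : y ∈ Submodule.span k {x}
  · obtain ⟨c, rfl⟩ := Submodule.mem_span_singleton.1 hxy
    rw [F.map_smul, Set.union_eq_self_of_subset_right (hsub _ _),
      Set.union_eq_self_of_subset_right (hsub _ _)]
    exact (hF.isPt_iff hn h3 hx).symm
  · have hFx0 : F x ≠ 0 := by rwa [Ne, F.map_eq_zero]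
    have hFxy : F y ∉ Submodule.span k {F x} := by
      intro h
      obtain ⟨c, hc⟩ := Submodule.mem_span_singleton.1 h
      refine hxy (Submodule.mem_span_singleton.2 ⟨F.scalar.symm c, F.injective ?_⟩)
      rw [F.map_smul, RingEquiv.apply_symm_apply, hc]
    have hW : Submodule.span k {x, y} ≤ coordSubspace k (Γ.looseStar v) := by
      rw [Submodule.span_le]
      rintro z (rfl | rfl) <;> assumption
    constructor
    · intro h
      have hL := isLn_span hx0 hxy h
      have h1 := f.isLn_mapLn _ hL
      rw [hF.mapLn_eq hn h3 hW hL, F.map_span_pair] at h1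
      rw [← moduleSupport_span_pair]
      exact h1.2
    · intro h
      have hL := isLn_span hFx0 hFxy h
      rw [← F.map_span_pair] at hL
      rw [← moduleSupport_span_pair]
      exact (hF.isLn_of_isLn_map hn h3 hW hL).2

end Realizes

/-- The semilinear automorphism maps a component to a component: the coordinate space of a maximal
star consists of the vectors that are dominated together with one of full support. -/
theorem Realizes.exists_map_eq (hF : f.Realizes v F) (hm : Γ.IsMaximalStar v)
    (h3 : 3 ≤ (Γ.looseStar v).ncard) : ∃ u, Γ.IsMaximalStar u ∧
      F.map (coordSubspace k (Γ.looseStar v)) = coordSubspace k (Γ.looseStar u) := by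
  have hps : Set.indicator (Γ.looseStar v) (1 : Γ.Completion → k) ∈
      coordSubspace k (Γ.looseStar v) := indicator_one_mem_coordSubspace.2 subset_rfl
  have hpv : Set.indicator (Γ.looseStar v) (1 : Γ.Completion → k) (Sum.inl v) ≠ 0 := by
    simp [Γ.inl_mem_looseStar_self v]
  have hp := isPt_of_apply_ne_zero hm.1 hps hpv
  have hFp := (hF.isPt_iff hm.1 h3 hps).2 hp
  apply exists_isMaximalStar hFp
  intro y
  constructor
  · intro hy
    have := (hF.isDominated_union_iff hm.1 h3 hps hy).1
      ⟨v, Or.inl hpv, Set.union_subset hps hy, hm.1⟩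
    rwa [F.apply_symm_apply] at this
  · intro hd
    by_cases hy : y ∈ Submodule.span k {F (Set.indicator (Γ.looseStar v) 1)}
    · exact (Submodule.span_singleton_le_iff_mem _ _).2 (by simpa using hps) hy
    have hL := isLn_span hFp.ne_zero hy hd
    obtain ⟨r, hr, h1⟩ := hF _ hps hpv
    have hle := f.comapLn_le hm hL (by
      rw [h1]
      exact Submodule.smul_mem _ _ (Submodule.subset_span (by simp)))
    have h2 := hF.mapLn_eq hm.1 h3 hle (f.isLn_comapLn _ hL)
    rw [f.mapLn_comapLn _ hL] at h2
    apply F.map_mono hle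
    rw [← h2]
    exact Submodule.subset_span (by simp)

theorem Realizes.isDominated_map (hF : f.Realizes v F) (hm : Γ.IsMaximalStar v)
    (h3 : 3 ≤ (Γ.looseStar v).ncard) {U : Submodule k (Γ.Completion → k)}
    (hU : U ≤ coordSubspace k (Γ.looseStar v)) (hd : Γ.IsDominated (moduleSupport U)) :
    Γ.IsDominated (moduleSupport (F.map U)) := by
  obtain ⟨u, -, hu⟩ := hF.exists_map_eq hm h3
  exact isDominated_moduleSupport_map F _ _ _ rfl hu
    (fun x y hx hy => hF.isDominated_union_iff hm.1 h3 hx hy) U hU hd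

theorem _root_.LooseGraph.isLn_coordSubspace (hn : (Γ.looseStar v).Nontrivial)
    (h2 : (Γ.looseStar v).ncard = 2) : Γ.IsLn (coordSubspace k (Γ.looseStar v)) :=
  ⟨by rw [finrank_coordSubspace, h2], by
    rw [moduleSupport_coordSubspace]
    exact ⟨v, Γ.inl_mem_looseStar_self v, subset_rfl, hn⟩⟩

theorem exists_mapLn_coordSubspace (f : Γ.Collineation k) (hm : Γ.IsMaximalStar v)
    (h2 : (Γ.looseStar v).ncard = 2) : ∃ u, Γ.IsMaximalStar u ∧
      f.mapLn (coordSubspace k (Γ.looseStar v)) = coordSubspace k (Γ.looseStar u) := by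
  have hL := isLn_coordSubspace (k := k) hm.1 h2
  have hps : Set.indicator (Γ.looseStar v) (1 : Γ.Completion → k) ∈
      coordSubspace k (Γ.looseStar v) := indicator_one_mem_coordSubspace.2 subset_rfl
  have hpv : Set.indicator (Γ.looseStar v) (1 : Γ.Completion → k) (Sum.inl v) ≠ 0 := by
    simp [Γ.inl_mem_looseStar_self v]
  have hp := isPt_of_apply_ne_zero hm.1 hps hpv
  have hfp := f.isPt_toFun _ hp
  have hfm := f.toFun_mem_mapLn hp hL hps
  apply exists_isMaximalStar hfp
  intro y
  by_cases hy : y ∈ Submodule.span k {f.toFun (Set.indicator (Γ.looseStar v) 1)}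
  · refine iff_of_true ((Submodule.span_singleton_le_iff_mem _ _).2 hfm hy) ?_
    obtain ⟨c, rfl⟩ := Submodule.mem_span_singleton.1 hy
    rw [Set.union_eq_self_of_subset_right (Function.support_const_smul_subset _ _)]
    exact hfp
  · constructor
    · intro h
      have h3 := (f.isLn_mapLn _ hL).2
      rw [(f.isLn_mapLn _ hL).eq_span hfm h hfp.ne_zero hy, moduleSupport_span_pair] at h3
      exact h3
    · intro h
      have hL' := isLn_span hfp.ne_zero hy h
      have hle := f.comapLn_le hm hL' (Submodule.subset_span (by simp))
      have he := Submodule.eq_of_le_of_finrank_eq hle (by rw [hL.1, (f.isLn_comapLn _ hL').1])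
      rw [← he, f.mapLn_comapLn _ hL']
      exact Submodule.subset_span (by simp)

end Collineation
end Extension
end LooseGraph

/-! ### Points of projective space and their linear spans -/

section LinearForms

variable {k : Type*} [Field k] {ι : Type*} [Fintype ι]

/-- The linear form with given coefficients. -/
noncomputable def linForm (a : ι → k) : MvPolynomial ι k := ∑ i, C (a i) * X i

theorem linForm_add (a b : ι → k) : linForm (a + b) = linForm a + linForm b := by
  simp [linForm, add_mul, Finset.sum_add_distrib]

theorem linForm_smul (c : k) (a : ι → k) : linForm (c • a) = C c * linForm a := by
  simp [linForm, Finset.mul_sum, mul_assoc]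

theorem linForm_sub (a b : ι → k) : linForm (a - b) = linForm a - linForm b := by
  simp [linForm, sub_mul, Finset.sum_sub_distrib]

@[simp] theorem linForm_single [DecidableEq ι] (i : ι) :
    linForm (Pi.single i (1 : k)) = X i := by
  rw [linForm, Finset.sum_eq_single i]
  · simp
  · intro j _ hj
    simp [hj]
  · simp

theorem isHomogeneous_linForm (a : ι → k) : (linForm a).IsHomogeneous 1 :=
  IsHomogeneous.sum _ _ _ fun i _ => (isHomogeneous_X k i).C_mul _

theorem Submodule.exists_dotProduct_ne_zero {W : Submodule k (ι → k)} {x : ι → k} (hx : x ∉ W) :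
    ∃ a : ι → k, (∀ w ∈ W, ∑ i, a i * w i = 0) ∧ ∑ i, a i * x i ≠ 0 := by
  classical
  obtain ⟨f, hf, hW⟩ := W.exists_le_ker_of_notMem hx
  have h : ∀ w : ι → k, ∑ i, f (Pi.single i 1) * w i = f w := by
    intro w
    conv_rhs => rw [← Finset.univ_sum_single w, _root_.map_sum]
    refine Finset.sum_congr rfl fun i _ => ?_
    rw [mul_comm, ← smul_eq_mul, ← f.map_smul]
    congr 1
    ext j
    by_cases hj : j = i
    · subst hj
      simp
    · simp [hj]
  exact ⟨fun i => f (Pi.single i 1), fun w hw => (h w).trans (hW hw), by rwa [h]⟩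

theorem MvPolynomial.IsHomogeneous.eval₂_mul_left {R S σ : Type*} [CommSemiring R] [CommSemiring S]
    {f : MvPolynomial σ R} {n : ℕ} (hf : f.IsHomogeneous n) (φ : R →+* S) (r : S) (y : σ → S) :
    MvPolynomial.eval₂ φ (fun i => r * y i) f = r ^ n * MvPolynomial.eval₂ φ y f := by
  rw [MvPolynomial.eval₂_eq, MvPolynomial.eval₂_eq, Finset.mul_sum]
  refine Finset.sum_congr rfl fun d hd => ?_
  have h : ∑ i ∈ d.support, d i = n := (hf.degree_eq_sum_deg_support hd).symm
  simp only [mul_pow, Finset.prod_mul_distrib, Finset.prod_pow_eq_pow_sum, h]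
  ring

end LinearForms

namespace ProjectiveSpectrum

variable {k : Type*} [Field k] {ι : Type*} 

theorem ext_of_homogeneous {p q : ProjectiveSpectrum (homogeneousSubmodule ι k)}
    (h : ∀ (n : ℕ) (f : MvPolynomial ι k), f.IsHomogeneous n →
      (f ∈ p.asHomogeneousIdeal ↔ f ∈ q.asHomogeneousIdeal)) : p = q :=
  ProjectiveSpectrum.ext (HomogeneousIdeal.ext' fun n f hf => h n f hf)

theorem le_of_homogeneous {p q : ProjectiveSpectrum (homogeneousSubmodule ι k)}
    (h : ∀ (n : ℕ) (f : MvPolynomial ι k), f.IsHomogeneous n →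
      f ∈ p.asHomogeneousIdeal → f ∈ q.asHomogeneousIdeal) : p ≤ q := by
  intro f hf
  rw [← sum_homogeneousComponent f]
  refine Ideal.sum_mem _ fun n _ => h n _ (homogeneousComponent_isHomogeneous n f) ?_
  have := p.asHomogeneousIdeal.isHomogeneous n hf
  rwa [← decomposition.decompose'_apply]

theorem irrelevant_le_of_X_mem {I : HomogeneousIdeal (homogeneousSubmodule ι k)}
    (h : ∀ i, (X i : MvPolynomial ι k) ∈ I) :
    HomogeneousIdeal.irrelevant (homogeneousSubmodule ι k) ≤ I := by
  rw [HomogeneousIdeal.irrelevant_le]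
  intro n hn f hf
  have hsp : f ∈ Ideal.span (MvPolynomial.X '' Set.univ : Set (MvPolynomial ι k)) := by
    rw [mem_ideal_span_X_image]
    intro m hm
    have := IsHomogeneous.degree_eq_sum_deg_support hf hm
    by_contra! hc
    rw [(Finsupp.ext fun i => hc i trivial : m = 0)] at this
    simp at this
    omega
  have hle : Ideal.span (MvPolynomial.X '' Set.univ : Set (MvPolynomial ι k)) ≤ I.toIdeal := by
    rw [Ideal.span_le]
    rintro _ ⟨i, -, rfl⟩
    exact h i
  exact hle hsp

theorem exists_X_notMem (p : ProjectiveSpectrum (homogeneousSubmodule ι k)) :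
    ∃ i, (X i : MvPolynomial ι k) ∉ p.asHomogeneousIdeal := by
  by_contra! h
  exact p.not_irrelevant_le (irrelevant_le_of_X_mem h)

variable (k) in
/-- The scheme point of projective space under a point with coordinates in an extension field. -/
noncomputable def ofCoords {K : Type*} [Field K] [Algebra k K] (x : ι → K) (hx : x ≠ 0) :
    ProjectiveSpectrum (homogeneousSubmodule ι k) where
  asHomogeneousIdeal := (RingHom.ker (aeval x : MvPolynomial ι k →ₐ[k] K)).homogeneousCore _
  isPrime := (RingHom.ker_isPrime _).homogeneousCore
  not_irrelevant_le h := by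
    obtain ⟨i, hi⟩ := Function.ne_iff.1 hx
    have h1 := h (HomogeneousIdeal.mem_irrelevant_of_mem _ one_pos (isHomogeneous_X k i))
    have h2 := Ideal.toIdeal_homogeneousCore_le _ _ h1
    rw [RingHom.mem_ker] at h2
    simp only [aeval_X] at h2
    exact hi h2

section

variable {K : Type*} [Field K] [Algebra k K] {x : ι → K} {hx : x ≠ 0}

theorem mem_ofCoords {f : MvPolynomial ι k} {n : ℕ} (hf : f.IsHomogeneous n) :
    f ∈ (ofCoords k x hx).asHomogeneousIdeal ↔ aeval x f = 0 := by
  constructor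
  · intro h
    exact Ideal.toIdeal_homogeneousCore_le _ _ h
  · intro h
    exact Ideal.mem_homogeneousCore_of_homogeneous_of_mem ⟨n, hf⟩ h

theorem X_mem_ofCoords {i : ι} :
    (X i : MvPolynomial ι k) ∈ (ofCoords k x hx).asHomogeneousIdeal ↔ x i = 0 := by
  rw [mem_ofCoords (isHomogeneous_X k i), aeval_X]

end

variable [Fintype ι]

/-- The smallest linear subspace of projective space through a point: the common zeros in `k^ι` of
the linear forms that vanish at the point. -/
def linSpan (p : ProjectiveSpectrum (homogeneousSubmodule ι k)) : Submodule k (ι → k) where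
  carrier := {w | ∀ a : ι → k, linForm a ∈ p.asHomogeneousIdeal → ∑ i, a i * w i = 0}
  add_mem' := by
    intro x y hx hy a ha
    simp [mul_add, Finset.sum_add_distrib, hx a ha, hy a ha]
  zero_mem' := by
    intro a _
    simp
  smul_mem' := by
    intro c x hx a ha
    have : ∑ i, a i * (c • x) i = c * ∑ i, a i * x i := by
      rw [Finset.mul_sum]
      exact Finset.sum_congr rfl fun i _ => by simp; ring
    rw [this, hx a ha, mul_zero]

variable {p q : ProjectiveSpectrum (homogeneousSubmodule ι k)}

theorem linForm_mem_iff {a : ι → k} :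
    linForm a ∈ p.asHomogeneousIdeal ↔ ∀ w ∈ p.linSpan, ∑ i, a i * w i = 0 := by
  refine ⟨fun h w hw => hw a h, fun h => ?_⟩
  by_contra ha
  let N : Submodule k (ι → k) :=
    { carrier := {a | linForm a ∈ p.asHomogeneousIdeal}
      add_mem' := by
        intro a b ha hb
        simp only [Set.mem_ofPred_eq, linForm_add] at *
        exact Ideal.add_mem _ ha hb
      zero_mem' := by
        have : linForm (0 : ι → k) = 0 := by simp [linForm]
        simp only [Set.mem_ofPred_eq, this]
        exact Ideal.zero_mem _
      smul_mem' := by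
        intro c a ha
        simp only [Set.mem_ofPred_eq, linForm_smul] at *
        exact Ideal.mul_mem_left _ _ ha }
  obtain ⟨w, hw, hne⟩ := N.exists_dotProduct_ne_zero (show a ∉ N from ha)
  refine hne ?_
  rw [← h w fun b hb => ?_]
  · exact Finset.sum_congr rfl fun i _ => mul_comm _ _
  · rw [← hw b hb]
    exact Finset.sum_congr rfl fun i _ => mul_comm _ _

theorem X_mem_iff {i : ι} :
    (X i : MvPolynomial ι k) ∈ p.asHomogeneousIdeal ↔ ∀ w ∈ p.linSpan, w i = 0 := by
  classical
  rw [← linForm_single, linForm_mem_iff]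
  have : ∀ w : ι → k, ∑ j, (Pi.single i (1 : k) : ι → k) j * w j = w i := by
    intro w
    rw [Finset.sum_eq_single i] <;> simp +contextual
  simp_rw [this]

theorem setOf_X_notMem : {i | (X i : MvPolynomial ι k) ∉ p.asHomogeneousIdeal} =
    moduleSupport p.linSpan := by
  ext i
  simp [X_mem_iff, moduleSupport]

theorem linSpan_ne_bot : p.linSpan ≠ ⊥ := by
  intro h
  obtain ⟨i, hi⟩ := p.exists_X_notMem
  refine hi (X_mem_iff.2 fun w hw => ?_)
  rw [h, Submodule.mem_bot] at hw
  rw [hw, Pi.zero_apply]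

theorem linSpan_le_iff {W : Submodule k (ι → k)} : p.linSpan ≤ W ↔
    ∀ a : ι → k, (∀ w ∈ W, ∑ i, a i * w i = 0) → linForm a ∈ p.asHomogeneousIdeal := by
  refine ⟨fun h a ha => linForm_mem_iff.2 fun w hw => ha w (h hw), fun h w hw => ?_⟩
  by_contra hwW
  obtain ⟨a, ha, hne⟩ := W.exists_dotProduct_ne_zero hwW
  exact hne (hw a (h a ha))

theorem linSpan_anti (h : p ≤ q) : q.linSpan ≤ p.linSpan :=
  fun _ hw a ha => hw a (h ha)

theorem linForm_mem_ofCoords {K : Type*} [Field K] [Algebra k K] {x : ι → K} {hx : x ≠ 0}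
    {a : ι → k} : linForm a ∈ (ofCoords k x hx).asHomogeneousIdeal ↔
      ∑ i, algebraMap k K (a i) * x i = 0 := by
  rw [mem_ofCoords (isHomogeneous_linForm a), linForm]
  simp

theorem linSpan_ofCoords {x : ι → k} {hx : x ≠ 0} :
    (ofCoords k x hx).linSpan = Submodule.span k {x} := by
  apply le_antisymm
  · rw [linSpan_le_iff]
    intro a ha
    rw [linForm_mem_ofCoords]
    exact ha x (Submodule.mem_span_singleton_self x)
  · rw [Submodule.span_singleton_le_iff_mem]
    intro a ha
    exact linForm_mem_ofCoords.1 ha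

/-- A point whose linear span consists of the multiples of one vector is the rational point with these
coordinates: modulo the ideal of the point, all variables are multiples of one of them. -/
theorem eq_ofCoords {x : ι → k} (hx : x ≠ 0) (h : p.linSpan ≤ Submodule.span k {x}) :
    p = ofCoords k x hx := by
  classical
  obtain ⟨i, hi⟩ := Function.ne_iff.1 hx
  rw [Pi.zero_apply] at hi
  have hXi : (X i : MvPolynomial ι k) ∉ p.asHomogeneousIdeal := by
    intro hX
    apply p.linSpan_ne_bot
    rw [eq_bot_iff]
    intro w hw
    obtain ⟨c, rfl⟩ := Submodule.mem_span_singleton.1 (h hw)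
    have h1 : c * x i = 0 := X_mem_iff.1 hX _ hw
    rw [(mul_eq_zero.1 h1).resolve_right hi, zero_smul]
    exact Submodule.zero_mem _
  let mk := Ideal.Quotient.mk p.asHomogeneousIdeal.toIdeal
  have hX : ∀ j, mk (X j) = mk (C (x i)⁻¹ * X i) * mk (C (x j)) := by
    intro j
    have h2 : linForm (Pi.single j (1 : k) - ((x i)⁻¹ * x j) • Pi.single i (1 : k)) ∈
        p.asHomogeneousIdeal := by
      rw [linSpan_le_iff] at h
      apply h
      intro w hw
      obtain ⟨c, rfl⟩ := Submodule.mem_span_singleton.1 hw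
      simp [sub_mul, Finset.sum_sub_distrib, Pi.single_apply]
      field_simp
      ring
    rw [linForm_sub, linForm_smul, linForm_single, linForm_single] at h2
    rw [← map_mul]
    have h3 := (Ideal.Quotient.mk_eq_mk_iff_sub_mem _ _).2 h2
    refine h3.trans ?_
    congr 1
    rw [C_mul]
    ring
  refine ext_of_homogeneous fun n f hf => ?_
  rw [mem_ofCoords hf]
  have h4 : mk f = mk (C (x i)⁻¹ * X i) ^ n * mk (C (aeval x f)) := by
    have h5 : mk f = eval₂ (mk.comp C) (fun j => mk (X j)) f := by
      have : mk = eval₂Hom (mk.comp C) (fun j => mk (X j)) := by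
        apply MvPolynomial.ringHom_ext
        · intro r; simp
        · intro j; simp
      conv_lhs => rw [this]
      rfl
    have h6 : mk (C (aeval x f)) = eval₂ (mk.comp C) (fun j => mk (C (x j))) f := by
      have := eval₂_comp_left (mk.comp C) (algebraMap k k) x f
      exact this
    rw [h5, h6, ← hf.eval₂_mul_left]
    simp_rw [hX]
  have hdom : IsDomain (MvPolynomial ι k ⧸ p.asHomogeneousIdeal.toIdeal) :=
    Ideal.Quotient.isDomain _
  have h7 : f ∈ p.asHomogeneousIdeal ↔ mk f = 0 := Ideal.Quotient.eq_zero_iff_mem.symm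
  have h8 : mk (C (x i)⁻¹ * X i) ≠ 0 := by
    intro h0
    have h9 := Ideal.mul_mem_left p.asHomogeneousIdeal.toIdeal (C (x i))
      (Ideal.Quotient.eq_zero_iff_mem.1 h0)
    rw [← mul_assoc, ← C_mul, mul_inv_cancel₀ hi, C_1, one_mul] at h9
    exact hXi h9
  rw [h7, h4, mul_eq_zero, or_iff_right (pow_ne_zero _ h8)]
  constructor
  · intro h0
    have h1 := Ideal.Quotient.eq_zero_iff_mem.1 h0
    by_contra hne
    apply p.isPrime.ne_top
    exact Ideal.eq_top_of_isUnit_mem _ h1 ((isUnit_iff_ne_zero.2 hne).map C)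
  · intro h0
    rw [h0, C_0, map_zero]

end ProjectiveSpectrum

/-! ### The action of semilinear automorphisms on the points of projective space -/

namespace SemilinearAut

open scoped Classical

variable {k : Type*} [Field k] {ι : Type*} [Fintype ι] (F G : SemilinearAut k ι)

theorem apply_eq_sum (w : ι → k) (i : ι) : F w i = ∑ j, F.scalar (w j) * F (Pi.single j 1) i := by
  conv_lhs => rw [← Finset.univ_sum_single w]
  have h : F (∑ j, Pi.single j (w j)) = ∑ j, F (Pi.single j (w j)) :=
    _root_.map_sum F.toAddEquiv _ _
  rw [h, Finset.sum_apply]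
  refine Finset.sum_congr rfl fun j _ => ?_
  have h2 : (Pi.single j (w j) : ι → k) = w j • Pi.single j 1 := by
    ext l
    by_cases hl : l = j
    · subst hl; simp
    · simp [hl]
  rw [h2, F.map_smul, Pi.smul_apply, smul_eq_mul]

/-- The linear substitution by which a semilinear automorphism acts on polynomial functions, twisted
so that a polynomial vanishes at the image of `w` if and only if its substitution vanishes at
`w`. -/
noncomputable def subst : MvPolynomial ι k →+* MvPolynomial ι k :=
  eval₂Hom (C.comp F.scalar.symm.toRingHom)
    fun i => linForm fun j => F.scalar.symm (F (Pi.single j 1) i)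

@[simp] theorem subst_C (c : k) : F.subst (C c) = C (F.scalar.symm c) := by
  simp [subst]

@[simp] theorem subst_X (i : ι) :
    F.subst (X i) = linForm fun j => F.scalar.symm (F (Pi.single j 1) i) := by
  simp [subst]

theorem subst_linForm (a : ι → k) :
    F.subst (linForm a) = linForm fun j => F.scalar.symm (∑ i, a i * F (Pi.single j 1) i) := by
  rw [linForm, _root_.map_sum]
  simp only [_root_.map_mul, subst_C, subst_X, _root_.map_sum]
  simp only [linForm, Finset.mul_sum, _root_.map_sum, _root_.map_mul, Finset.sum_mul]
  rw [Finset.sum_comm]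
  exact Finset.sum_congr rfl fun i _ => Finset.sum_congr rfl fun j _ => by ring

theorem subst_trans : (F.trans G).subst = F.subst.comp G.subst := by
  apply MvPolynomial.ringHom_ext
  · intro r
    simp [trans]
  · intro i
    rw [RingHom.comp_apply, subst_X, subst_X, subst_linForm]
    congr 1
    ext j
    change F.scalar.symm (G.scalar.symm (G (F (Pi.single j 1)) i)) = _
    rw [G.apply_eq_sum]
    simp [mul_comm]

theorem subst_eq_id (h : ∀ x, F x = x) (hs : ∀ c, F.scalar c = c) : F.subst = RingHom.id _ := by
  have hs' : ∀ c, F.scalar.symm c = c := fun c => by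
    rw [RingEquiv.symm_apply_eq, hs]
  apply MvPolynomial.ringHom_ext
  · intro r
    simp [hs']
  · intro i
    rw [subst_X, RingHom.id_apply]
    simp only [h, hs']
    rw [← linForm_single (k := k) i]
    congr 1
    ext j
    simp [Pi.single_apply, eq_comm]

theorem subst_subst_symm (f : MvPolynomial ι k) : F.subst (F.symm.subst f) = f := by
  rw [← RingHom.comp_apply, ← subst_trans, subst_eq_id, RingHom.id_apply]
  · intro x; simp
  · intro c
    exact F.scalar.symm_apply_apply c

theorem isHomogeneous_subst {f : MvPolynomial ι k} {n : ℕ} (hf : f.IsHomogeneous n) :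
    (F.subst f).IsHomogeneous n := by
  have := hf.eval₂ (n := 1) (C.comp F.scalar.symm.toRingHom)
    (fun i => linForm fun j => F.scalar.symm (F (Pi.single j 1) i))
    (fun i => isHomogeneous_C _ _) fun i => isHomogeneous_linForm _
  rwa [one_mul] at this

/-- The substitution, as a homomorphism of graded rings. -/
noncomputable def substHom :
    homogeneousSubmodule ι k →+*ᵍ homogeneousSubmodule ι k where
  toRingHom := F.subst
  map_mem hf := F.isHomogeneous_subst hf

/-- The action of a semilinear automorphism on the points of projective space. -/
noncomputable def act : C(ProjectiveSpectrum (homogeneousSubmodule ι k),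
    ProjectiveSpectrum (homogeneousSubmodule ι k)) :=
  AlgebraicGeometry.ProjectiveSpectrum.comap F.substHom <| by
    rw [HomogeneousIdeal.irrelevant_le]
    intro n hn f hf
    rw [← F.subst_subst_symm f]
    exact Ideal.mem_map_of_mem F.subst
      (HomogeneousIdeal.mem_irrelevant_of_mem _ hn (F.symm.isHomogeneous_subst hf))

variable {F G} {p : ProjectiveSpectrum (homogeneousSubmodule ι k)}

theorem mem_act {f : MvPolynomial ι k} :
    f ∈ (F.act p).asHomogeneousIdeal ↔ F.subst f ∈ p.asHomogeneousIdeal := Iff.rfl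

theorem act_trans : (F.trans G).act p = G.act (F.act p) := by
  refine ProjectiveSpectrum.ext_of_homogeneous fun n f _ => ?_
  rw [mem_act, mem_act, mem_act, subst_trans, RingHom.comp_apply]

theorem act_eq_self (h : ∀ x, F x = x) (hs : ∀ c, F.scalar c = c) : F.act p = p := by
  refine ProjectiveSpectrum.ext_of_homogeneous fun n f _ => ?_
  rw [mem_act, subst_eq_id F h hs, RingHom.id_apply]

@[simp] theorem act_symm_act : F.symm.act (F.act p) = p := by
  rw [← act_trans]
  exact act_eq_self (fun x => by simp) fun c => F.scalar.symm_apply_apply c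

@[simp] theorem act_act_symm : F.act (F.symm.act p) = p := by
  rw [← act_trans]
  exact act_eq_self (fun x => by simp) fun c => F.scalar.apply_symm_apply c

theorem map_linSpan_le : F.map p.linSpan ≤ (F.act p).linSpan := by
  intro y hy
  obtain ⟨w, rfl⟩ : ∃ w, F w = y := ⟨F.symm y, by simp⟩
  rw [apply_mem_map] at hy
  intro a ha
  rw [mem_act, subst_linForm] at ha
  have h := congrArg F.scalar (hy _ ha)
  simp only [_root_.map_sum, _root_.map_mul, RingEquiv.apply_symm_apply, _root_.map_zero] at h
  rw [← h]
  simp_rw [F.apply_eq_sum w, Finset.mul_sum, Finset.sum_mul]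
  rw [Finset.sum_comm]
  exact Finset.sum_congr rfl fun i _ => Finset.sum_congr rfl fun j _ => by ring

theorem linSpan_act : (F.act p).linSpan = F.map p.linSpan := by
  refine le_antisymm ?_ map_linSpan_le
  intro y hy
  rw [mem_map]
  have := map_linSpan_le (F := F.symm) (p := F.act p)
  rw [act_symm_act] at this
  apply this
  rwa [apply_mem_map]

/-- The action of a semilinear automorphism on a point depends only on its restriction to the linear
span of the point, up to scalars. -/
theorem act_eq_act {c : k} (hc : c ≠ 0) (hs : F.scalar = G.scalar)
    (h : ∀ w ∈ p.linSpan, F w = c • G w) : F.act p = G.act p := by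
  let mk := Ideal.Quotient.mk p.asHomogeneousIdeal.toIdeal
  let d := F.scalar.symm c
  have hd : d ≠ 0 := by simpa [d] using hc
  have hX : ∀ i, mk (F.subst (X i)) = mk (C d) * mk (G.subst (X i)) := by
    intro i
    rw [← _root_.map_mul]
    apply (Ideal.Quotient.mk_eq_mk_iff_sub_mem _ _).2
    rw [subst_X, subst_X, ← linForm_smul, ← linForm_sub]
    refine ProjectiveSpectrum.linForm_mem_iff.2 fun w hw => ?_
    apply F.scalar.injective
    have h2 := congrFun (h w hw) i
    rw [Pi.smul_apply, F.apply_eq_sum, G.apply_eq_sum, smul_eq_mul, Finset.mul_sum] at h2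
    simp only [Pi.sub_apply, Pi.smul_apply, smul_eq_mul, sub_mul, Finset.sum_sub_distrib,
      _root_.map_sub, _root_.map_sum, _root_.map_mul, RingEquiv.apply_symm_apply, _root_.map_zero,
      d, ← hs]
    rw [sub_eq_zero, Finset.sum_congr rfl fun j _ => mul_comm _ _, h2]
    exact Finset.sum_congr rfl fun j _ => by rw [hs]; ring
  refine ProjectiveSpectrum.ext_of_homogeneous fun n f hf => ?_
  have hev : ∀ H : SemilinearAut k ι, mk (H.subst f) =
      eval₂ (mk.comp (C.comp H.scalar.symm.toRingHom)) (fun i => mk (H.subst (X i))) f := by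
    intro H
    have : mk.comp H.subst = eval₂Hom (mk.comp (C.comp H.scalar.symm.toRingHom))
        (fun i => mk (H.subst (X i))) := by
      apply MvPolynomial.ringHom_ext
      · intro r; simp
      · intro j; simp
    exact congrArg (fun g => g f) this
  have h1 : mk (F.subst f) = mk (C d) ^ n * mk (G.subst f) := by
    rw [hev F, hev G, ← hf.eval₂_mul_left, hs]
    simp_rw [hX]
  have hu : IsUnit (mk (C d) ^ n) := (((isUnit_iff_ne_zero.2 hd).map C).map mk).pow n
  rw [mem_act, mem_act]
  have h7 : ∀ g, g ∈ p.asHomogeneousIdeal ↔ mk g = 0 :=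
    fun g => Ideal.Quotient.eq_zero_iff_mem.symm
  rw [h7, h7, h1, hu.mul_right_eq_zero]

end SemilinearAut

/-! ### Generic points of coordinate subspaces, and points of projective lines -/

namespace ProjectiveSpectrum

variable {k : Type*} [Field k] {ι : Type*}

/-- The coordinates of the generic point of the subspace of the coordinates in `S`. -/
noncomputable def genericCoords (k : Type*) [Field k] (S : Set ι) :
    ι → FractionRing (MvPolynomial ι k) :=
  S.indicator fun i => algebraMap (MvPolynomial ι k) _ (X i)

theorem genericCoords_ne_zero_iff {S : Set ι} {i : ι} : genericCoords k S i ≠ 0 ↔ i ∈ S := by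
  by_cases h : i ∈ S <;> simp [genericCoords, h]

theorem genericCoords_ne_zero {S : Set ι} (hS : S.Nonempty) : genericCoords k S ≠ 0 := by
  obtain ⟨i, hi⟩ := hS
  exact fun h => genericCoords_ne_zero_iff.2 hi (congrFun h i)

/-- The generic point of the linear subspace on which the coordinates outside `S` vanish. -/
noncomputable def generic (k : Type*) [Field k] (S : Set ι) (hS : S.Nonempty) :
    ProjectiveSpectrum (homogeneousSubmodule ι k) :=
  ofCoords k (genericCoords k S) (genericCoords_ne_zero hS)

variable {S : Set ι} {hS : S.Nonempty} {p q : ProjectiveSpectrum (homogeneousSubmodule ι k)}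

theorem X_mem_generic {i : ι} :
    (X i : MvPolynomial ι k) ∈ (generic k S hS).asHomogeneousIdeal ↔ i ∉ S := by
  rw [generic, X_mem_ofCoords, ← genericCoords_ne_zero_iff (k := k), not_not]

/-- Setting the coordinates outside `S` to zero does not change a polynomial modulo an ideal that
contains these coordinates. -/
theorem sub_aeval_indicator_mem {I : Ideal (MvPolynomial ι k)} (h : ∀ i ∉ S, X i ∈ I)
    (f : MvPolynomial ι k) : f - aeval (S.indicator (X : ι → MvPolynomial ι k)) f ∈ I := by
  rw [← Ideal.Quotient.mk_eq_mk_iff_sub_mem]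
  have : (Ideal.Quotient.mkₐ k I) =
      (Ideal.Quotient.mkₐ k I).comp (aeval (S.indicator (X : ι → MvPolynomial ι k))) := by
    apply MvPolynomial.algHom_ext
    intro i
    by_cases hi : i ∈ S
    · simp [hi]
    · simpa [hi] using Ideal.Quotient.eq_zero_iff_mem.2 (h i hi)
  exact congrArg (fun g => g f) this

theorem generic_le (h : ∀ i ∉ S, X i ∈ p.asHomogeneousIdeal) : generic k S hS ≤ p := by
  refine le_of_homogeneous fun n f hf hfg => ?_
  rw [generic, mem_ofCoords hf] at hfg
  have h0 : aeval (S.indicator (X : ι → MvPolynomial ι k)) f = 0 := by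
    apply IsFractionRing.injective (MvPolynomial ι k) (FractionRing (MvPolynomial ι k))
    rw [_root_.map_zero, ← hfg]
    have h1 : (IsScalarTower.toAlgHom k (MvPolynomial ι k)
        (FractionRing (MvPolynomial ι k))).comp
        (aeval (S.indicator (X : ι → MvPolynomial ι k))) = aeval (genericCoords k S) := by
      apply MvPolynomial.algHom_ext
      intro i
      by_cases hi : i ∈ S <;> simp [hi, genericCoords]
    exact congrArg (fun g => g f) h1
  have := sub_aeval_indicator_mem (I := p.asHomogeneousIdeal.toIdeal) h f
  rwa [h0, sub_zero] at this

theorem le_irrelevant (p : ProjectiveSpectrum (homogeneousSubmodule ι k)) :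
    p.asHomogeneousIdeal ≤ HomogeneousIdeal.irrelevant (homogeneousSubmodule ι k) := by
  intro f hf
  have h1 : homogeneousComponent 0 f ∈ p.asHomogeneousIdeal := by
    have := p.asHomogeneousIdeal.isHomogeneous 0 hf
    rwa [← decomposition.decompose'_apply]
  rw [HomogeneousIdeal.mem_irrelevant_iff]
  change ((decomposition.decompose' f 0 : homogeneousSubmodule ι k 0) : MvPolynomial ι k) = 0
  rw [decomposition.decompose'_apply]
  rw [homogeneousComponent_zero] at h1 ⊢
  by_contra hne
  apply p.isPrime.ne_top
  refine Ideal.eq_top_of_isUnit_mem _ h1 ((isUnit_iff_ne_zero.2 ?_).map C)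
  exact fun h => hne (by rw [h, C_0])

theorem isPrime_irrelevant :
    (HomogeneousIdeal.irrelevant (homogeneousSubmodule ι k)).toIdeal.IsPrime := by
  have h : (HomogeneousIdeal.irrelevant (homogeneousSubmodule ι k)).toIdeal =
      RingHom.ker (constantCoeff : MvPolynomial ι k →+* k) := by
    ext f
    rw [HomogeneousIdeal.mem_iff, HomogeneousIdeal.mem_irrelevant_iff, RingHom.mem_ker]
    change ((decomposition.decompose' f 0 : homogeneousSubmodule ι k 0) : MvPolynomial ι k) = 0 ↔ _
    rw [decomposition.decompose'_apply, homogeneousComponent_zero, constantCoeff_eq]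
    exact C_eq_zero
  rw [h]
  exact RingHom.ker_isPrime _

/-- A projective line has dimension one: by the dimension formula for the polynomial ring in two
variables, there is no chain of three points on it. -/
theorem eq_of_generic_lt (h2 : S.ncard = 2) (hp : ∀ i ∉ S, X i ∈ p.asHomogeneousIdeal)
    (hne : p ≠ generic k S hS) (hpq : p ≤ q) : p = q := by
  classical
  by_contra hpq'
  have hfin : Finite S := Set.finite_of_ncard_ne_zero (by omega)
  have key : ∀ I J : Ideal (MvPolynomial ι k), (∀ i ∉ S, X i ∈ I) → I < J →
      I.comap (rename (Subtype.val : S → ι)).toRingHom <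
        J.comap (rename (Subtype.val : S → ι)).toRingHom := by
    intro I J hI hIJ
    refine lt_of_le_of_ne (Ideal.comap_mono hIJ.le) fun heq => hIJ.not_ge fun f hf => ?_
    let g : MvPolynomial S k := aeval (fun i => if h : i ∈ S then X (⟨i, h⟩ : S) else 0) f
    have hg : rename (Subtype.val : S → ι) g =
        aeval (S.indicator (X : ι → MvPolynomial ι k)) f := by
      have : (rename (Subtype.val : S → ι)).comp (aeval (R := k)
          (fun i => if h : i ∈ S then X (⟨i, h⟩ : S) else 0)) =
          aeval (S.indicator (X : ι → MvPolynomial ι k)) := by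
        apply MvPolynomial.algHom_ext
        intro i
        by_cases hi : i ∈ S <;> simp [hi]
      exact congrArg (fun g => g f) this
    have h1 := sub_aeval_indicator_mem hI f
    have h3 : g ∈ J.comap (rename (Subtype.val : S → ι)).toRingHom := by
      change rename _ g ∈ J
      rw [hg, ← sub_sub_cancel f (aeval _ f)]
      exact J.sub_mem hf (hIJ.le h1)
    rw [← heq] at h3
    have h4 : rename (Subtype.val : S → ι) g ∈ I := h3
    rw [hg] at h4
    rw [← sub_add_cancel f (aeval (S.indicator (X : ι → MvPolynomial ι k)) f)]
    exact I.add_mem h1 h4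
  have hI : ∀ i ∉ S, X i ∈ (generic k S hS).asHomogeneousIdeal := fun i hi => X_mem_generic.2 hi
  have h01 : generic k S hS < p := lt_of_le_of_ne (generic_le hp) hne.symm
  have h12 : p < q := lt_of_le_of_ne hpq hpq'
  have h23 : q.asHomogeneousIdeal.toIdeal <
      (HomogeneousIdeal.irrelevant (homogeneousSubmodule ι k)).toIdeal :=
    lt_of_le_not_ge q.le_irrelevant q.not_irrelevant_le
  have hpr := isPrime_irrelevant (k := k) (ι := ι)
  let φ : MvPolynomial S k →+* MvPolynomial ι k := (rename (Subtype.val : S → ι)).toRingHom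
  let P : Fin 4 → PrimeSpectrum (MvPolynomial S k) :=
    ![⟨_, (generic k S hS).isPrime.comap φ⟩, ⟨_, p.isPrime.comap φ⟩, ⟨_, q.isPrime.comap φ⟩,
      ⟨_, hpr.comap φ⟩]
  have hP : StrictMono P := by
    rw [Fin.strictMono_iff_lt_succ]
    intro i
    fin_cases i
    · exact key _ _ hI h01
    · exact key _ _ hp h12
    · exact key _ _ (fun i hi => hpq (hp i hi)) h23
  have h := Order.LTSeries.length_le_krullDim (LTSeries.mk 3 P hP)
  change (3 : WithBot ℕ∞) ≤ ringKrullDim (MvPolynomial S k) at h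
  rw [MvPolynomial.ringKrullDim_of_isNoetherianRing, ringKrullDim_eq_zero_of_field, zero_add,
    Nat.card_coe_set_eq, h2] at h
  exact absurd h (by decide)

theorem isClosed_singleton_of_ne_generic (h2 : S.ncard = 2)
    (hp : ∀ i ∉ S, X i ∈ p.asHomogeneousIdeal) (hne : p ≠ generic k S hS) : IsClosed {p} := by
  rw [← closure_subset_iff_isClosed]
  intro q hq
  rw [← le_iff_mem_closure] at hq
  exact (eq_of_generic_lt h2 hp hne hq).symm

/-- The proper closed subsets of a projective line are finite. -/
theorem finite_of_generic_notMem [Finite ι] (h2 : S.ncard = 2)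
    {Z : Set (ProjectiveSpectrum (homogeneousSubmodule ι k))} (hZ : IsClosed Z)
    (hg : generic k S hS ∉ Z) :
    {p ∈ Z | ∀ i ∉ S, X i ∈ p.asHomogeneousIdeal}.Finite := by
  set T := {p ∈ Z | ∀ i ∉ S, X i ∈ p.asHomogeneousIdeal} with hT
  have hTc : IsClosed T := by
    have : T = Z ∩ zeroLocus _ (X '' Sᶜ) := by
      ext p
      simp [hT, mem_zeroLocus, Set.subset_def]
    rw [this]
    exact hZ.inter (isClosed_zeroLocus _ _)
  let I := vanishingIdeal T
  have hmin : ∀ p ∈ T, p.asHomogeneousIdeal.toIdeal ∈ I.toIdeal.minimalPrimes := by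
    intro p hp
    have hIp : I.toIdeal ≤ p.asHomogeneousIdeal.toIdeal := by
      intro f hf
      exact (mem_vanishingIdeal _ _).1 hf p hp
    obtain ⟨P, hP, hPp⟩ := Ideal.exists_minimalPrimes_le hIp
    have hPpr : P.IsPrime := hP.1.1
    let q : ProjectiveSpectrum (homogeneousSubmodule ι k) :=
      ⟨P.homogeneousCore _, hPpr.homogeneousCore, fun h => p.not_irrelevant_le
        (h.trans ((Ideal.toIdeal_homogeneousCore_le _ P).trans hPp))⟩
    have hqP : q.asHomogeneousIdeal.toIdeal ≤ P := Ideal.toIdeal_homogeneousCore_le _ P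
    have hqT : q ∈ T := by
      have h1 : q ∈ closure T := by
        rw [← zeroLocus_vanishingIdeal_eq_closure, mem_zeroLocus]
        have h3 := Ideal.homogeneousCore_mono (homogeneousSubmodule ι k) hP.1.2
        rw [HomogeneousIdeal.toIdeal_homogeneousCore_eq_self] at h3
        exact h3
      rwa [hTc.closure_eq] at h1
    have hqne : q ≠ generic k S hS := fun h => hg (h ▸ hqT.1)
    have hqp : q = p := eq_of_generic_lt h2 hqT.2 hqne (hqP.trans hPp)
    have : P = p.asHomogeneousIdeal.toIdeal := le_antisymm hPp (by rw [← hqp]; exact hqP)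
    rwa [← this]
  refine Set.Finite.of_injOn
    (f := fun p : ProjectiveSpectrum (homogeneousSubmodule ι k) => p.asHomogeneousIdeal.toIdeal)
    (t := I.toIdeal.minimalPrimes) (fun p hp => hmin p hp) ?_ (Ideal.finite_minimalPrimes_of_isNoetherianRing _ _)
  intro p _ q _ h
  exact ProjectiveSpectrum.ext (HomogeneousIdeal.ext h)

section Lines

variable [Fintype ι]

theorem exists_dual_pair {x y : ι → k} (hy : y ∉ Submodule.span k {x}) :
    ∃ a : ι → k, ∑ i, a i * x i = 0 ∧ ∑ i, a i * y i = 1 := by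
  obtain ⟨a, ha, hne⟩ := Submodule.exists_dotProduct_ne_zero hy
  refine ⟨(∑ i, a i * y i)⁻¹ • a, ?_, ?_⟩
  · simp only [Pi.smul_apply, smul_eq_mul, mul_assoc, ← Finset.mul_sum,
      ha x (Submodule.mem_span_singleton_self x), mul_zero]
  · simp only [Pi.smul_apply, smul_eq_mul, mul_assoc, ← Finset.mul_sum]
    exact inv_mul_cancel₀ hne

/-- On a line there are infinitely many points which lie in no coordinate hyperplane that does not
contain the line.  Over a finite field such points have coordinates in an algebraic closure; two
parameters with the same point are conjugate, as the homogenized minimal polynomial shows. -/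
theorem infinite_setOf_moduleSupport_eq {x y : ι → k} (hx : x ≠ 0)
    (hy : y ∉ Submodule.span k {x}) :
    {p : ProjectiveSpectrum (homogeneousSubmodule ι k) | p.linSpan ≤ Submodule.span k {x, y} ∧
      moduleSupport p.linSpan = moduleSupport (Submodule.span k {x, y})}.Infinite := by
  obtain ⟨a, hax, hay⟩ := exists_dual_pair hy
  obtain ⟨b, hby, hbx⟩ := exists_dual_pair (LooseGraph.notMem_span_symm hx hy)
  let K := AlgebraicClosure k
  let z : K → ι → K := fun θ i => algebraMap k K (x i) + θ * algebraMap k K (y i)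
  have hz : ∀ (c : ι → k) (θ : K), aeval (z θ) (linForm c) =
      algebraMap k K (∑ i, c i * x i) + θ * algebraMap k K (∑ i, c i * y i) := by
    intro c θ
    simp only [linForm, _root_.map_sum, _root_.map_mul, aeval_C, aeval_X, z, mul_add,
      Finset.sum_add_distrib, Finset.mul_sum]
    congr 1
    exact Finset.sum_congr rfl fun i _ => by ring
  have hza : ∀ θ, aeval (z θ) (linForm a) = θ := by
    intro θ
    rw [hz, hax, hay]
    simp
  have hzb : ∀ θ, aeval (z θ) (linForm b) = 1 := by
    intro θ
    rw [hz, hbx, hby]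
    simp
  have hz0 : ∀ θ, z θ ≠ 0 := by
    intro θ h
    have := hzb θ
    rw [h, linForm] at this
    simp at this
  let P : K → ProjectiveSpectrum (homogeneousSubmodule ι k) := fun θ => ofCoords k (z θ) (hz0 θ)
  have hfib : ∀ θ, {θ' | P θ' = P θ}.Finite := by
    intro θ
    refine Set.Finite.subset (Polynomial.finite_setOfPred_isRoot
      (p := (minpoly k θ).map (algebraMap k K)) ?_) ?_
    · exact Polynomial.map_ne_zero (minpoly.ne_zero (Algebra.IsIntegral.isIntegral θ))
    · intro θ' h
      -- the homogenized minimal polynomial of `θ` vanishes at the point of `θ`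
      let m := minpoly k θ
      let f : MvPolynomial ι k :=
        ∑ j ∈ Finset.range (m.natDegree + 1),
          C (m.coeff j) * (linForm b ^ (m.natDegree - j) * linForm a ^ j)
      have hf : f.IsHomogeneous m.natDegree := by
        refine IsHomogeneous.sum _ _ _ fun j hj => ?_
        have h1 := ((isHomogeneous_linForm b).pow (m.natDegree - j)).mul
          ((isHomogeneous_linForm a).pow j)
        rw [one_mul, one_mul, Nat.sub_add_cancel (by simpa [Nat.lt_succ_iff] using hj)] at h1
        exact h1.C_mul _
      have hev : ∀ τ, aeval (z τ) f = Polynomial.aeval τ m := by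
        intro τ
        rw [Polynomial.aeval_eq_sum_range]
        simp only [f, _root_.map_sum, _root_.map_mul, _root_.map_pow, hza, hzb, aeval_C, one_pow,
          one_mul, Algebra.smul_def]
      have h1 : f ∈ (P θ).asHomogeneousIdeal := by
        rw [mem_ofCoords hf, hev]
        exact minpoly.aeval k θ
      rw [← (show P θ' = P θ from h), mem_ofCoords hf, hev] at h1
      change Polynomial.IsRoot _ _
      rwa [Polynomial.IsRoot, Polynomial.eval_map_algebraMap]
  -- the parameters of the points on a coordinate hyperplane that does not contain the line
  let B : Set K := ⋃ i ∈ moduleSupport (Submodule.span k {x, y}), {θ | z θ i = 0}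
  have hB : B.Finite := by
    refine Set.Finite.biUnion (Set.toFinite _) fun i hi => Set.Subsingleton.finite ?_
    intro θ hθ θ' hθ'
    have h1 : algebraMap k K (x i) + θ * algebraMap k K (y i) = 0 := hθ
    have h2 : algebraMap k K (x i) + θ' * algebraMap k K (y i) = 0 := hθ'
    have h3 : (θ - θ') * algebraMap k K (y i) = 0 := by linear_combination h1 - h2
    rcases mul_eq_zero.1 h3 with h | h
    · exact sub_eq_zero.1 h
    · exfalso
      rw [h, mul_zero, add_zero] at h1
      rw [moduleSupport_span_pair] at hi
      rcases hi with hi | hi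
      · exact hi (by simpa using h1)
      · exact hi (by simpa using h)
  have hBc : (Bᶜ).Infinite := hB.infinite_compl
  have himg : (P '' Bᶜ).Infinite := by
    intro hfin
    apply hBc
    refine Set.Finite.of_finite_fibers P hfin ?_
    rintro _ ⟨θ, -, rfl⟩
    exact (hfib θ).subset fun θ' h => h.2
  refine himg.mono ?_
  rintro _ ⟨θ, hθ, rfl⟩
  have hle : (P θ).linSpan ≤ Submodule.span k {x, y} := by
    rw [linSpan_le_iff]
    intro c hc
    rw [mem_ofCoords (isHomogeneous_linForm c), hz,
      hc x (Submodule.subset_span (by simp)), hc y (Submodule.subset_span (by simp))]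
    simp
  refine ⟨hle, subset_antisymm ?_ ?_⟩
  · rw [moduleSupport_subset_iff]
    exact hle.trans (moduleSupport_subset_iff.1 subset_rfl)
  · intro i hi
    rw [← setOf_X_notMem]
    change X i ∉ (P θ).asHomogeneousIdeal
    rw [X_mem_ofCoords]
    intro h
    exact hθ (Set.mem_biUnion hi h)

end Lines

end ProjectiveSpectrum

/-! ### The incidence geometry in terms of vectors and subspaces -/

namespace LooseGraph

variable {V E : Type*} {Γ : LooseGraph V E} {k : Type*} [Field k]

theorem inr_notMem_looseStar {e : E} (he : Γ.ends e = ∅) (v : V)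
    (j : Fin (2 - (Γ.ends e).card)) : (Sum.inr ⟨e, j⟩ : Γ.Completion) ∉ Γ.looseStar v := by
  rintro (h | ⟨e', hv, h⟩)
  · cases h
  · rw [inr_mem_completedEnds] at h
    subst h
    rw [he] at hv
    simp at hv

theorem completedEnds_eq_of_ends_eq_empty {e : E} (he : Γ.ends e = ∅) :
    ∃ i j : Γ.Completion, i ≠ j ∧ Γ.completedEnds e = {i, j} ∧
      (∀ v : V, i ∉ Γ.looseStar v) ∧ ∀ v : V, j ∉ Γ.looseStar v := by
  have hc : 2 - (Γ.ends e).card = 2 := by simp [he]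
  refine ⟨Sum.inr ⟨e, ⟨0, by omega⟩⟩, Sum.inr ⟨e, ⟨1, by omega⟩⟩, by simp, ?_,
    fun v => inr_notMem_looseStar he v _, fun v => inr_notMem_looseStar he v _⟩
  ext l
  constructor
  · rintro (⟨v, hv, -⟩ | ⟨⟨j, hj⟩, rfl⟩)
    · simp [he] at hv
    · obtain rfl | rfl : j = 0 ∨ j = 1 := by omega
      · exact Or.inl rfl
      · exact Or.inr rfl
  · rintro (rfl | rfl)
    · exact Or.inr ⟨_, rfl⟩
    · exact Or.inr ⟨_, rfl⟩

theorem ncard_completedEnds_of_ends_eq_empty {e : E} (he : Γ.ends e = ∅) :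
    (Γ.completedEnds e).ncard = 2 := by
  obtain ⟨i, j, hij, h, -⟩ := completedEnds_eq_of_ends_eq_empty he
  rw [h, Set.ncard_pair hij]

theorem completedEnds_nonempty {e : E} (he : Γ.ends e = ∅) : (Γ.completedEnds e).Nonempty := by
  obtain ⟨i, j, -, h, -⟩ := completedEnds_eq_of_ends_eq_empty he
  exact ⟨i, by simp [h]⟩

theorem nonempty_of_mem_monoidalPoints {S : Set Γ.Completion} (h : S ∈ Γ.monoidalPoints) :
    S.Nonempty := by
  obtain ⟨v, hv, -⟩ | ⟨e, he, rfl⟩ := h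
  · exact ⟨_, hv⟩
  · exact completedEnds_nonempty he

theorem IsDominated.mem_monoidalPoints {S : Set Γ.Completion} (h : Γ.IsDominated S) :
    S ∈ Γ.monoidalPoints := by
  obtain ⟨v, hv, hs, -⟩ := h
  exact Or.inl ⟨v, hv, hs⟩

theorem IsDominated.mono {S T : Set Γ.Completion} (hT : Γ.IsDominated T) (hST : S ⊆ T)
    (hS : S ∈ Γ.monoidalPoints) : Γ.IsDominated S := by
  obtain ⟨u, -, hu, hn⟩ := hT
  obtain ⟨v, hv, hs⟩ | ⟨e, he, rfl⟩ := hS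
  · exact ⟨v, hv, hs, looseStar_nontrivial_of_mem hn (hu (hST hv))⟩
  · obtain ⟨i, j, -, h, hi, -⟩ := completedEnds_eq_of_ends_eq_empty he
    exact absurd (hu (hST (by simp [h]))) (hi u)

theorem support_ofCoords {x : Γ.Completion → k} {hx : x ≠ 0} :
    support (ProjectiveSpectrum.ofCoords k x hx : Γ.Ambient k) = Function.support x := by
  ext j
  exact ProjectiveSpectrum.X_mem_ofCoords.not

theorem ne_zero_of_support_mem {x : Γ.Completion → k}
    (h : Function.support x ∈ Γ.monoidalPoints) : x ≠ 0 := by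
  rintro rfl
  simpa using nonempty_of_mem_monoidalPoints h

theorem X_mem_of_support_subset {S : Set Γ.Completion} {p : Γ.Ambient k} (hp : support p ⊆ S)
    (i : Γ.Completion) (hi : i ∉ S) :
    (X i : MvPolynomial Γ.Completion k) ∈ p.asHomogeneousIdeal := by
  by_contra h
  exact hi (hp h)

theorem support_generic {S : Set Γ.Completion} {hS : S.Nonempty} :
    support (ProjectiveSpectrum.generic k S hS : Γ.Ambient k) = S := by
  ext i
  exact ProjectiveSpectrum.X_mem_generic.not.trans not_not

theorem not_isDominated_completedEnds {e : E} (he : Γ.ends e = ∅) :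
    ¬ Γ.IsDominated (Γ.completedEnds e) := by
  rintro ⟨v, hv, -⟩
  rw [inl_mem_completedEnds, he] at hv
  simp at hv

theorem nontrivial_looseStar {v : V} {e : E} (h : v ∈ Γ.ends e) : (Γ.looseStar v).Nontrivial := by
  by_cases hc : (Γ.ends e).card = 2
  · obtain ⟨w, hw, hwv⟩ := Finset.exists_mem_ne (by omega : 1 < (Γ.ends e).card) v
    exact ⟨_, Γ.inl_mem_looseStar_self v, Sum.inl w,
      Or.inr ⟨e, h, Γ.inl_mem_completedEnds.2 hw⟩, by simpa using hwv.symm⟩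
  · have := Γ.card_ends_le e
    exact ⟨_, Γ.inl_mem_looseStar_self v, Sum.inr ⟨e, ⟨0, by omega⟩⟩,
      Or.inr ⟨e, h, Γ.inr_mem_completedEnds.2 rfl⟩, by simp⟩

theorem isClosed_setOf_support_subset (S : Set Γ.Completion) :
    IsClosed {p : Γ.schemeOver k | support p.1 ⊆ S} := by
  have h : {p : Γ.schemeOver k | support p.1 ⊆ S} =
      Subtype.val ⁻¹' ProjectiveSpectrum.zeroLocus _ (X '' Sᶜ) := by
    ext p
    constructor
    · rintro hp _ ⟨i, hi, rfl⟩
      exact X_mem_of_support_subset hp i hi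
    · intro hp i hi
      by_contra hiS
      exact hi (hp ⟨i, hiS, rfl⟩)
  rw [h]
  exact (ProjectiveSpectrum.isClosed_zeroLocus _ _).preimage continuous_subtype_val

theorem looseStar_nonempty (v : V) : (Γ.looseStar v).Nonempty := ⟨_, Γ.inl_mem_looseStar_self v⟩

theorem exists_apply_eq_zero {W : Submodule k (Γ.Completion → k)} (hW : Module.finrank k W = 2)
    (i : Γ.Completion) : ∃ z ∈ W, z ≠ 0 ∧ z i = 0 := by
  by_contra! h
  let f : W →ₗ[k] k := (LinearMap.proj i).comp W.subtype
  have hf : Function.Injective f := by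
    rw [← LinearMap.ker_eq_bot, LinearMap.ker_eq_bot']
    intro m hm
    by_contra hne
    exact h m m.2 (fun h0 => hne (Subtype.ext h0)) hm
  have := LinearMap.finrank_le_finrank_of_injective hf
  rw [hW, Module.finrank_self] at this
  omega

theorem support_eq (p : Γ.Ambient k) [Fintype V] [Fintype E] :
    support p = moduleSupport p.linSpan :=
  ProjectiveSpectrum.setOf_X_notMem

variable [Fintype V] [Fintype E]

theorem mem_linearLocus_iff {W : Submodule k (Γ.Completion → k)} {p : Γ.Ambient k} :
    p ∈ linearLocus W ↔ p.linSpan ≤ W := by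
  rw [ProjectiveSpectrum.linSpan_le_iff]
  constructor
  · intro h a ha
    exact h ⟨a, ha, rfl⟩
  · rintro h _ ⟨a, ha, rfl⟩
    exact h a ha

theorem exists_span_pair {W : Submodule k (Γ.Completion → k)} (hW : Module.finrank k W = 2) :
    ∃ x y, x ≠ 0 ∧ y ∉ Submodule.span k {x} ∧ W = Submodule.span k {x, y} := by
  have hne : W ≠ ⊥ := by
    rintro rfl
    rw [finrank_bot] at hW
    omega
  obtain ⟨x, hx, hx0⟩ := W.exists_mem_ne_zero_of_ne_bot hne
  obtain ⟨y, hy, hyx⟩ : ∃ y ∈ W, y ∉ Submodule.span k {x} := by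
    by_contra! h
    have := Submodule.finrank_mono (show W ≤ Submodule.span k {x} from h)
    rw [hW, finrank_span_singleton hx0] at this
    omega
  refine ⟨x, y, hx0, hyx, ?_⟩
  symm
  apply Submodule.eq_of_le_of_finrank_eq
  · rw [Submodule.span_le]
    rintro z (rfl | rfl) <;> assumption
  · rw [hW, finrank_span_pair_eq_two hx0 hyx]

/-- A line that is contained in the scheme up to one point contains a point of the scheme at which no
coordinate vanishes that does not vanish on the whole line.  This point lies in the affine space of
a vertex.  The alternative is the multiplicative group of an edge, of whose closure two points are
missing. -/
theorem isLn_of_line (L : Γ.Line k) : Γ.IsLn L.1 := by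
  obtain ⟨W, hW, hL⟩ := L
  refine ⟨hW, ?_⟩
  obtain ⟨x, y, hx, hxy, hWe⟩ := exists_span_pair hW
  have hmiss : ∃ q ∈ linearLocus W, linearLocus W \ {q} ⊆ Γ.schemeOver k := by
    obtain h | ⟨q, hqW, h⟩ := hL
    · obtain ⟨p, hp, -⟩ := (ProjectiveSpectrum.infinite_setOf_moduleSupport_eq hx hxy).nonempty
      rw [← hWe] at hp
      exact ⟨p, mem_linearLocus_iff.2 hp, fun r hr => h hr.1⟩
    · exact ⟨q, hqW, fun r hr => (h.symm.subset hr).2⟩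
  -- a point with generic coordinates other than the exceptional point `q`
  obtain ⟨q, hqW, hq⟩ := hmiss
  obtain ⟨p, ⟨hp, hps⟩, hpq⟩ : ∃ p ∈ {p : Γ.Ambient k | p.linSpan ≤ W ∧
      moduleSupport p.linSpan = moduleSupport W}, p ≠ q := by
    have := ProjectiveSpectrum.infinite_setOf_moduleSupport_eq hx hxy
    rw [← hWe] at this
    obtain ⟨p, hp, hpq⟩ := this.exists_notMem_finset {q}
    exact ⟨p, hp, by simpa using hpq⟩
  have hpX : support p ∈ Γ.monoidalPoints := hq ⟨mem_linearLocus_iff.2 hp, hpq⟩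
  rw [support_eq, hps] at hpX
  obtain ⟨v, hv, hvs⟩ | ⟨e, he, hWs⟩ := hpX
  · refine ⟨v, hv, hvs, ?_⟩
    by_contra hn
    obtain ⟨z, hz, hz0, hzv⟩ := exists_apply_eq_zero hW (Sum.inl v)
    apply hz0
    ext i
    by_contra hi
    have h1 := hvs (support_subset_moduleSupport hz (show i ∈ Function.support z from hi))
    rw [Set.not_nontrivial_iff] at hn
    rw [hn h1 (Γ.inl_mem_looseStar_self v)] at hi
    exact hi hzv
  · exfalso
    obtain ⟨a, b, hab, hends, ha, hb⟩ := completedEnds_eq_of_ends_eq_empty he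
    have key : ∀ i ∈ Γ.completedEnds e, (X i : MvPolynomial Γ.Completion k) ∈
        q.asHomogeneousIdeal := by
      intro i hi
      obtain ⟨z, hz, hz0, hzi⟩ := exists_apply_eq_zero hW i
      by_cases hzq : ProjectiveSpectrum.ofCoords k z hz0 = q
      · rw [← hzq, ProjectiveSpectrum.X_mem_ofCoords]
        exact hzi
      · exfalso
        have h1 : support (ProjectiveSpectrum.ofCoords k z hz0 : Γ.Ambient k) ∈
            Γ.monoidalPoints := by
          refine hq ⟨?_, hzq⟩
          rw [mem_linearLocus_iff, ProjectiveSpectrum.linSpan_ofCoords,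
            Submodule.span_singleton_le_iff_mem]
          exact hz
        rw [support_ofCoords] at h1
        have h3 := hWs ▸ support_subset_moduleSupport hz
        obtain ⟨v, hv, -⟩ | ⟨e', he', hz'⟩ := h1
        · have := h3 hv
          rw [inl_mem_completedEnds, he] at this
          simp at this
        · have h4 : Γ.completedEnds e' = Γ.completedEnds e := by
            rw [← hz']
            refine Set.eq_of_subset_of_ncard_le h3 ?_ (Set.toFinite _)
            rw [hz', ncard_completedEnds_of_ends_eq_empty he,
              ncard_completedEnds_of_ends_eq_empty he']
          rw [← h4, ← hz'] at hi
          exact hi hzi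
    obtain ⟨i, hi⟩ := q.exists_X_notMem
    refine hi ?_
    by_cases hie : i ∈ Γ.completedEnds e
    · exact key i hie
    · rw [ProjectiveSpectrum.X_mem_iff]
      intro w hw
      by_contra hwi
      exact hie (hWs ▸ support_subset_moduleSupport (mem_linearLocus_iff.1 hqW hw) hwi)

/-- A plane of coordinate vectors with a dominating vertex is a line: its points off the coordinate
hyperplane of this vertex lie in the scheme, and the hyperplane contains only one point of it. -/
def IsLn.line {W : Submodule k (Γ.Completion → k)} (hW : Γ.IsLn W) : Γ.Line k :=
  ⟨W, hW.1, by
    obtain ⟨u, hu, hus, hn⟩ := hW.2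
    obtain ⟨z, hz, hz0, hzu⟩ := exists_apply_eq_zero hW.1 (Sum.inl u)
    have hX : ∀ p ∈ linearLocus W, p ∉ Γ.schemeOver k →
        p = ProjectiveSpectrum.ofCoords k z hz0 := by
      intro p hp hpX
      rw [mem_linearLocus_iff] at hp
      apply ProjectiveSpectrum.eq_ofCoords
      intro w hw
      obtain ⟨x, hx, hxu⟩ := hu
      have hx0 : x ≠ 0 := by
        rintro rfl
        exact hxu rfl
      have hzx : z ∉ Submodule.span k {x} := by
        intro h
        obtain ⟨c, rfl⟩ := Submodule.mem_span_singleton.1 h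
        rcases mul_eq_zero.1 (show c * x (Sum.inl u) = 0 from hzu) with h | h
        · exact hz0 (by rw [h, zero_smul])
        · exact hxu h
      have hwW := hp hw
      rw [hW.eq_span hx hz hx0 hzx, Submodule.mem_span_pair] at hwW
      obtain ⟨a, b, rfl⟩ := hwW
      by_cases ha : a = 0
      · rw [ha, zero_smul, zero_add]
        exact Submodule.smul_mem _ _ (Submodule.mem_span_singleton_self z)
      · exfalso
        apply hpX
        refine Or.inl ⟨u, ?_, ?_⟩
        · rw [support_eq]
          refine support_subset_moduleSupport hw ?_
          simp [hzu, ha, hxu]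
        · rw [support_eq, moduleSupport_subset_iff]
          exact hp.trans (moduleSupport_subset_iff.1 hus)
    by_cases h : linearLocus W ⊆ Γ.schemeOver k
    · exact Or.inl h
    · right
      obtain ⟨q, hq, hqX⟩ := Set.not_subset.1 h
      refine ⟨q, hq, ?_⟩
      ext p
      constructor
      · rintro ⟨hp, hpX⟩
        exact ⟨hp, fun h => hqX (h ▸ hpX)⟩
      · rintro ⟨hp, hpq⟩
        refine ⟨hp, ?_⟩
        by_contra hpX
        exact hpq ((hX p hp hpX).trans (hX q hq hqX).symm)⟩

/-- The rational point with given homogeneous coordinates. -/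
noncomputable def ratPt (x : Γ.Completion → k) (h : Function.support x ∈ Γ.monoidalPoints) :
    Γ.RationalPoint k :=
  ⟨⟨ProjectiveSpectrum.ofCoords k x (ne_zero_of_support_mem h), by
      rw [schemeOver, Set.mem_ofPred_eq, support_ofCoords]
      exact h⟩,
    Submodule.span k {x}, finrank_span_singleton (ne_zero_of_support_mem h), by
      rw [mem_linearLocus_iff, ProjectiveSpectrum.linSpan_ofCoords]⟩

theorem RationalPoint.exists_linSpan_eq (p : Γ.RationalPoint k) :
    ∃ x : Γ.Completion → k, x ≠ 0 ∧ p.1.1.linSpan = Submodule.span k {x} := by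
  obtain ⟨p, W, hW, hp⟩ := p
  rw [mem_linearLocus_iff] at hp
  obtain ⟨x, hx, hx0⟩ := Submodule.exists_mem_ne_zero_of_ne_bot
    (ProjectiveSpectrum.linSpan_ne_bot (p := p.1))
  refine ⟨x, hx0, ?_⟩
  have h1 : Submodule.span k {x} ≤ p.1.linSpan := by
    rwa [Submodule.span_singleton_le_iff_mem]
  symm
  apply Submodule.eq_of_le_of_finrank_le h1
  rw [finrank_span_singleton hx0, ← hW]
  exact Submodule.finrank_mono hp

/-- Homogeneous coordinates of a rational point. -/
noncomputable def RationalPoint.vec (p : Γ.RationalPoint k) : Γ.Completion → k :=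
  p.exists_linSpan_eq.choose

namespace RationalPoint

variable (p : Γ.RationalPoint k)

theorem vec_ne_zero : p.vec ≠ 0 := p.exists_linSpan_eq.choose_spec.1

theorem linSpan_eq : p.1.1.linSpan = Submodule.span k {p.vec} := p.exists_linSpan_eq.choose_spec.2

theorem support_vec : Function.support p.vec = support p.1.1 := by
  rw [support_eq, linSpan_eq]
  have := moduleSupport_span_pair p.vec p.vec
  rwa [Set.pair_eq_singleton, Set.union_self, eq_comm] at this

theorem support_vec_mem : Function.support p.vec ∈ Γ.monoidalPoints := by
  rw [support_vec]
  exact p.1.2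

variable {p} in
theorem ext_linSpan {q : Γ.RationalPoint k} (h : p.1.1.linSpan ≤ q.1.1.linSpan) : p = q := by
  apply Subtype.ext
  apply Subtype.ext
  rw [q.linSpan_eq] at h
  rw [ProjectiveSpectrum.eq_ofCoords q.vec_ne_zero h,
    ProjectiveSpectrum.eq_ofCoords q.vec_ne_zero q.linSpan_eq.le]

@[simp] theorem ratPt_vec : ratPt p.vec p.support_vec_mem = p := by
  apply ext_linSpan
  rw [p.linSpan_eq]
  exact (ProjectiveSpectrum.linSpan_ofCoords (hx := p.vec_ne_zero)).le

end RationalPoint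

theorem linSpan_ratPt {x : Γ.Completion → k} (h : Function.support x ∈ Γ.monoidalPoints) :
    (ratPt x h).1.1.linSpan = Submodule.span k {x} :=
  ProjectiveSpectrum.linSpan_ofCoords (hx := ne_zero_of_support_mem h)

theorem exists_vec_ratPt {x : Γ.Completion → k} (h : Function.support x ∈ Γ.monoidalPoints) :
    ∃ c : k, c ≠ 0 ∧ (ratPt x h).vec = c • x := by
  have h1 := (ratPt x h).linSpan_eq
  rw [linSpan_ratPt] at h1
  have h2 : (ratPt x h).vec ∈ Submodule.span k {x} := by
    rw [h1]
    exact Submodule.mem_span_singleton_self _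
  obtain ⟨c, hc⟩ := Submodule.mem_span_singleton.1 h2
  refine ⟨c, ?_, hc.symm⟩
  rintro rfl
  exact (ratPt x h).vec_ne_zero (by rw [← hc, zero_smul])

theorem ratPt_smul {x : Γ.Completion → k} {c : k} (h : Function.support x ∈ Γ.monoidalPoints)
    (h' : Function.support (c • x) ∈ Γ.monoidalPoints) : ratPt (c • x) h' = ratPt x h := by
  apply RationalPoint.ext_linSpan
  rw [linSpan_ratPt, linSpan_ratPt, Submodule.span_singleton_le_iff_mem]
  exact Submodule.smul_mem _ _ (Submodule.mem_span_singleton_self x)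

theorem incident_iff {p : Γ.RationalPoint k} {L : Γ.Line k} : Incident p L ↔ p.vec ∈ L.1 := by
  rw [Incident, mem_linearLocus_iff, p.linSpan_eq, Submodule.span_singleton_le_iff_mem]

/-- The rational points on lines are those in the affine space of a vertex which is not isolated. -/
theorem isPt_vec_iff {p : Γ.RationalPoint k} : Γ.IsPt p.vec ↔ ∃ L, Incident p L := by
  constructor
  · rintro ⟨v, hv, hs, hn⟩
    obtain ⟨i, hi, hiv⟩ := hn.exists_ne (Sum.inl v)
    obtain ⟨y, hy, hyp⟩ : ∃ y ∈ coordSubspace k (Γ.looseStar v), y ∉ Submodule.span k {p.vec} := by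
      by_contra! h
      have h1 := h (Set.indicator {i} 1) (indicator_one_mem_coordSubspace.2 (by simpa using hi))
      obtain ⟨c, hc⟩ := Submodule.mem_span_singleton.1 h1
      have h2 := congrFun hc i
      have h3 := congrFun hc (Sum.inl v)
      have h4 : c * p.vec (Sum.inl v) = 0 := by simpa [hiv.symm] using h3
      rw [(mul_eq_zero.1 h4).resolve_right hv] at h2
      simp at h2
    exact ⟨(isLn_span_of_apply_ne_zero hn hs hv hy hyp).line,
      incident_iff.2 (Submodule.subset_span (by simp))⟩
  · rintro ⟨L, hL⟩
    rw [incident_iff] at hL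
    exact (isLn_of_line L).2.mono (support_subset_moduleSupport hL) p.support_vec_mem

end LooseGraph

/-! ### The collineation of a combinatorial automorphism -/

namespace LooseGraph

open scoped Classical

variable {V E : Type*} {Γ : LooseGraph V E} {k : Type*} [Field k] [Fintype V] [Fintype E]

/-- The map on coordinate vectors under a permutation of the rational points (with junk values at
vectors that do not represent points of the scheme). -/
noncomputable def vecMap (π : Equiv.Perm (Γ.RationalPoint k)) (x : Γ.Completion → k) :
    Γ.Completion → k :=
  if h : Function.support x ∈ Γ.monoidalPoints then (π (ratPt x h)).vec else x

/-- The map on subspaces under a permutation of the lines (with junk values at subspaces which are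
not lines). -/
noncomputable def lineMap (π : Equiv.Perm (Γ.Line k)) (W : Submodule k (Γ.Completion → k)) :
    Submodule k (Γ.Completion → k) :=
  if h : Γ.IsLn W then (π h.line).1 else W

theorem vecMap_eq {π : Equiv.Perm (Γ.RationalPoint k)} {x : Γ.Completion → k} (hx : Γ.IsPt x) :
    vecMap π x = (π (ratPt x hx.mem_monoidalPoints)).vec :=
  dif_pos hx.mem_monoidalPoints

theorem lineMap_eq {π : Equiv.Perm (Γ.Line k)} {W : Submodule k (Γ.Completion → k)}
    (hW : Γ.IsLn W) : lineMap π W = (π hW.line).1 := dif_pos hW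

theorem isLn_lineMap (π : Equiv.Perm (Γ.Line k)) (W : Submodule k (Γ.Completion → k))
    (hW : Γ.IsLn W) : Γ.IsLn (lineMap π W) := by
  rw [lineMap_eq hW]
  exact isLn_of_line _

theorem incident_ratPt {x : Γ.Completion → k} (h : Function.support x ∈ Γ.monoidalPoints)
    {L : Γ.Line k} : Incident (ratPt x h) L ↔ x ∈ L.1 := by
  rw [Incident, mem_linearLocus_iff, linSpan_ratPt, Submodule.span_singleton_le_iff_mem]

theorem isPt_ratPt_vec_iff {x : Γ.Completion → k} (h : Function.support x ∈ Γ.monoidalPoints) :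
    Γ.IsPt (ratPt x h).vec ↔ Γ.IsPt x := by
  obtain ⟨c, hc, h1⟩ := exists_vec_ratPt h
  rw [h1, IsPt, IsPt, support_smul_of_ne_zero hc]

theorem lineMap_inv_lineMap (π : Equiv.Perm (Γ.Line k)) (W : Submodule k (Γ.Completion → k))
    (hW : Γ.IsLn W) : lineMap π⁻¹ (lineMap π W) = W := by
  rw [lineMap_eq (isLn_lineMap π W hW)]
  have : (isLn_lineMap π W hW).line = π hW.line := Subtype.ext (lineMap_eq hW)
  rw [this]
  exact congrArg Subtype.val (π.symm_apply_apply hW.line)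

theorem isPt_vec_apply_iff (g : Γ.combAut k) (p : Γ.RationalPoint k) :
    Γ.IsPt (g.1.1 p).vec ↔ Γ.IsPt p.vec := by
  rw [isPt_vec_iff, isPt_vec_iff]
  constructor
  · rintro ⟨L, hL⟩
    refine ⟨g.1.2⁻¹ L, ?_⟩
    rw [← g.2 p]
    rwa [show g.1.2 (g.1.2⁻¹ L) = L from g.1.2.apply_symm_apply L]
  · rintro ⟨L, hL⟩
    exact ⟨g.1.2 L, (g.2 p L).2 hL⟩

theorem isPt_vecMap (g : Γ.combAut k) (x : Γ.Completion → k) (hx : Γ.IsPt x) :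
    Γ.IsPt (vecMap g.1.1 x) := by
  rw [vecMap_eq hx, isPt_vec_apply_iff, isPt_ratPt_vec_iff]
  exact hx

theorem vecMap_mem_lineMap (g : Γ.combAut k) (x : Γ.Completion → k)
    (W : Submodule k (Γ.Completion → k)) (hx : Γ.IsPt x) (hW : Γ.IsLn W) :
    vecMap g.1.1 x ∈ lineMap g.1.2 W ↔ x ∈ W := by
  rw [vecMap_eq hx, lineMap_eq hW, ← incident_iff, g.2, incident_ratPt]
  rfl

theorem vecMap_smul (π : Equiv.Perm (Γ.RationalPoint k)) (x : Γ.Completion → k) (c : k)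
    (hx : Γ.IsPt x) (hc : c ≠ 0) : vecMap π (c • x) = vecMap π x := by
  rw [vecMap_eq hx, vecMap_eq (hx.smul hc), ratPt_smul hx.mem_monoidalPoints]

theorem ratPt_vecMap {π : Equiv.Perm (Γ.RationalPoint k)} {x : Γ.Completion → k} (hx : Γ.IsPt x)
    (h : Function.support (vecMap π x) ∈ Γ.monoidalPoints) :
    ratPt (vecMap π x) h = π (ratPt x hx.mem_monoidalPoints) := by
  simp only [vecMap_eq hx]
  exact RationalPoint.ratPt_vec _

theorem vecMap_inv_vecMap (g : Γ.combAut k) (x : Γ.Completion → k) (hx : Γ.IsPt x) :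
    ∃ c : k, c ≠ 0 ∧ vecMap (g⁻¹).1.1 (vecMap g.1.1 x) = c • x := by
  rw [vecMap_eq (isPt_vecMap g x hx), ratPt_vecMap hx]
  have : (g⁻¹).1.1 (g.1.1 (ratPt x hx.mem_monoidalPoints)) = ratPt x hx.mem_monoidalPoints :=
    g.1.1.symm_apply_apply _
  rw [this]
  exact exists_vec_ratPt _

/-- The collineation given by a combinatorial automorphism. -/
noncomputable def toCollineation (g : Γ.combAut k) : Γ.Collineation k where
  toFun := vecMap g.1.1
  invFun := vecMap (g⁻¹).1.1
  mapLn := lineMap g.1.2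
  comapLn := lineMap (g⁻¹).1.2
  isPt_toFun := isPt_vecMap g
  isLn_mapLn := isLn_lineMap _
  mem_mapLn := vecMap_mem_lineMap g
  toFun_smul := vecMap_smul _
  inv_toFun := vecMap_inv_vecMap g
  comapLn_mapLn := lineMap_inv_lineMap _
  isPt_invFun := isPt_vecMap g⁻¹
  isLn_comapLn := isLn_lineMap _
  mem_comapLn := vecMap_mem_lineMap g⁻¹
  invFun_smul := vecMap_smul _
  toFun_inv x hx := by
    have := vecMap_inv_vecMap g⁻¹ x hx
    rwa [inv_inv] at this
  mapLn_comapLn W hW := by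
    have := lineMap_inv_lineMap (g⁻¹).1.2 W hW
    exact this

end LooseGraph

/-! ### Components and the semilinear maps between them -/

theorem SemilinearAut.exists_forall_eq_smul {k C : Type*} [Field k] (H : SemilinearAut k C)
    {U : Submodule k (C → k)} {u : C} {x y : C → k} (hx : x ∈ U) (hxu : x u ≠ 0) (hy : y ∈ U)
    (hy0 : y ≠ 0) (hyu : y u = 0) (h : ∀ z ∈ U, z u ≠ 0 → ∃ c : k, H z = c • z) :
    ∃ a : k, a ≠ 0 ∧ (∀ z ∈ U, H z = a • z) ∧ ∀ s, H.scalar s = s := by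
  obtain ⟨a, ha⟩ := h x hx hxu
  have hx0 : x ≠ 0 := by
    rintro rfl
    exact hxu rfl
  have ha0 : a ≠ 0 := by
    rintro rfl
    rw [zero_smul] at ha
    exact hx0 (H.map_eq_zero.1 ha)
  -- The image of `s x + y` is a multiple of it; comparison of coefficients gives `hs`.
  have key : ∀ y ∈ U, y ≠ 0 → y u = 0 → H y = a • y ∧ ∀ s, H.scalar s = s := by
    intro y hy hy0 hyu
    obtain ⟨j, hj⟩ := Function.ne_iff.1 hy0
    rw [Pi.zero_apply] at hj
    obtain ⟨c, hc⟩ := h (x + y) (U.add_mem hx hy) (by simpa [hyu] using hxu)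
    have hc0 : c ≠ 0 := by
      rintro rfl
      rw [zero_smul] at hc
      have := congrFun (H.map_eq_zero.1 hc) u
      simp [hyu, hxu] at this
    have hHy : H y = (c - a) • x + c • y := by
      rw [H.map_add, ha] at hc
      rw [sub_smul, eq_sub_of_add_eq' hc, smul_add]
      abel
    have hs : ∀ s : k, s ≠ 0 → H.scalar s * a + (c - a) = c * s := by
      intro s hs0
      obtain ⟨d, hd⟩ := h (s • x + y) (U.add_mem (U.smul_mem s hx) hy)
        (by simp [hyu, hxu, hs0])
      rw [H.map_add, H.map_smul, ha, hHy] at hd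
      have h1 := congrFun hd u
      have h2 := congrFun hd j
      simp only [Pi.add_apply, Pi.smul_apply, smul_eq_mul, hyu, mul_zero, add_zero] at h1 h2
      have h3 : H.scalar s * a + (c - a) = d * s := by
        apply mul_right_cancel₀ hxu
        linear_combination h1
      have h4 : c = d := by
        apply mul_right_cancel₀ hj
        linear_combination h2 - x j * h3
      rw [h3, h4]
    have hca : c = a := by
      by_cases hex : ∃ s : k, s ≠ 0 ∧ s + 1 ≠ 0
      · obtain ⟨s, hs0, hs1⟩ := hex
        have h1 := hs s hs0
        have h2 := hs (s + 1) hs1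
        rw [_root_.map_add, _root_.map_one] at h2
        linear_combination h1 - h2
      · push Not at hex
        have h1 := hex a ha0
        have h2 := hex c hc0
        linear_combination h2 - h1
    rw [hca, sub_self, zero_smul, zero_add] at hHy
    refine ⟨hHy, fun s => ?_⟩
    by_cases hs0 : s = 0
    · rw [hs0, _root_.map_zero]
    · have h1 := hs s hs0
      rw [hca, sub_self, add_zero, mul_comm] at h1
      exact mul_left_cancel₀ ha0 h1
  have hsc := (key y hy hy0 hyu).2
  refine ⟨a, ha0, fun z hz => ?_, hsc⟩
  have hw : z - (z u * (x u)⁻¹) • x ∈ U := U.sub_mem hz (U.smul_mem _ hx)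
  have hz' : H (z - (z u * (x u)⁻¹) • x) = a • (z - (z u * (x u)⁻¹) • x) := by
    by_cases h0 : z - (z u * (x u)⁻¹) • x = 0
    · rw [h0, H.map_zero, smul_zero]
    · exact (key _ hw h0 (by simp [hxu])).1
  rw [H.map_sub, H.map_smul, hsc, ha, smul_sub, smul_comm a] at hz'
  exact sub_left_injective hz'

namespace LooseGraph

section Pair

variable {C : Type*} {S T : Set C}

/-- The first element of a set of two elements, in an order chosen once for all. -/
noncomputable def pairFst (h : S.ncard = 2) : C := (Set.ncard_eq_two.1 h).choose

/-- The second element of a set of two elements, in an order chosen once for all. -/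
noncomputable def pairSnd (h : S.ncard = 2) : C := (Set.ncard_eq_two.1 h).choose_spec.choose

theorem pairFst_ne_pairSnd (h : S.ncard = 2) : pairFst h ≠ pairSnd h :=
  (Set.ncard_eq_two.1 h).choose_spec.choose_spec.1

theorem eq_pair (h : S.ncard = 2) : S = {pairFst h, pairSnd h} :=
  (Set.ncard_eq_two.1 h).choose_spec.choose_spec.2

theorem exists_perm_pair (hS : S.ncard = 2) (hT : T.ncard = 2) :
    ∃ σ : Equiv.Perm C, σ (pairFst hS) = pairFst hT ∧ σ (pairSnd hS) = pairSnd hT := by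
  classical
  refine ⟨(Equiv.swap (pairFst hS) (pairFst hT)).trans
    (Equiv.swap (Equiv.swap (pairFst hS) (pairFst hT) (pairSnd hS)) (pairSnd hT)), ?_, ?_⟩
  · rw [Equiv.trans_apply, Equiv.swap_apply_left]
    refine Equiv.swap_apply_of_ne_of_ne (fun h => ?_) (pairFst_ne_pairSnd hT)
    rw [eq_comm, Equiv.swap_apply_eq_iff, Equiv.swap_apply_right] at h
    exact pairFst_ne_pairSnd hS h.symm
  · rw [Equiv.trans_apply, Equiv.swap_apply_left]

end Pair

variable {V E : Type*} {Γ : LooseGraph V E} {k : Type*} [Field k]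

/-- The semilinear automorphism restricts to the scalar extension of the bijection between the sets of
homogeneous coordinates of two projective lines that respects the chosen orders.  With these orders,
the standard maps are closed under composition. -/
def IsStandard {v u : V} (hv : (Γ.looseStar v).ncard = 2) (hu : (Γ.looseStar u).ncard = 2)
    (F : SemilinearAut k Γ.Completion) : Prop :=
  (∀ c, F.scalar c = c) ∧
    F (Set.indicator {pairFst hv} 1) = Set.indicator {pairFst hu} 1 ∧
    F (Set.indicator {pairSnd hv} 1) = Set.indicator {pairSnd hu} 1

theorem exists_isStandard {v u : V} (hv : (Γ.looseStar v).ncard = 2)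
    (hu : (Γ.looseStar u).ncard = 2) : ∃ F : SemilinearAut k Γ.Completion, IsStandard hv hu F := by
  obtain ⟨σ, h1, h2⟩ := exists_perm_pair hv hu
  have key : ∀ i j, σ i = j → (semilinearAutOfLinearEquiv (LinearEquiv.funCongrLeft k k σ.symm)
      (RingEquiv.refl k)) (Set.indicator {i} 1) = Set.indicator {j} (1 : Γ.Completion → k) := by
    rintro i j rfl
    ext l
    change Set.indicator {i} (1 : Γ.Completion → k) (σ.symm l) = _
    by_cases hl : l = σ i
    · simp [hl]
    · rw [Set.indicator_of_notMem, Set.indicator_of_notMem]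
      · simpa using hl
      · simpa [Equiv.symm_apply_eq] using hl
  exact ⟨_, fun c => rfl, key _ _ h1, key _ _ h2⟩

variable [Fintype V] [Fintype E]

/-- A point is rational if its linear span is spanned by one vector. -/
def IsRational (p : Γ.Ambient k) : Prop := ∃ x, x ≠ 0 ∧ p.linSpan = Submodule.span k {x}

/-- The semilinear maps that describe the action of a combinatorial automorphism on the component
of a vertex `v`.  If `v` has at least two edges, such a map realizes the collineation on the affine
space of `v`.  The component of a vertex with only one edge is a projective or an affine line, on
whose rational points the collineation is an arbitrary bijection; here the map is the standard one
between the coordinates of this line and its image. -/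
def IsCompatible (g : Γ.combAut k) (v : V) (F : SemilinearAut k Γ.Completion) : Prop :=
  (3 ≤ (Γ.looseStar v).ncard ∧ (toCollineation g).Realizes v F) ∨
    ∃ (u : V) (hv : (Γ.looseStar v).ncard = 2) (hu : (Γ.looseStar u).ncard = 2),
      Γ.IsMaximalStar u ∧ lineMap g.1.2 (coordSubspace k (Γ.looseStar v)) =
        coordSubspace k (Γ.looseStar u) ∧ IsStandard hv hu F

namespace IsMaximalStar

variable {v : V}

theorem ncard (hm : Γ.IsMaximalStar v) :
    3 ≤ (Γ.looseStar v).ncard ∨ (Γ.looseStar v).ncard = 2 := by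
  have := Set.one_lt_ncard_iff_nontrivial.2 hm.1
  omega

end IsMaximalStar

theorem lineMap_one {W : Submodule k (Γ.Completion → k)} :
    lineMap (1 : Γ.combAut k).1.2 W = W := by
  by_cases hW : Γ.IsLn W
  · rw [lineMap_eq hW]
    rfl
  · exact dif_neg hW

theorem lineMap_mul (h g : Γ.combAut k) {W : Submodule k (Γ.Completion → k)} (hW : Γ.IsLn W) :
    lineMap (h * g).1.2 W = lineMap h.1.2 (lineMap g.1.2 W) := by
  rw [lineMap_eq (isLn_lineMap _ _ hW), lineMap_eq hW]
  have : (isLn_lineMap g.1.2 W hW).line = g.1.2 hW.line := Subtype.ext (lineMap_eq hW)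
  rw [this]
  rfl

theorem vecMap_mul (h g : Γ.combAut k) {x : Γ.Completion → k} (hx : Γ.IsPt x) :
    vecMap (h * g).1.1 x = vecMap h.1.1 (vecMap g.1.1 x) := by
  rw [vecMap_eq (isPt_vecMap g x hx), vecMap_eq hx, ratPt_vecMap hx]
  rfl

theorem IsStandard.map_coordSubspace {v u : V} {hv : (Γ.looseStar v).ncard = 2}
    {hu : (Γ.looseStar u).ncard = 2} {F : SemilinearAut k Γ.Completion}
    (hF : IsStandard hv hu F) :
    F.map (coordSubspace k (Γ.looseStar v)) = coordSubspace k (Γ.looseStar u) := by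
  conv_lhs => rw [eq_pair hv]
  conv_rhs => rw [eq_pair hu]
  rw [coordSubspace_pair, coordSubspace_pair, F.map_span_pair, hF.2.1, hF.2.2]

/-- A point of a projective line which is not rational spans the line. -/
theorem linSpan_eq_of_not_isRational {v : V} (hm : Γ.IsMaximalStar v)
    (h2 : (Γ.looseStar v).ncard = 2) {p : Γ.Ambient k} (hp : ¬ IsRational p)
    (hs : p.linSpan ≤ coordSubspace k (Γ.looseStar v)) :
    p.linSpan = coordSubspace k (Γ.looseStar v) := by
  obtain ⟨x, hx, hx0⟩ := Submodule.exists_mem_ne_zero_of_ne_bot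
    (ProjectiveSpectrum.linSpan_ne_bot (p := p))
  obtain ⟨y, hy, hyx⟩ : ∃ y ∈ p.linSpan, y ∉ Submodule.span k {x} := by
    by_contra! h
    exact hp ⟨x, hx0, le_antisymm h (by rwa [Submodule.span_singleton_le_iff_mem])⟩
  refine le_antisymm hs ?_
  rw [(isLn_coordSubspace (k := k) hm.1 h2).eq_span (hs hx) (hs hy) hx0 hyx, Submodule.span_le]
  rintro z (rfl | rfl) <;> assumption

theorem isRational_of_act {F : SemilinearAut k Γ.Completion} {p : Γ.Ambient k}
    (h : IsRational (F.act p)) : IsRational p := by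
  obtain ⟨x, hx, h⟩ := h
  rw [SemilinearAut.linSpan_act] at h
  refine ⟨F.symm x, fun h0 => hx (F.symm.map_eq_zero.1 h0), ?_⟩
  rw [← F.symm_map_map p.linSpan, h, ← Set.pair_eq_singleton, F.symm.map_span_pair,
    Set.pair_eq_singleton]

namespace IsCompatible

variable {g h : Γ.combAut k} {v : V} {F G : SemilinearAut k Γ.Completion}

theorem exists_of_isMaximalStar (g : Γ.combAut k) (hm : Γ.IsMaximalStar v)
    (hk : Nat.card k ≠ 2 ∨ (3 < (Γ.looseStar v).ncard → {e : E | Γ.ends e = {v}}.Subsingleton)) :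
    ∃ F, IsCompatible g v F := by
  rcases hm.ncard with h3 | h2
  · obtain ⟨F, hF⟩ := (toCollineation g).exists_realizes hm.1 h3 hk
    exact ⟨F, Or.inl ⟨h3, hF⟩⟩
  · obtain ⟨u, hu, h⟩ := (toCollineation g).exists_mapLn_coordSubspace hm h2
    have hW : Γ.IsLn (coordSubspace k (Γ.looseStar u)) := by
      rw [← h]
      exact isLn_lineMap _ _ (isLn_coordSubspace hm.1 h2)
    have hu2 : (Γ.looseStar u).ncard = 2 := by rw [← finrank_coordSubspace (k := k), hW.1]
    obtain ⟨F, hF⟩ := exists_isStandard (k := k) h2 hu2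
    exact ⟨F, Or.inr ⟨u, h2, hu2, hu, h, hF⟩⟩

theorem exists_map_eq (hF : IsCompatible g v F) (hm : Γ.IsMaximalStar v) :
    ∃ u, Γ.IsMaximalStar u ∧
      F.map (coordSubspace k (Γ.looseStar v)) = coordSubspace k (Γ.looseStar u) := by
  obtain ⟨h3, hF⟩ | ⟨u, hv, hu, hmu, -, hF⟩ := hF
  · exact hF.exists_map_eq hm h3
  · exact ⟨u, hmu, hF.map_coordSubspace⟩

theorem one_refl (hm : Γ.IsMaximalStar v) : IsCompatible (1 : Γ.combAut k) v
    (semilinearAutOfLinearEquiv (LinearEquiv.refl k (Γ.Completion → k)) (RingEquiv.refl k)) := by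
  rcases hm.ncard with h3 | h2
  · refine Or.inl ⟨h3, fun x hx hxv => ?_⟩
    have hp := isPt_of_apply_ne_zero hm.1 hx hxv
    change ∃ r : k, r ≠ 0 ∧ vecMap (1 : Γ.combAut k).1.1 x = r • x
    rw [vecMap_eq hp]
    exact exists_vec_ratPt hp.mem_monoidalPoints
  · exact Or.inr ⟨v, h2, h2, hm, lineMap_one, fun c => rfl, rfl, rfl⟩

theorem trans (hF : IsCompatible g v F) (hm : Γ.IsMaximalStar v) {u : V}
    (hu : Γ.IsMaximalStar u)
    (hmap : F.map (coordSubspace k (Γ.looseStar v)) = coordSubspace k (Γ.looseStar u))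
    (hG : IsCompatible h u G) : IsCompatible (h * g) v (F.trans G) := by
  obtain ⟨h3, hF⟩ | ⟨u', hv, hu', hmu', hW, hF⟩ := hF
  · obtain ⟨hu3, hG⟩ | ⟨-, hu2, -⟩ := hG
    · refine Or.inl ⟨h3, fun x hx hxv => ?_⟩
      have hp := isPt_of_apply_ne_zero hm.1 hx hxv
      obtain ⟨r, hr, h1⟩ := hF x hx hxv
      have hFx : Γ.IsPt (F x) := (hF.isPt_iff hm.1 h3 hx).2 hp
      obtain ⟨s, hs, h2⟩ := hG.toFun_eq hu.1 hu3 (by rw [← hmap]; simpa using hx) hFx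
      refine ⟨s, hs, ?_⟩
      change vecMap (h * g).1.1 x = _
      change vecMap g.1.1 x = _ at h1
      rw [vecMap_mul h g hp, h1, vecMap_smul _ _ _ hFx hr]
      exact h2
    · exfalso
      rw [← finrank_coordSubspace (k := k), ← F.symm_map_map (coordSubspace k (Γ.looseStar v)),
        hmap] at h3
      rw [eq_pair hu2, coordSubspace_pair, F.symm.map_span_pair] at h3
      classical
      have := finrank_span_finset_le_card (R := k) ({F.symm (Set.indicator {pairFst hu2} 1),
        F.symm (Set.indicator {pairSnd hu2} 1)} : Finset (Γ.Completion → k))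
      rw [Finset.coe_pair] at this
      exact absurd (h3.trans (this.trans Finset.card_le_two)) (by decide)
  · have hS : Γ.looseStar u' = Γ.looseStar u :=
      coordSubspace_injective (hF.map_coordSubspace.symm.trans hmap)
    obtain ⟨hu3, -⟩ | ⟨w, hu2, hw, hmw, hW', hG⟩ := hG
    · rw [← hS] at hu3
      omega
    · refine Or.inr ⟨w, hv, hw, hmw, ?_, ?_, ?_, ?_⟩
      · rw [lineMap_mul h g (isLn_coordSubspace hm.1 hv), hW, hS, hW']
      · intro c
        change G.scalar (F.scalar c) = c
        rw [hF.1, hG.1]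
      · rw [SemilinearAut.trans_apply, hF.2.1, ← hG.2.1]
        simp only [pairFst, hS]
      · rw [SemilinearAut.trans_apply, hF.2.2, ← hG.2.2]
        simp only [pairSnd, hS]

theorem isDominated_act (hF : IsCompatible g v F) (hm : Γ.IsMaximalStar v) {p : Γ.Ambient k}
    (hp : ¬ IsRational p) (hs : support p ⊆ Γ.looseStar v) (hd : Γ.IsDominated (support p)) :
    Γ.IsDominated (support (F.act p)) := by
  rw [support_eq] at hd hs ⊢
  rw [moduleSupport_subset_iff] at hs
  rw [SemilinearAut.linSpan_act]
  obtain ⟨h3, hF⟩ | ⟨u, hv, hu, hmu, -, hF⟩ := hF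
  · exact hF.isDominated_map hm h3 hs hd
  · rw [linSpan_eq_of_not_isRational hm hv hp hs, hF.map_coordSubspace]
    exact (isLn_coordSubspace hmu.1 hu).2

/-- On the points that are not rational, the action does not depend on the choice of the component and
of the semilinear map. -/
theorem act_eq_act {v' : V} (hF : IsCompatible g v F) (hG : IsCompatible g v' G)
    (hm : Γ.IsMaximalStar v) (hm' : Γ.IsMaximalStar v') {p : Γ.Ambient k}
    (hp : ¬ IsRational p) (hs : support p ⊆ Γ.looseStar v) (hs' : support p ⊆ Γ.looseStar v')
    (hd : Γ.IsDominated (support p)) : F.act p = G.act p := by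
  rw [support_eq] at hd hs hs'
  rw [moduleSupport_subset_iff] at hs hs'
  -- a component of dimension one shares only rational points with the other components
  have hthin : ∀ {v v' : V}, Γ.IsMaximalStar v → (Γ.looseStar v).ncard = 2 →
      p.linSpan ≤ coordSubspace k (Γ.looseStar v) →
      p.linSpan ≤ coordSubspace k (Γ.looseStar v') → Γ.looseStar v = Γ.looseStar v' := by
    intro v v' hm h2 hs hs'
    rw [linSpan_eq_of_not_isRational hm h2 hp hs, coordSubspace_le_iff] at hs'
    exact hs'.antisymm (hm.2 _ hs')
  obtain ⟨h3, hF⟩ | ⟨u, hv, hu, hmu, hW, hF⟩ := hF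
  · obtain ⟨h3', hG⟩ | ⟨-, hv', -⟩ := hG
    swap
    · rw [← hthin hm' hv' hs' hs] at h3
      omega
    obtain ⟨u, ⟨x, hx, hxu⟩, hus, hn⟩ := hd
    have hx0 : x ≠ 0 := by
      rintro rfl
      exact hxu rfl
    obtain ⟨y, hy, hyx⟩ : ∃ y ∈ p.linSpan, y ∉ Submodule.span k {x} := by
      by_contra! h
      exact hp ⟨x, hx0, le_antisymm h (by rwa [Submodule.span_singleton_le_iff_mem])⟩
    -- `G⁻¹ ∘ F` fixes all rational points off the hyperplane of a vertex dominating the span of `p`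
    obtain ⟨a, ha, hH, hsc⟩ := (F.trans G.symm).exists_forall_eq_smul hx hxu
      (p.linSpan.sub_mem hy (p.linSpan.smul_mem (y (Sum.inl u) * (x (Sum.inl u))⁻¹) hx))
      (fun h0 => hyx (by
        rw [sub_eq_zero.1 h0]
        exact Submodule.smul_mem _ _ (Submodule.mem_span_singleton_self x)))
      (by simp only [Pi.sub_apply, Pi.smul_apply, smul_eq_mul]
          rw [mul_assoc, inv_mul_cancel₀ hxu, mul_one, sub_self])
      (fun z hz hzu => by
        have hzp : Γ.IsPt z :=
          ⟨u, hzu, (support_subset_moduleSupport hz).trans hus, hn⟩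
        obtain ⟨r, hr, h1⟩ := hF.toFun_eq hm.1 h3 (hs hz) hzp
        obtain ⟨s, hs0, h2⟩ := hG.toFun_eq hm'.1 h3' (hs' hz) hzp
        refine ⟨G.symm.scalar (r⁻¹ * s), ?_⟩
        rw [SemilinearAut.trans_apply, ← G.symm_apply_apply z, ← G.symm.map_smul,
          G.symm_apply_apply, mul_smul, ← h2, h1, smul_smul, inv_mul_cancel₀ hr, one_smul])
    refine SemilinearAut.act_eq_act (c := G.scalar a) (by simpa using ha) ?_ fun w hw => ?_
    · ext s
      have h1 : G.scalar.symm (F.scalar s) = s := hsc s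
      rw [RingEquiv.symm_apply_eq] at h1
      exact h1
    · have h1 := congrArg G (hH w hw)
      rwa [SemilinearAut.trans_apply, G.apply_symm_apply, G.map_smul] at h1
  · have hS := hthin hm hv hs hs'
    obtain ⟨h3', hG⟩ | ⟨u', hv', hu', hmu', hW', hG⟩ := hG
    · rw [← hS] at h3'
      omega
    have hT : Γ.looseStar u = Γ.looseStar u' := by
      apply coordSubspace_injective (k := k)
      rw [← hW, ← hW', hS]
    refine SemilinearAut.act_eq_act one_ne_zero ?_ fun w hw => ?_
    · ext c
      rw [hF.1, hG.1]
    · have hw' := hs hw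
      rw [eq_pair hv, coordSubspace_pair, Submodule.mem_span_pair] at hw'
      obtain ⟨a, b, rfl⟩ := hw'
      have h1 : F (Set.indicator {pairFst hv} 1) = G (Set.indicator {pairFst hv} 1) := by
        have := hG.2.1
        simp only [pairFst, ← hS, ← hT] at this
        rw [hF.2.1]
        simp only [pairFst, this]
      have h2 : F (Set.indicator {pairSnd hv} 1) = G (Set.indicator {pairSnd hv} 1) := by
        have := hG.2.2
        simp only [pairSnd, ← hS, ← hT] at this
        rw [hF.2.2]
        simp only [pairSnd, this]
      rw [one_smul, F.map_add, G.map_add, F.map_smul, F.map_smul, G.map_smul, G.map_smul, h1, h2,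
        hF.1, hF.1, hG.1, hG.1]

end IsCompatible

end LooseGraph

/-! ### The action of a combinatorial automorphism on scheme points -/

namespace LooseGraph

variable {V E : Type*} {Γ : LooseGraph V E} {k : Type*} [Field k] [Fintype V] [Fintype E]

variable (Γ k) in
/-- The rational points that lie on no line. -/
abbrev IsolatedPoint : Type _ := {P : Γ.RationalPoint k // ¬ Γ.IsPt P.vec}

/-- The permutation of the isolated rational points under a combinatorial automorphism. -/
noncomputable def isolatedPerm : Γ.combAut k →* Equiv.Perm (Γ.IsolatedPoint k) where
  toFun g := g.1.1.subtypePerm fun P => (isPt_vec_apply_iff g P).not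
  map_one' := rfl
  map_mul' _ _ := rfl

theorem isPt_vec_iff_isDominated {P : Γ.RationalPoint k} :
    Γ.IsPt P.vec ↔ Γ.IsDominated (support P.1.1) := by
  rw [IsPt, P.support_vec]

theorem RationalPoint.isRational (P : Γ.RationalPoint k) : IsRational P.1.1 :=
  ⟨P.vec, P.vec_ne_zero, P.linSpan_eq⟩

theorem IsRational.exists_eq {p : Γ.schemeOver k} (h : IsRational p.1) :
    ∃ P : Γ.RationalPoint k, P.1 = p := by
  obtain ⟨x, hx, h⟩ := h
  exact ⟨⟨p, Submodule.span k {x}, finrank_span_singleton hx, by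
    rw [mem_linearLocus_iff, h]⟩, rfl⟩

/-- A place for the isolated rational points: a set of points of the scheme that do not belong to the
affine space of any vertex of positive degree.  If one of them belongs to a multiplicative group,
then all of them are non-generic points of this group; otherwise all of them are isolated points of
the scheme.  In both cases every permutation of this set, extended by the identity, is continuous
outside the affine spaces of the vertices of positive degree. -/
structure IsPlacement (j : Γ.IsolatedPoint k ↪ Γ.schemeOver k) : Prop where
  not_isDominated : ∀ P, ¬ Γ.IsDominated (support (j P).1)
  support_eq : ∀ P Q e, Γ.ends e = ∅ → support (j P).1 = Γ.completedEnds e →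
    support (j Q).1 = Γ.completedEnds e
  ne_generic : ∀ P e (he : Γ.ends e = ∅),
    (j P).1 ≠ ProjectiveSpectrum.generic k (Γ.completedEnds e) (completedEnds_nonempty he)

/-- The graph of the action of a combinatorial automorphism on the points of the scheme.  On the
rational points of the components of positive-degree vertices the action is the given one.  It is
extended to the other points of these components by means of semilinear maps.  The remaining points
are fixed, apart from those that represent the isolated rational points. -/
def ActsAs (j : Γ.IsolatedPoint k ↪ Γ.schemeOver k) (g : Γ.combAut k)
    (p p' : Γ.schemeOver k) : Prop :=
  (∃ P : Γ.RationalPoint k, Γ.IsPt P.vec ∧ P.1 = p ∧ (g.1.1 P).1 = p') ∨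
  (¬ IsRational p.1 ∧ Γ.IsDominated (support p.1) ∧ ∃ v F, Γ.IsMaximalStar v ∧
    support p.1 ⊆ Γ.looseStar v ∧ IsCompatible g v F ∧ F.act p.1 = p'.1) ∨
  (¬ Γ.IsDominated (support p.1) ∧
    Equiv.Perm.viaEmbeddingHom j (isolatedPerm g) p = p')

namespace ActsAs

variable {j : Γ.IsolatedPoint k ↪ Γ.schemeOver k} {g h : Γ.combAut k}
  {p p' p'' : Γ.schemeOver k}

theorem exists_right (j : Γ.IsolatedPoint k ↪ Γ.schemeOver k)
    (hk : Nat.card k ≠ 2 ∨ ∀ v, 3 < (Γ.looseStar v).ncard → {e : E | Γ.ends e = {v}}.Subsingleton)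
    (g : Γ.combAut k) (p : Γ.schemeOver k) : ∃ p', ActsAs j g p p' := by
  by_cases hd : Γ.IsDominated (support p.1)
  · by_cases hr : IsRational p.1
    · obtain ⟨P, rfl⟩ := hr.exists_eq
      exact ⟨_, Or.inl ⟨P, isPt_vec_iff_isDominated.2 hd, rfl, rfl⟩⟩
    · obtain ⟨v, hm, hv⟩ := hd.exists_isMaximalStar
      obtain ⟨F, hF⟩ := IsCompatible.exists_of_isMaximalStar g hm (hk.imp id fun h => h v)
      exact ⟨⟨F.act p.1, (hF.isDominated_act hm hr hv hd).mem_monoidalPoints⟩,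
        Or.inr (Or.inl ⟨hr, hd, v, F, hm, hv, hF, rfl⟩)⟩
  · exact ⟨_, Or.inr (Or.inr ⟨hd, rfl⟩)⟩

theorem rational_iff (P : Γ.RationalPoint k) (hP : Γ.IsPt P.vec) :
    ActsAs j g P.1 p' ↔ (g.1.1 P).1 = p' := by
  constructor
  · rintro (⟨Q, -, hQ, h⟩ | ⟨hr, -⟩ | ⟨hd, -⟩)
    · rwa [Subtype.ext hQ] at h
    · exact absurd P.isRational hr
    · exact absurd (isPt_vec_iff_isDominated.1 hP) hd
  · exact fun h => Or.inl ⟨P, hP, rfl, h⟩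

theorem not_isDominated_iff (hd : ¬ Γ.IsDominated (support p.1)) :
    ActsAs j g p p' ↔ Equiv.Perm.viaEmbeddingHom j (isolatedPerm g) p = p' := by
  constructor
  · rintro (⟨Q, hQ, rfl, -⟩ | ⟨-, h, -⟩ | ⟨-, h⟩)
    · exact absurd (isPt_vec_iff_isDominated.1 hQ) hd
    · exact absurd h hd
    · exact h
  · exact fun h => Or.inr (Or.inr ⟨hd, h⟩)

theorem not_isRational_iff (hr : ¬ IsRational p.1) (hd : Γ.IsDominated (support p.1)) {v : V}
    {F : SemilinearAut k Γ.Completion} (hm : Γ.IsMaximalStar v) (hv : support p.1 ⊆ Γ.looseStar v)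
    (hF : IsCompatible g v F) : ActsAs j g p p' ↔ F.act p.1 = p'.1 := by
  constructor
  · rintro (⟨Q, hQ, rfl, -⟩ | ⟨-, -, u, G, hm', hu, hG, h⟩ | ⟨h, -⟩)
    · exact absurd Q.isRational hr
    · rw [← h]
      exact hF.act_eq_act hG hm hm' hr hv hu hd
    · exact absurd hd h
  · exact fun h => Or.inr (Or.inl ⟨hr, hd, v, F, hm, hv, hF, h⟩)

theorem unique (h1 : ActsAs j g p p') (h2 : ActsAs j g p p'') : p' = p'' := by
  obtain ⟨P, hP, rfl, h⟩ | ⟨hr, hd, v, F, hm, hv, hF, h⟩ | ⟨hd, h⟩ := h1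
  · rw [← h, (rational_iff P hP).1 h2]
  · exact Subtype.ext (h.symm.trans ((not_isRational_iff hr hd hm hv hF).1 h2))
  · rw [← h, (not_isDominated_iff hd).1 h2]

theorem one (j : Γ.IsolatedPoint k ↪ Γ.schemeOver k) (p : Γ.schemeOver k) : ActsAs j 1 p p := by
  by_cases hd : Γ.IsDominated (support p.1)
  · by_cases hr : IsRational p.1
    · obtain ⟨P, rfl⟩ := hr.exists_eq
      exact (rational_iff P (isPt_vec_iff_isDominated.2 hd)).2 rfl
    · obtain ⟨v, hm, hv⟩ := hd.exists_isMaximalStar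
      exact (not_isRational_iff hr hd hm hv (IsCompatible.one_refl hm)).2
        (SemilinearAut.act_eq_self (fun _ => rfl) fun _ => rfl)
  · rw [not_isDominated_iff hd, map_one, map_one]
    rfl

theorem viaEmbedding_not_isDominated (hj : IsPlacement j) (hd : ¬ Γ.IsDominated (support p.1))
    (σ : Equiv.Perm (Γ.IsolatedPoint k)) :
    ¬ Γ.IsDominated (support (Equiv.Perm.viaEmbeddingHom j σ p).1) := by
  rw [Equiv.Perm.viaEmbeddingHom_apply]
  by_cases h : p ∈ Set.range j
  · obtain ⟨P, rfl⟩ := h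
    rw [Equiv.Perm.viaEmbedding_apply]
    exact hj.not_isDominated _
  · rwa [Equiv.Perm.viaEmbedding_apply_of_notMem _ _ _ h]

theorem mul (hj : IsPlacement j)
    (hk : Nat.card k ≠ 2 ∨ ∀ v, 3 < (Γ.looseStar v).ncard → {e : E | Γ.ends e = {v}}.Subsingleton)
    (h1 : ActsAs j g p p') (h2 : ActsAs j h p' p'') : ActsAs j (h * g) p p'' := by
  obtain ⟨P, hP, rfl, rfl⟩ | ⟨hr, hd, v, F, hm, hv, hF, h1⟩ | ⟨hd, rfl⟩ := h1
  · rw [rational_iff _ ((isPt_vec_apply_iff g P).2 hP)] at h2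
    rw [rational_iff _ hP, ← h2]
    rfl
  · obtain ⟨u, hu, hmap⟩ := hF.exists_map_eq hm
    obtain ⟨G, hG⟩ := IsCompatible.exists_of_isMaximalStar h hu (hk.imp id fun h => h u)
    have hr' : ¬ IsRational p'.1 := by
      rw [← h1]
      exact fun h => hr (isRational_of_act h)
    have hd' : Γ.IsDominated (support p'.1) := by
      rw [← h1]
      exact hF.isDominated_act hm hr hv hd
    have hu' : support p'.1 ⊆ Γ.looseStar u := by
      rw [← h1, support_eq, moduleSupport_subset_iff, SemilinearAut.linSpan_act, ← hmap]
      apply F.map_mono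
      rwa [← moduleSupport_subset_iff, ← support_eq]
    rw [not_isRational_iff hr' hd' hu hu' hG] at h2
    rw [not_isRational_iff hr hd hm hv (hF.trans hm hu hmap hG), SemilinearAut.act_trans, h1, h2]
  · rw [not_isDominated_iff (viaEmbedding_not_isDominated hj hd _)] at h2
    rw [not_isDominated_iff hd, map_mul, map_mul, ← h2]
    rfl

end ActsAs

section Action

variable (j : Γ.IsolatedPoint k ↪ Γ.schemeOver k)
  (hk : Nat.card k ≠ 2 ∨ ∀ v, 3 < (Γ.looseStar v).ncard → {e : E | Γ.ends e = {v}}.Subsingleton)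

/-- The action of a combinatorial automorphism on the points of the scheme: the map with the graph
`ActsAs j g`. -/
noncomputable def schemeMap (g : Γ.combAut k) (p : Γ.schemeOver k) : Γ.schemeOver k :=
  (ActsAs.exists_right j hk g p).choose

variable {j hk} {g h : Γ.combAut k} {p p' : Γ.schemeOver k}

theorem actsAs_schemeMap (hk : Nat.card k ≠ 2 ∨ ∀ v, 3 < (Γ.looseStar v).ncard →
    {e : E | Γ.ends e = {v}}.Subsingleton) (j : Γ.IsolatedPoint k ↪ Γ.schemeOver k)
    (g : Γ.combAut k) (p : Γ.schemeOver k) : ActsAs j g p (schemeMap j hk g p) :=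
  (ActsAs.exists_right j hk g p).choose_spec

theorem schemeMap_eq_iff : schemeMap j hk g p = p' ↔ ActsAs j g p p' :=
  ⟨fun h => h ▸ actsAs_schemeMap hk j g p, fun h => (actsAs_schemeMap hk j g p).unique h⟩

theorem schemeMap_one : schemeMap j hk 1 p = p := schemeMap_eq_iff.2 (ActsAs.one j p)

theorem schemeMap_mul (hj : IsPlacement j) :
    schemeMap j hk (h * g) p = schemeMap j hk h (schemeMap j hk g p) :=
  schemeMap_eq_iff.2 ((actsAs_schemeMap hk j g p).mul hj hk (actsAs_schemeMap hk j h _))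

theorem schemeMap_rationalPoint {P : Γ.RationalPoint k} (hP : Γ.IsPt P.vec) :
    schemeMap j hk g P.1 = (g.1.1 P).1 :=
  schemeMap_eq_iff.2 ((ActsAs.rational_iff P hP).2 rfl)

theorem schemeMap_isolatedPoint (hj : IsPlacement j) (P : Γ.IsolatedPoint k) :
    schemeMap j hk g (j P) = j (isolatedPerm g P) := by
  rw [schemeMap_eq_iff, ActsAs.not_isDominated_iff (hj.not_isDominated P),
    Equiv.Perm.viaEmbeddingHom_apply, Equiv.Perm.viaEmbedding_apply]

theorem schemeMap_injective (hj : IsPlacement j) : Function.Injective (schemeMap j hk g) := by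
  intro p q hpq
  have := congrArg (schemeMap j hk g⁻¹) hpq
  rwa [← schemeMap_mul hj, ← schemeMap_mul hj, inv_mul_cancel, schemeMap_one, schemeMap_one] at this

/-! ### Continuity -/

/-- On a component of dimension at least two, the action is that of a semilinear map. -/
theorem schemeMap_eq_act {v : V} {F : SemilinearAut k Γ.Completion} (hm : Γ.IsMaximalStar v)
    (h3 : 3 ≤ (Γ.looseStar v).ncard) (hF : (toCollineation g).Realizes v F)
    (hv : support p.1 ⊆ Γ.looseStar v) : (schemeMap j hk g p).1 = F.act p.1 := by
  have hd : Γ.IsDominated (support p.1) :=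
    IsDominated.mono ⟨v, Γ.inl_mem_looseStar_self v, subset_rfl, hm.1⟩ hv p.2
  by_cases hr : IsRational p.1
  · obtain ⟨P, rfl⟩ := hr.exists_eq
    have hP : Γ.IsPt P.vec := isPt_vec_iff_isDominated.2 hd
    rw [schemeMap_rationalPoint hP]
    obtain ⟨r, hr0, h1⟩ := hF.toFun_eq hm.1 h3 (x := P.vec) (by
      rw [mem_coordSubspace, P.support_vec]
      exact hv) hP
    change vecMap g.1.1 P.vec = _ at h1
    rw [vecMap_eq hP, RationalPoint.ratPt_vec] at h1
    have hne := P.vec_ne_zero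
    have hFne : F P.vec ≠ 0 := fun h0 => hne (F.map_eq_zero.1 h0)
    have h2 : (F.act P.1.1).linSpan = Submodule.span k {F P.vec} := by
      rw [SemilinearAut.linSpan_act, P.linSpan_eq, ← Set.pair_eq_singleton, F.map_span_pair,
        Set.pair_eq_singleton]
    have h3 : (g.1.1 P).1.1.linSpan ≤ Submodule.span k {F P.vec} := by
      rw [(g.1.1 P).linSpan_eq, h1, Submodule.span_singleton_le_iff_mem]
      exact Submodule.smul_mem _ _ (Submodule.mem_span_singleton_self _)
    rw [ProjectiveSpectrum.eq_ofCoords hFne h3, ProjectiveSpectrum.eq_ofCoords hFne h2.le]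
  · exact ((ActsAs.not_isRational_iff hr hd hm hv (Or.inl ⟨h3, hF⟩)).1
      (actsAs_schemeMap hk j g p)).symm

/-- An injective map of the scheme that maps a projective line with two coordinates to another, and
its generic point to the generic point, is continuous on this line, since all proper closed subsets
are finite sets of closed points. -/
theorem continuousOn_of_generic {f : Γ.schemeOver k → Γ.schemeOver k} (hf : Function.Injective f)
    {S T : Set Γ.Completion} (hS : S.ncard = 2) (hT : T.ncard = 2) (hSn : S.Nonempty)
    (hTn : T.Nonempty)
    (hST : ∀ p, support p.1 ⊆ S → support (f p).1 ⊆ T)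
    (hgen : ∀ p, p.1 = ProjectiveSpectrum.generic k S hSn →
      (f p).1 = ProjectiveSpectrum.generic k T hTn) :
    ContinuousOn f {p | support p.1 ⊆ S} := by
  have hX : ∀ {S : Set Γ.Completion} {p : Γ.Ambient k}, support p ⊆ S →
      ∀ i ∉ S, (X i : MvPolynomial Γ.Completion k) ∈ p.asHomogeneousIdeal := by
    intro S p hp i hi
    by_contra h
    exact hi (hp h)
  rw [continuousOn_iff_isClosed]
  intro Z hZ
  obtain ⟨Z, hZc, rfl⟩ := isClosed_induced_iff.1 hZ
  -- a closed set that contains the generic point of the image line contains the whole line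
  by_cases hg : ProjectiveSpectrum.generic k T hTn ∈ Z
  · refine ⟨Set.univ, isClosed_univ, ?_⟩
    rw [Set.univ_inter, Set.inter_eq_right]
    intro p hp
    have h1 : ProjectiveSpectrum.generic k T hTn ≤ (f p).1 :=
      ProjectiveSpectrum.generic_le (hX (hST p hp))
    rw [ProjectiveSpectrum.le_iff_mem_closure] at h1
    exact hZc.closure_subset_iff.2 (Set.singleton_subset_iff.2 hg) h1
  · have hfin := ProjectiveSpectrum.finite_of_generic_notMem hT hZc hg
    have hB : (f ⁻¹' (Subtype.val ⁻¹' Z) ∩ {p | support p.1 ⊆ S}).Finite := by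
      refine Set.Finite.of_injOn (f := fun p => (f p).1) (t := _) ?_ ?_ hfin
      · rintro p ⟨hp, hpS⟩
        exact ⟨hp, hX (hST p hpS)⟩
      · intro p _ q _ hpq
        exact hf (Subtype.ext hpq)
    refine ⟨_, ?_, (Set.inter_eq_left.2 Set.inter_subset_right).symm⟩
    rw [← Set.biUnion_of_singleton (f ⁻¹' (Subtype.val ⁻¹' Z) ∩ {p | support p.1 ⊆ S})]
    refine hB.isClosed_biUnion fun p hp => ?_
    have hne : p.1 ≠ ProjectiveSpectrum.generic k S hSn := by
      intro h
      exact hg (hgen p h ▸ hp.1)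
    have hc := ProjectiveSpectrum.isClosed_singleton_of_ne_generic hS (hX hp.2) hne
    have := hc.preimage (continuous_subtype_val (p := (· ∈ Γ.schemeOver k)))
    convert this using 1
    ext q
    simp [Subtype.ext_iff]

end Action

end LooseGraph

namespace LooseGraph

theorem _root_.SemilinearAut.act_mono {k ι : Type*} [Field k] [Fintype ι] {F : SemilinearAut k ι}
    {p q : ProjectiveSpectrum (homogeneousSubmodule ι k)} (h : p ≤ q) : F.act p ≤ F.act q :=
  fun _ hf => h hf

variable {V E : Type*} {Γ : LooseGraph V E} {k : Type*} [Field k] [Fintype V] [Fintype E]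

theorem not_isRational_generic {S : Set Γ.Completion} (hS : S.ncard = 2) {hSn : S.Nonempty} :
    ¬ IsRational (ProjectiveSpectrum.generic k S hSn : Γ.Ambient k) := by
  rintro ⟨x, -, h⟩
  obtain ⟨i, j, hij, hS⟩ := Set.ncard_eq_two.1 hS
  have key : ∀ i ∈ S, ∃ c : k, c • x = Set.indicator {i} 1 := by
    intro i hi
    have hne : Set.indicator {i} (1 : Γ.Completion → k) ≠ 0 := by
      intro h
      have := congrFun h i
      simp at this
    have h1 : ProjectiveSpectrum.generic k S hSn ≤ ProjectiveSpectrum.ofCoords k _ hne := by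
      refine ProjectiveSpectrum.generic_le fun l hl => ?_
      rw [ProjectiveSpectrum.X_mem_ofCoords]
      exact Set.indicator_of_notMem (fun h => hl (by rwa [Set.mem_singleton_iff.1 h])) _
    have h2 := ProjectiveSpectrum.linSpan_anti h1
    rw [ProjectiveSpectrum.linSpan_ofCoords, h, Submodule.span_singleton_le_iff_mem] at h2
    exact Submodule.mem_span_singleton.1 h2
  obtain ⟨a, ha⟩ := key i (by simp [hS])
  obtain ⟨b, hb⟩ := key j (by simp [hS])
  have h1 := congrFun ha i
  have h2 := congrFun ha j
  have h3 := congrFun hb i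
  have h4 := congrFun hb j
  simp [hij, hij.symm] at h1 h2 h3 h4
  rcases h3 with h3 | h3
  · simp [h3] at h4
  · simp [h3] at h1

theorem support_act_subset {F : SemilinearAut k Γ.Completion} {S T : Set Γ.Completion}
    (h : F.map (coordSubspace k S) = coordSubspace k T) {p : Γ.Ambient k} (hp : support p ⊆ S) :
    support (F.act p) ⊆ T := by
  rw [support_eq, moduleSupport_subset_iff] at hp ⊢
  rw [SemilinearAut.linSpan_act, ← h]
  exact F.map_mono hp

theorem act_generic {F : SemilinearAut k Γ.Completion} {S T : Set Γ.Completion}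
    (h : F.map (coordSubspace k S) = coordSubspace k T) {hS : S.Nonempty} {hT : T.Nonempty} :
    F.act (ProjectiveSpectrum.generic k S hS) = ProjectiveSpectrum.generic k T hT := by
  have h' : F.symm.map (coordSubspace k T) = coordSubspace k S := by
    rw [← h, F.symm_map_map]
  apply le_antisymm
  · rw [← F.act_act_symm (p := ProjectiveSpectrum.generic k T hT)]
    apply SemilinearAut.act_mono
    exact ProjectiveSpectrum.generic_le
      (X_mem_of_support_subset (Γ := Γ) (support_act_subset h' support_generic.subset))
  · exact ProjectiveSpectrum.generic_le
      (X_mem_of_support_subset (Γ := Γ) (support_act_subset h support_generic.subset))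

theorem support_eq_completedEnds {e : E} (he : Γ.ends e = ∅) {p : Γ.schemeOver k}
    (hp : support p.1 ⊆ Γ.completedEnds e) : support p.1 = Γ.completedEnds e := by
  obtain ⟨v, hv, -⟩ | ⟨e', he', h⟩ := p.2
  · have := hp hv
    rw [inl_mem_completedEnds, he] at this
    simp at this
  · refine Set.eq_of_subset_of_ncard_le hp ?_ (Set.toFinite _)
    rw [h, ncard_completedEnds_of_ends_eq_empty he, ncard_completedEnds_of_ends_eq_empty he']

variable {j : Γ.IsolatedPoint k ↪ Γ.schemeOver k}
  {hk : Nat.card k ≠ 2 ∨ ∀ v, 3 < (Γ.looseStar v).ncard → {e : E | Γ.ends e = {v}}.Subsingleton}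
  {g : Γ.combAut k}

theorem continuousOn_schemeMap_looseStar (hj : IsPlacement j) {v : V} (hm : Γ.IsMaximalStar v) :
    ContinuousOn (schemeMap j hk g) {p | support p.1 ⊆ Γ.looseStar v} := by
  obtain ⟨F, hF⟩ := IsCompatible.exists_of_isMaximalStar g hm (hk.imp id fun h => h v)
  obtain ⟨h3, hF'⟩ | ⟨u, hv, hu, hmu, hW, hF'⟩ := id hF
  · rw [Topology.IsInducing.subtypeVal.continuousOn_iff]
    refine ContinuousOn.congr (F.act.continuous.comp continuous_subtype_val).continuousOn ?_
    intro p hp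
    exact schemeMap_eq_act hm h3 hF' hp
  · have hmap := hF'.map_coordSubspace
    have hd : ∀ p : Γ.schemeOver k, support p.1 ⊆ Γ.looseStar v → Γ.IsDominated (support p.1) :=
      fun p hp => IsDominated.mono ⟨v, Γ.inl_mem_looseStar_self v, subset_rfl, hm.1⟩ hp p.2
    refine continuousOn_of_generic (schemeMap_injective hj) hv hu
      (looseStar_nonempty v) (looseStar_nonempty u) ?_ ?_
    · intro p hp
      by_cases hr : IsRational p.1
      · obtain ⟨P, rfl⟩ := hr.exists_eq
        rw [schemeMap_rationalPoint (isPt_vec_iff_isDominated.2 (hd _ hp)),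
          ← RationalPoint.support_vec]
        have hL := isLn_coordSubspace (k := k) hm.1 hv
        have h1 : Incident P hL.line := by
          rw [incident_iff]
          change P.vec ∈ coordSubspace k (Γ.looseStar v)
          rwa [mem_coordSubspace, P.support_vec]
        rw [← g.2, incident_iff, ← lineMap_eq hL, hW] at h1
        exact h1
      · rw [← (ActsAs.not_isRational_iff hr (hd p hp) hm hp hF).1 (actsAs_schemeMap hk j g p)]
        exact support_act_subset hmap hp
    · intro p hp
      have hr : ¬ IsRational p.1 := by
        rw [hp]
        exact not_isRational_generic hv
      have hs : support p.1 ⊆ Γ.looseStar v := by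
        rw [hp, support_generic]
      rw [← (ActsAs.not_isRational_iff hr (hd p hs) hm hs hF).1 (actsAs_schemeMap hk j g p), hp]
      exact act_generic hmap

theorem continuousOn_schemeMap_completedEnds (hj : IsPlacement j) {e : E} (he : Γ.ends e = ∅) :
    ContinuousOn (schemeMap j hk g) {p | support p.1 ⊆ Γ.completedEnds e} := by
  have hdom : ∀ p : Γ.schemeOver k, support p.1 ⊆ Γ.completedEnds e →
      ¬ Γ.IsDominated (support p.1) := by
    intro p hp
    rw [support_eq_completedEnds he hp]
    exact not_isDominated_completedEnds he
  have hfix : ∀ p : Γ.schemeOver k, support p.1 ⊆ Γ.completedEnds e → p ∉ Set.range j →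
      schemeMap j hk g p = p := by
    intro p hp hpj
    rw [schemeMap_eq_iff, ActsAs.not_isDominated_iff (hdom p hp), Equiv.Perm.viaEmbeddingHom_apply,
      Equiv.Perm.viaEmbedding_apply_of_notMem _ _ _ hpj]
  have hc := ncard_completedEnds_of_ends_eq_empty he
  refine continuousOn_of_generic (schemeMap_injective hj) hc hc (completedEnds_nonempty he)
    (completedEnds_nonempty he) ?_ ?_
  · intro p hp
    by_cases hpj : p ∈ Set.range j
    · obtain ⟨P, rfl⟩ := hpj
      rw [schemeMap_isolatedPoint hj]
      exact (hj.support_eq P _ e he (support_eq_completedEnds he hp)).subset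
    · rwa [hfix p hp hpj]
  · intro p hp
    rw [hfix p, hp]
    · rw [hp, support_generic]
    · rintro ⟨P, rfl⟩
      exact hj.ne_generic P e he hp

theorem subsingleton_of_not_nontrivial {v : V} (hn : ¬ (Γ.looseStar v).Nontrivial) :
    {p : Γ.schemeOver k | support p.1 ⊆ Γ.looseStar v}.Subsingleton := by
  rw [Set.not_nontrivial_iff] at hn
  have hne : Set.indicator {Sum.inl v} (1 : Γ.Completion → k) ≠ 0 := by
    intro h
    have := congrFun h (Sum.inl v)
    simp at this
  have key : ∀ p : Γ.schemeOver k, support p.1 ⊆ Γ.looseStar v →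
      p.1 = ProjectiveSpectrum.ofCoords k _ hne := by
    intro p hp
    apply ProjectiveSpectrum.eq_ofCoords
    rw [support_eq, moduleSupport_subset_iff] at hp
    refine hp.trans (coordSubspace_le_of_indicator_mem fun i hi => ?_)
    rw [hn hi (Γ.inl_mem_looseStar_self v)]
    exact Submodule.mem_span_singleton_self _
  intro p hp q hq
  exact Subtype.ext ((key p hp).trans (key q hq).symm)

/-- The scheme is the union of finitely many closed subsets, one for every vertex and one for every
edge without end vertices, and the action is continuous on each of them. -/
theorem continuous_schemeMap (hj : IsPlacement j) : Continuous (schemeMap j hk g) := by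
  let A : V ⊕ {e : E // Γ.ends e = ∅} → Set (Γ.schemeOver k) := fun i =>
    {p | support p.1 ⊆ Sum.elim Γ.looseStar (fun e => Γ.completedEnds e.1) i}
  refine LocallyFinite.continuous (f := A) (locallyFinite_of_finite A) ?_
    (fun i => isClosed_setOf_support_subset _) ?_
  · refine Set.eq_univ_of_forall fun p => Set.mem_iUnion.2 ?_
    obtain ⟨v, -, hv⟩ | ⟨e, he, h⟩ := p.2
    · exact ⟨Sum.inl v, hv⟩
    · exact ⟨Sum.inr ⟨e, he⟩, h.subset⟩
  · rintro (v | ⟨e, he⟩)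
    · by_cases hn : (Γ.looseStar v).Nontrivial
      · obtain ⟨u, hu, huv⟩ := exists_isMaximalStar_of_nontrivial hn
        exact (continuousOn_schemeMap_looseStar hj hu).mono fun p hp => Set.Subset.trans hp huv
      · exact (subsingleton_of_not_nontrivial hn).continuousOn _
    · exact continuousOn_schemeMap_completedEnds hj he

/-- A combinatorial automorphism is determined by its action on the rational points. -/
theorem eq_one_of_forall_eq (g : Γ.combAut k) (h : ∀ P, g.1.1 P = P) : g = 1 := by
  refine Subtype.ext (Prod.ext (Equiv.ext h) (Equiv.ext fun L => ?_))
  obtain ⟨x, y, hx, hy, hxy, hL⟩ := (isLn_of_line L).exists_pair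
  have key : ∀ z ∈ L.1, Γ.IsPt z → z ∈ (g.1.2 L).1 := by
    intro z hz hzp
    rw [← incident_ratPt hzp.mem_monoidalPoints, ← h (ratPt z hzp.mem_monoidalPoints), g.2,
      incident_ratPt]
    exact hz
  apply Subtype.ext
  change (g.1.2 L).1 = L.1
  rw [(isLn_of_line (g.1.2 L)).eq_span
    (key x (by rw [hL]; exact Submodule.subset_span (by simp)) hx)
    (key y (by rw [hL]; exact Submodule.subset_span (by simp)) hy) hx.ne_zero hxy]
  exact hL.symm

/-- The homomorphism from the combinatorial to the topological automorphism group, given a placement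
of the isolated rational points. -/
noncomputable def schemeHom (hk : Nat.card k ≠ 2 ∨ ∀ v, 3 < (Γ.looseStar v).ncard →
    {e : E | Γ.ends e = {v}}.Subsingleton) (hj : IsPlacement j) :
    Γ.combAut k →* (Γ.schemeOver k ≃ₜ Γ.schemeOver k) where
  toFun g :=
    { toFun := schemeMap j hk g
      invFun := schemeMap j hk g⁻¹
      left_inv := fun p => by rw [← schemeMap_mul hj, inv_mul_cancel, schemeMap_one (hk := hk)]
      right_inv := fun p => by rw [← schemeMap_mul hj, mul_inv_cancel, schemeMap_one]
      continuous_toFun := continuous_schemeMap hj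
      continuous_invFun := continuous_schemeMap hj }
  map_one' := Homeomorph.ext fun _ => schemeMap_one (hk := hk)
  map_mul' _ _ := Homeomorph.ext fun _ => schemeMap_mul (hk := hk) hj

theorem schemeHom_apply (hj : IsPlacement j) (g : Γ.combAut k) (p : Γ.schemeOver k) :
    schemeHom hk hj g p = schemeMap j hk g p := rfl

theorem schemeHom_injective (hj : IsPlacement j) : Function.Injective (schemeHom hk hj) := by
  rw [injective_iff_map_eq_one]
  intro g hg
  have hfix : ∀ p, schemeMap j hk g p = p := fun p => congrArg (fun f => f p) hg
  refine eq_one_of_forall_eq g fun P => ?_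
  by_cases hP : Γ.IsPt P.vec
  · have := hfix P.1
    rw [schemeMap_rationalPoint hP] at this
    exact Subtype.ext this
  · have := hfix (j ⟨P, hP⟩)
    rw [schemeMap_isolatedPoint hj] at this
    exact congrArg Subtype.val (j.injective this)

/-! ### Placements of the isolated rational points -/

/-- The inclusion of the isolated rational points is a placement if all of them lie in the same
multiplicative group, or none of them does. -/
theorem isPlacement_inclusion (h : ∀ e : E, Γ.ends e = ∅ →
    (∀ e' : E, Γ.ends e' = ∅ → e' = e) ∧ ∀ v : V, ∃ e' : E, v ∈ Γ.ends e') :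
    IsPlacement (⟨fun P => P.1.1, fun _ _ h => Subtype.ext (Subtype.ext h)⟩ :
      Γ.IsolatedPoint k ↪ Γ.schemeOver k) where
  not_isDominated P := isPt_vec_iff_isDominated.not.1 P.2
  support_eq P Q e he _ := by
    obtain ⟨v, hv, hs⟩ | ⟨e', he', hs⟩ := Q.1.1.2
    · exfalso
      obtain ⟨e', hve⟩ := (h e he).2 v
      exact isPt_vec_iff_isDominated.not.1 Q.2 ⟨v, hv, hs, nontrivial_looseStar hve⟩
    · rw [(h e he).1 e' he'] at hs
      exact hs
  ne_generic P e he hP :=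
    not_isRational_generic (ncard_completedEnds_of_ends_eq_empty he) (hP ▸ P.1.isRational)

theorem _root_.nonempty_embedding_ne_zero (C k : Type*) [Finite C] [Field k] [Infinite k] :
    Nonempty ((C → k) ↪ {c : k // c ≠ 0}) := by
  have := Fintype.ofFinite C
  have h1 : Cardinal.mk {c : k // c ≠ 0} = Cardinal.mk k := by
    refine Cardinal.mk_compl_of_infinite {0} ?_
    rw [Cardinal.mk_singleton]
    exact Cardinal.one_lt_aleph0.trans_le (Cardinal.aleph0_le_mk k)
  have h2 : Nonempty ((C → k) ↪ k) := by
    rw [← Cardinal.lift_mk_le', Cardinal.mk_arrow, Cardinal.mk_fintype C, Cardinal.lift_natCast,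
      Cardinal.power_natCast]
    have h3 : Cardinal.aleph0 ≤ Cardinal.lift (Cardinal.mk k) :=
      Cardinal.aleph0_le_lift.2 (Cardinal.aleph0_le_mk k)
    refine (Cardinal.lift_le.2 (Cardinal.power_nat_le h3)).trans ?_
    rw [Cardinal.lift_lift]
  obtain ⟨f⟩ := h2
  obtain ⟨e⟩ := Cardinal.eq.1 h1
  exact ⟨f.trans e.symm.toEmbedding⟩

/-- If there is a multiplicative group among the components, then its non-generic points provide
enough room for all isolated rational points: there are infinitely many of them, and as many
rational ones as there are scalars if the field is infinite. -/
theorem exists_isPlacement {e : E} (he : Γ.ends e = ∅) :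
    ∃ j : Γ.IsolatedPoint k ↪ Γ.schemeOver k, IsPlacement j := by
  obtain ⟨a, b, hab, hS, -, -⟩ := completedEnds_eq_of_ends_eq_empty he
  have hc := ncard_completedEnds_of_ends_eq_empty he
  let T : Set (Γ.schemeOver k) := {p | support p.1 = Γ.completedEnds e ∧
    p.1 ≠ ProjectiveSpectrum.generic k (Γ.completedEnds e) (completedEnds_nonempty he)}
  have hmem : Γ.completedEnds e ∈ Γ.monoidalPoints := Or.inr ⟨e, he, rfl⟩
  have hvec : Function.Injective (RationalPoint.vec : Γ.RationalPoint k → _) := by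
    intro P Q h
    apply RationalPoint.ext_linSpan
    rw [P.linSpan_eq, Q.linSpan_eq, h]
  have hemb : Nonempty (Γ.IsolatedPoint k ↪ T) := by
    rcases finite_or_infinite k with hfin | hinf
    · have hfinI : Finite (Γ.IsolatedPoint k) :=
        Finite.of_injective (fun P => P.1.vec) (hvec.comp Subtype.val_injective)
      have hinfT : Infinite T := by
        rw [Set.infinite_coe_iff]
        have ha0 : Set.indicator {a} (1 : Γ.Completion → k) ≠ 0 := by
          intro h
          have := congrFun h a
          simp at this
        have hba : Set.indicator {b} (1 : Γ.Completion → k) ∉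
            Submodule.span k {Set.indicator {a} 1} := by
          intro h
          obtain ⟨c, hc⟩ := Submodule.mem_span_singleton.1 h
          have := congrFun hc b
          simp [hab.symm] at this
        have h1 := (ProjectiveSpectrum.infinite_setOf_moduleSupport_eq ha0 hba).sdiff
          (Set.finite_singleton
            (ProjectiveSpectrum.generic k (Γ.completedEnds e) (completedEnds_nonempty he)))
        refine Set.Infinite.of_image Subtype.val (h1.mono ?_)
        rintro p ⟨⟨-, hp⟩, hne⟩
        rw [← coordSubspace_pair, moduleSupport_coordSubspace, ← hS, ← support_eq] at hp
        exact ⟨⟨p, by rw [schemeOver, Set.mem_ofPred_eq, hp]; exact hmem⟩, ⟨hp, hne⟩, rfl⟩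
      have := Fintype.ofFinite (Γ.IsolatedPoint k)
      exact ⟨(Fintype.equivFin _).toEmbedding.trans
        (Fin.valEmbedding.trans (Infinite.natEmbedding T))⟩
    · obtain ⟨f⟩ := nonempty_embedding_ne_zero Γ.Completion k
      let z : k → Γ.Completion → k := fun c =>
        Set.indicator {a} 1 + c • Set.indicator {b} 1
      have hz : ∀ c, c ≠ 0 → Function.support (z c) = Γ.completedEnds e := by
        intro c hc
        ext i
        rw [hS]
        by_cases hia : i = a
        · subst hia
          simp [z, hab]
        · by_cases hib : i = b
          · subst hib
            simp [z, hab.symm, hc]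
          · simp [z, hia, hib]
      let P : {c : k // c ≠ 0} → Γ.RationalPoint k := fun c =>
        ratPt (z c) ((hz c c.2).symm ▸ hmem)
      have hPT : ∀ c, (P c).1 ∈ T := by
        intro c
        refine ⟨?_, fun h => not_isRational_generic hc (h ▸ (P c).isRational)⟩
        rw [← hz c c.2]
        exact support_ofCoords (hx := ne_zero_of_support_mem ((hz c c.2).symm ▸ hmem))
      have hP : Function.Injective P := by
        intro c d hcd
        have h1 : z c ∈ Submodule.span k {z d} := by
          rw [← linSpan_ratPt ((hz d d.2).symm ▸ hmem)]
          change z c ∈ (P d).1.1.linSpan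
          rw [← hcd]
          change z c ∈ (ratPt (z c) _).1.1.linSpan
          rw [linSpan_ratPt]
          exact Submodule.mem_span_singleton_self _
        obtain ⟨r, hr⟩ := Submodule.mem_span_singleton.1 h1
        have h2 := congrFun hr a
        have h3 := congrFun hr b
        simp [z, hab, hab.symm] at h2 h3
        rw [h2, one_mul] at h3
        exact Subtype.ext h3.symm
      exact ⟨⟨fun Q => ⟨(P (f Q.1.vec)).1, hPT _⟩, fun Q R h =>
        Subtype.ext (hvec (f.injective (hP (Subtype.ext (congrArg (fun x : T => x.1) h)))))⟩⟩
  obtain ⟨f⟩ := hemb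
  refine ⟨f.trans (Function.Embedding.subtype _), fun P => ?_, fun P Q e' he' h => ?_,
    fun P e' he' h => ?_⟩
  · change ¬ Γ.IsDominated (support (f P).1.1)
    rw [(f P).2.1]
    exact not_isDominated_completedEnds he
  · change support (f P).1.1 = _ at h
    change support (f Q).1.1 = _
    rw [(f Q).2.1, ← (f P).2.1, h]
  · change (f P).1.1 = _ at h
    have h1 := (f P).2.1
    rw [h, support_generic] at h1
    apply (f P).2.2
    rw [h]
    simp only [h1]

end LooseGraph

theorem mainTheorem10 {V E : Type*} [Fintype V] [Fintype E] (Γ : LooseGraph V E)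
    (k : Type*) [Field k]
    (hk : Nat.card k ≠ 2 ∨ ∀ v : V, 2 < {e : E | v ∈ Γ.ends e}.ncard →
      {e : E | Γ.ends e = {v}}.Subsingleton) :
    ∃ φ : Γ.combAut k →* (Γ.schemeOver k ≃ₜ Γ.schemeOver k),
      Function.Injective φ ∧
      ((∀ e : E, Γ.ends e = ∅ →
          (∀ e' : E, Γ.ends e' = ∅ → e' = e) ∧ ∀ v : V, ∃ e' : E, v ∈ Γ.ends e') →
        ∀ (g : Γ.combAut k) (p : Γ.RationalPoint k), φ g p.1 = (g.1.1 p).1) := by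
  have hk' : Nat.card k ≠ 2 ∨ ∀ v, 3 < (Γ.looseStar v).ncard →
      {e : E | Γ.ends e = {v}}.Subsingleton := by
    refine hk.imp id fun h v hv => h v ?_
    have := LooseGraph.ncard_looseStar_le (Γ := Γ) v
    omega
  by_cases hs : ∀ e : E, Γ.ends e = ∅ →
      (∀ e' : E, Γ.ends e' = ∅ → e' = e) ∧ ∀ v : V, ∃ e' : E, v ∈ Γ.ends e'
  · have hj := LooseGraph.isPlacement_inclusion (k := k) hs
    refine ⟨LooseGraph.schemeHom hk' hj, LooseGraph.schemeHom_injective hj, fun _ g p => ?_⟩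
    rw [LooseGraph.schemeHom_apply]
    by_cases hp : Γ.IsPt p.vec
    · exact LooseGraph.schemeMap_rationalPoint hp
    · exact LooseGraph.schemeMap_isolatedPoint hj ⟨p, hp⟩
  · obtain ⟨e, he, -⟩ := not_forall₂.1 hs
    obtain ⟨j, hj⟩ := LooseGraph.exists_isPlacement (k := k) he
    exact ⟨LooseGraph.schemeHom hk' hj, LooseGraph.schemeHom_injective hj, fun h => absurd h hs⟩
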